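/- Fix $0<\delta<1$. There is a constant $C_\delta$, depending only on $\delta$, such that the following holds. Let $n\ge 0$ be an integer, let $Q\in\mathbb{R}[x_1,\dots,x_n]$ be a polynomial of (total) degree at most $2$, and let $\zeta_1,\dots,\zeta_n\in\mathbb{R}$ be independent discrete random variables. Here the support of $\zeta_i$ is the set $\{x\in\mathbb{R}:\Pr[\zeta_i=x]>0\}$. For nonempty subsets $R_1,\dots,R_n$ of the supports of $\zeta_1,\dots,\zeta_n$, respectively, say that the product $R_1\times\dots\times R_n$ is a fixing box for $Q$ if $Q$ is constant on $R_1\times\dots\times R_n$. For some positive integer $m$, suppose that for every fixing box $R_1\times\dots\times R_n$ there are at least $m$ indices $i\in\{1,\dots,n\}$ such that $\Pr[\zeta_i\in R_i]\le 1-\delta$. Then $$\sup_{z\in\mathbb{R}}\Pr[Q(\zeta_1,\dots,\zeta_n)=z]\le\frac{C_\delta}{\sqrt m}.$$ -/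

import Mathlib

open MeasureTheory ProbabilityTheory

namespace QuadLO

/-- A real random variable is discrete if it almost surely takes values in some countable set. -/
def IsDiscreteRV {Ω : Type*} [MeasurableSpace Ω] (P : Measure Ω) (X : Ω → ℝ) : Prop :=
  Measurable X ∧ ∃ S : Set ℝ, S.Countable ∧ ∀ᵐ ω ∂P, X ω ∈ S

/-- The support of a discrete random variable: the values taken with positive probability. -/
def discreteSupport {Ω : Type*} [MeasurableSpace Ω] (P : Measure Ω) (X : Ω → ℝ) : Set ℝ :=
  {x | 0 < P.real {ω | X ω = x}}

/-- The product `R 0 × ⋯ × R (n - 1)` of nonempty subsets of the supports of the `ζ i` is a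
fixing box for `Q` if `Q` is constant on it. -/
structure IsFixingBox {Ω : Type*} [MeasurableSpace Ω] (P : Measure Ω) {n : ℕ}
    (ζ : Fin n → Ω → ℝ) (Q : MvPolynomial (Fin n) ℝ) (R : Fin n → Set ℝ) : Prop where
  nonempty : ∀ i, (R i).Nonempty
  subset_support : ∀ i, R i ⊆ discreteSupport P (ζ i)
  constant : ∃ c : ℝ, ∀ x ∈ Set.pi Set.univ R, MvPolynomial.eval x Q = c

end QuadLO

/-! The core is the case of independent random signs: if the mixed coefficients of a quadratic
polynomial are nonzero on m disjoint pairs of coordinates, every value has probability O(1/√m)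
(`exists_pr_quad_le_of_matching`). Decoupling squares the probability and subtracts the quadratic
equations of two outcomes that share some coordinates; the linear equation that results would alone
cost a square root. So the quadratic equation is kept next to the new linear one, and a stronger
family of bounds is proved: k linear constraints L ξ = v and a quadratic equation hold together with
probability O(s^(-(k+1)/2)), provided there are s disjoint pairs of coordinate sets on which L is
onto and the bilinear form does not vanish on the kernel of L (`IsGood`).

One decoupling step (`pr_quad_sq_le_of_highRank`) bounds the square of the k-th probability
essentially by s^(-k/2), the price of L agreeing on the two outcomes, times the (k+1)-th
probability. Since s^(-k/2) s^(-(k+2)/2) = s^(-(k+1)), nothing is lost. The recursion climbs in k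
without end, but each step takes a square root: starting from the linear bound, which is off by √s,
j steps leave a loss s^(1/2^(j+1)), eventually at most 2, and the constants survive because they
grow slower than squaring allows (`pr_quad_le_of_recursion`).

The step needs many disjoint pairs of rank three: adding a constraint costs rank two, and three
extra dimensions make it rare that most pairs fail to see the new constraint (`pr_many_triples_le`).
Without such pairs the form, off few coordinates and on a fibre of L, is a diagonal form plus one of
rank at most two; the diagonal part is constant on signs, so what remains is a quadratic polynomial
in at most k + 5 linear forms (`pr_quad_le_of_lowRank`), handled by `pr_quadric_le`. Linear forms
are governed throughout by Halász's inequality (`pr_linear_le`).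

For general variables each coordinate is drawn as a pair of values from which a random sign selects
one; a coordinate with an atom heavier than 1 - δ is coupled so that one member of its pair is
always that atom. After the pairs of these coordinates are revealed, consider the relevant nonzero
mixed coefficients as edges of a graph. A matching of size of order m reduces to signs. Otherwise
fewer than m/2 coordinates cover all edges; fixing them makes the polynomial a sum of univariate
terms, and a box of level sets and atoms is fixing, so the hypothesis forces at least m/2 spread
summands (`measure_quad_le_of_cover`). -/

namespace QuadLO

/-! ### Coordinate subspaces and linear maps that are onto from them. -/

section Coordinates

variable {ι : Type*} {W V : Type*} [AddCommGroup W] [Module ℝ W] [AddCommGroup V] [Module ℝ V]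

/-- The vectors supported in the set `T` of coordinates. -/
def supp (T : Finset ι) : Submodule ℝ (ι → ℝ) where
  carrier := {x | ∀ i, i ∉ T → x i = 0}
  add_mem' := by
    intro a b ha hb i hi
    simp [ha i hi, hb i hi]
  zero_mem' := by simp
  smul_mem' := by
    intro c x hx i hi
    simp [hx i hi]

theorem supp_mono {S T : Finset ι} (h : S ⊆ T) : supp S ≤ supp T :=
  fun _ hx i hi => hx i fun hS => hi (h hS)

/-- `L` maps the vectors supported in `T` onto the whole target. -/
def Onto (L : (ι → ℝ) →ₗ[ℝ] W) (T : Finset ι) : Prop := ∀ w, ∃ x ∈ supp T, L x = w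

theorem Onto.mono {L : (ι → ℝ) →ₗ[ℝ] W} {S T : Finset ι} (h : Onto L S) (hST : S ⊆ T) :
    Onto L T := fun w => let ⟨x, hx, hw⟩ := h w; ⟨x, supp_mono hST hx, hw⟩

theorem Onto.comp {L : (ι → ℝ) →ₗ[ℝ] W} {T : Finset ι} (h : Onto L T) {f : W →ₗ[ℝ] V}
    (hf : Function.Surjective f) : Onto (f ∘ₗ L) T := by
  intro v
  obtain ⟨w, rfl⟩ := hf v
  obtain ⟨x, hx, rfl⟩ := h w
  exact ⟨x, hx, rfl⟩

theorem Onto.surjective {L : (ι → ℝ) →ₗ[ℝ] W} {T : Finset ι} (h : Onto L T) :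
    Function.Surjective L := fun w => let ⟨x, _, hw⟩ := h w; ⟨x, hw⟩

theorem Onto.exists_section {L : (ι → ℝ) →ₗ[ℝ] W} {T : Finset ι} (h : Onto L T) :
    ∃ σ : W →ₗ[ℝ] (ι → ℝ), (∀ w, σ w ∈ supp T) ∧ ∀ w, L (σ w) = w := by
  have hs : LinearMap.range (L.domRestrict (supp T)) = ⊤ := by
    rw [LinearMap.range_eq_top]
    intro w
    obtain ⟨x, hx, hw⟩ := h w
    exact ⟨⟨x, hx⟩, hw⟩
  obtain ⟨g, hg⟩ := (L.domRestrict (supp T)).exists_rightInverse_of_surjective hs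
  refine ⟨(supp T).subtype ∘ₗ g, fun w => (g w).2, fun w => ?_⟩
  exact congrArg (fun f : W →ₗ[ℝ] W => f w) hg

/-- A proper subspace lies in a hyperplane. The functional is a certificate of degeneracy; it later
supplies the sparse functionals. -/
theorem not_onto_iff {L : (ι → ℝ) →ₗ[ℝ] W} {T : Finset ι} :
    ¬ Onto L T ↔ ∃ θ : W →ₗ[ℝ] ℝ, θ ≠ 0 ∧ ∀ x ∈ supp T, θ (L x) = 0 := by
  constructor
  · intro h
    have hlt : (supp T).map L < ⊤ := by
      rw [lt_top_iff_ne_top]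
      intro htop
      refine h fun w => ?_
      have : w ∈ (supp T).map L := by rw [htop]; trivial
      obtain ⟨x, hx, hw⟩ := this
      exact ⟨x, hx, hw⟩
    obtain ⟨θ, hθ, hle⟩ := Submodule.exists_le_ker_of_lt_top _ hlt
    exact ⟨θ, hθ, fun x hx => hle ⟨x, hx, rfl⟩⟩
  · rintro ⟨θ, hθ, h⟩ hO
    refine hθ (LinearMap.ext fun w => ?_)
    obtain ⟨x, hx, rfl⟩ := hO w
    exact h x hx

variable [DecidableEq ι]

theorem single_mem_supp {T : Finset ι} {i : ι} (hi : i ∈ T) (a : ℝ) : Pi.single i a ∈ supp T := by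
  intro j hj
  rw [Pi.single_eq_of_ne]
  rintro rfl
  exact hj hi

theorem eq_sum_single_of_mem_supp {T : Finset ι} {x : ι → ℝ} (hx : x ∈ supp T) :
    x = ∑ i ∈ T, x i • Pi.single i (1 : ℝ) := by
  ext j
  rw [Finset.sum_apply]
  by_cases hj : j ∈ T
  · rw [Finset.sum_eq_single j]
    · simp
    · intro b _ hb
      simp [hb.symm]
    · exact fun h => absurd hj h
  · rw [hx j hj, Finset.sum_eq_zero]
    intro i hi
    have : j ≠ i := by rintro rfl; exact hj hi
    simp [this]

theorem map_eq_sum_of_mem_supp (L : (ι → ℝ) →ₗ[ℝ] W) {T : Finset ι} {x : ι → ℝ}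
    (hx : x ∈ supp T) : L x = ∑ i ∈ T, x i • L (Pi.single i 1) := by
  conv_lhs => rw [eq_sum_single_of_mem_supp hx]
  simp [map_sum]

/-- A surjection from the vectors supported in `T` restricts to one from those supported in a small
linearly independent set of coordinates. -/
theorem Onto.exists_basis [FiniteDimensional ℝ W] {L : (ι → ℝ) →ₗ[ℝ] W} {T : Finset ι}
    (h : Onto L T) : ∃ T' ⊆ T, T'.card = Module.finrank ℝ W ∧ Onto L T' ∧
      LinearIndepOn ℝ (fun i => L (Pi.single i 1)) (T' : Set ι) := by
  set v : ι → W := fun i => L (Pi.single i 1) with hv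
  have hspan : Submodule.span ℝ (v '' (T : Set ι)) = ⊤ := by
    rw [eq_top_iff]
    intro w _
    obtain ⟨x, hx, rfl⟩ := h w
    rw [map_eq_sum_of_mem_supp L hx]
    exact Submodule.sum_mem _ fun i hi =>
      Submodule.smul_mem _ _ (Submodule.subset_span ⟨i, hi, rfl⟩)
  obtain ⟨b, hbT, -, hTb, hli⟩ :=
    exists_linearIndepOn_extension (K := ℝ) (v := v) (s := ∅) (t := (T : Set ι))
      (linearIndepOn_empty _ _) (Set.empty_subset _)
  have hfin : b.Finite := T.finite_toSet.subset hbT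
  have hspan' : Submodule.span ℝ (v '' b) = ⊤ := by
    rw [eq_top_iff, ← hspan]
    exact Submodule.span_le.2 hTb
  refine ⟨hfin.toFinset, by simpa using hbT, ?_, ?_, by simpa using hli⟩
  · have hli' : LinearIndependent ℝ (fun i : b => v i) := hli
    have hb : ⊤ ≤ Submodule.span ℝ (Set.range fun i : b => v i) := by
      rw [← hspan', Set.image_eq_range]
    have : Fintype b := hfin.fintype
    have := Module.finrank_eq_card_basis (Module.Basis.mk hli' hb)
    rw [this, Set.Finite.card_toFinset]
  · intro w
    have : w ∈ Submodule.span ℝ (v '' b) := by rw [hspan']; trivial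
    have hmem : Submodule.span ℝ (v '' b) ≤ (supp hfin.toFinset).map L := by
      rw [Submodule.span_le]
      rintro _ ⟨i, hi, rfl⟩
      exact ⟨Pi.single i 1, single_mem_supp (by simpa using hi) 1, rfl⟩
    obtain ⟨x, hx, hw⟩ := hmem this
    exact ⟨x, hx, hw⟩

/-- The coordinate projection onto the vectors supported in `S`. -/
def proj (S : Finset ι) : (ι → ℝ) →ₗ[ℝ] (ι → ℝ) where
  toFun x i := if i ∈ S then x i else 0
  map_add' x y := by ext i; by_cases h : i ∈ S <;> simp [h]
  map_smul' c x := by ext i; by_cases h : i ∈ S <;> simp [h]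

theorem proj_apply (S : Finset ι) (x : ι → ℝ) (i : ι) :
    proj S x i = if i ∈ S then x i else 0 := rfl

theorem proj_mem_supp (S : Finset ι) (x : ι → ℝ) : proj S x ∈ supp S := by
  intro i hi
  simp [proj_apply, hi]

theorem proj_eq_self {S : Finset ι} {x : ι → ℝ} (hx : x ∈ supp S) : proj S x = x := by
  ext i
  by_cases h : i ∈ S
  · simp [proj_apply, h]
  · simp [proj_apply, h, hx i h]

theorem proj_eq_zero {S T : Finset ι} {x : ι → ℝ} (hx : x ∈ supp T) (h : Disjoint S T) :
    proj S x = 0 := by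
  ext i
  by_cases hi : i ∈ S
  · simp [proj_apply, hi, hx i (Finset.disjoint_left.1 h hi)]
  · simp [proj_apply, hi]

theorem Onto.proj {L : (ι → ℝ) →ₗ[ℝ] W} {S T : Finset ι} (h : Onto L T) (hTS : T ⊆ S) :
    Onto (L ∘ₗ proj S) T := by
  intro w
  obtain ⟨x, hx, hw⟩ := h w
  exact ⟨x, hx, by simp [proj_eq_self (supp_mono hTS hx), hw]⟩

/-- Either there are `s` disjoint sets of size at most `N` with a given property, or a small set
meets all of them. -/
theorem exists_disjoint_or_cover (p : Finset ι → Prop) (N s : ℕ) :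
    (∃ T : Fin s → Finset ι, Pairwise (fun a b => Disjoint (T a) (T b)) ∧
      ∀ b, p (T b) ∧ (T b).card ≤ N) ∨
    ∃ S : Finset ι, S.card ≤ (s - 1) * N ∧ ∀ T, p T → T.card ≤ N → ¬ Disjoint T S := by
  induction s with
  | zero => exact Or.inl ⟨fun _ => ∅, fun a => a.elim0, fun a => a.elim0⟩
  | succ s ih =>
    rcases ih with ⟨T, hT, hp⟩ | ⟨S, hS, h⟩
    -- If the family of `s` sets cannot be extended, its union is the cover; hence the factor `s -
    -- 1` in the statement.
    · by_cases hex : ∃ T', p T' ∧ T'.card ≤ N ∧ Disjoint T' (Finset.univ.biUnion T)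
      · obtain ⟨T', hp', hN, hd⟩ := hex
        rw [Finset.disjoint_biUnion_right] at hd
        left
        refine ⟨Fin.cons T' T, ?_, ?_⟩
        · intro a b hab
          induction a using Fin.cases with
          | zero =>
            induction b using Fin.cases with
            | zero => exact absurd rfl hab
            | succ b => simpa using hd b (Finset.mem_univ _)
          | succ a =>
            induction b using Fin.cases with
            | zero => simpa using (hd a (Finset.mem_univ _)).symm
            | succ b => simpa using hT (fun h => hab (by rw [h]))
        · intro b
          induction b using Fin.cases with
          | zero => exact ⟨hp', hN⟩
          | succ b => simpa using hp b
      · right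
        refine ⟨Finset.univ.biUnion T, ?_, fun T' h1 h2 h3 => hex ⟨T', h1, h2, h3⟩⟩
        refine Finset.card_biUnion_le.trans ?_
        calc ∑ i, (T i).card ≤ ∑ _i : Fin s, N := Finset.sum_le_sum fun i _ => (hp i).2
          _ = (s + 1 - 1) * N := by simp
    · exact Or.inr ⟨S, hS.trans (Nat.mul_le_mul_right _ (by omega)), h⟩

end Coordinates

/-! ### Averages over random signs, and decoupling. -/

section Cube

variable {ι : Type*} [Fintype ι] [DecidableEq ι]

/-- The set of sign vectors. -/
noncomputable def cube (ι : Type*) [Fintype ι] [DecidableEq ι] : Finset (ι → ℝ) :=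
  Fintype.piFinset fun _ => {1, -1}

theorem mem_cube {x : ι → ℝ} : x ∈ cube ι ↔ ∀ i, x i = 1 ∨ x i = -1 := by
  simp [cube]

theorem card_cube : (cube ι).card = 2 ^ Fintype.card ι := by
  rw [cube, Fintype.card_piFinset]
  have : ((1 : ℝ)) ≠ -1 := by norm_num
  simp [Finset.card_pair this]

/-- The average of a function over the uniformly random sign vector. -/
noncomputable def ex (f : (ι → ℝ) → ℝ) : ℝ := (∑ x ∈ cube ι, f x) / 2 ^ Fintype.card ι

open Classical in
/-- The probability of an event for the uniformly random sign vector. -/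
noncomputable def pr (E : (ι → ℝ) → Prop) : ℝ := ex fun x => if E x then 1 else 0

/-- The vector with coordinates in `S` taken from `x`, the others from `y`. -/
def mix (S : Finset ι) (x y : ι → ℝ) : ι → ℝ := proj S x + proj Sᶜ y

theorem mix_apply (S : Finset ι) (x y : ι → ℝ) (i : ι) :
    mix S x y i = if i ∈ S then x i else y i := by
  by_cases h : i ∈ S <;> simp [mix, proj_apply, h]

theorem mix_mem_cube {S : Finset ι} {x y : ι → ℝ} (hx : x ∈ cube ι) (hy : y ∈ cube ι) :
    mix S x y ∈ cube ι := by
  rw [mem_cube] at *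
  intro i
  rw [mix_apply]
  split_ifs
  · exact hx i
  · exact hy i

theorem mix_mix (S : Finset ι) (x y : ι → ℝ) : mix S (mix S x y) (mix S y x) = x := by
  ext i
  simp only [mix_apply]
  split_ifs <;> rfl

theorem ex_const (c : ℝ) : ex (fun _ : ι → ℝ => c) = c := by
  simp [ex, card_cube]

theorem ex_mono {f g : (ι → ℝ) → ℝ} (h : ∀ x ∈ cube ι, f x ≤ g x) : ex f ≤ ex g :=
  div_le_div_of_nonneg_right (Finset.sum_le_sum h) (by positivity)

theorem ex_congr {f g : (ι → ℝ) → ℝ} (h : ∀ x ∈ cube ι, f x = g x) : ex f = ex g := by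
  rw [ex, ex, Finset.sum_congr rfl h]

theorem ex_add (f g : (ι → ℝ) → ℝ) : ex (fun x => f x + g x) = ex f + ex g := by
  simp [ex, Finset.sum_add_distrib, add_div]

theorem ex_mul_left (c : ℝ) (f : (ι → ℝ) → ℝ) : ex (fun x => c * f x) = c * ex f := by
  simp [ex, ← Finset.mul_sum, mul_div_assoc]

theorem ex_sum {κ : Type*} (s : Finset κ) (f : κ → (ι → ℝ) → ℝ) :
    ex (fun x => ∑ k ∈ s, f k x) = ∑ k ∈ s, ex (f k) := by
  simp only [ex]
  rw [Finset.sum_comm, Finset.sum_div]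

theorem ex_comm (f : (ι → ℝ) → (ι → ℝ) → ℝ) :
    ex (fun x => ex fun y => f x y) = ex (fun y => ex fun x => f x y) := by
  simp only [ex, ← Finset.sum_div]
  rw [Finset.sum_comm]

theorem ex_le {f : (ι → ℝ) → ℝ} {M : ℝ} (h : ∀ x ∈ cube ι, f x ≤ M) : ex f ≤ M :=
  (ex_mono h).trans_eq (ex_const M)

theorem ex_nonneg {f : (ι → ℝ) → ℝ} (h : ∀ x ∈ cube ι, 0 ≤ f x) : 0 ≤ ex f :=
  (ex_const (0 : ℝ)).symm.le.trans (ex_mono h)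

theorem ex_sq_le (f : (ι → ℝ) → ℝ) : ex f ^ 2 ≤ ex fun x => f x ^ 2 := by
  have h := sq_sum_le_card_mul_sum_sq (s := cube ι) (f := f)
  rw [card_cube] at h
  push_cast at h
  rw [ex, ex, div_pow, div_le_div_iff₀ (by positivity) (by positivity)]
  calc _ ≤ (2 ^ Fintype.card ι * ∑ i ∈ cube ι, f i ^ 2) * 2 ^ Fintype.card ι := by gcongr
    _ = _ := by ring

/-- Exchanging the coordinates outside `S` between two points of the cube is an involution, so a
mixture of two independent uniform points is uniform. -/
theorem ex_mix (S : Finset ι) (f : (ι → ℝ) → ℝ) :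
    ex f = ex fun y => ex fun x => f (mix S x y) := by
  have key : ∑ y ∈ cube ι, ∑ x ∈ cube ι, f (mix S x y) = ∑ _y ∈ cube ι, ∑ x ∈ cube ι, f x := by
    rw [← Finset.sum_product', ← Finset.sum_product']
    refine Finset.sum_nbij' (fun p => (mix S p.1 p.2, mix S p.2 p.1))
      (fun p => (mix S p.1 p.2, mix S p.2 p.1)) ?_ ?_ ?_ ?_ ?_
    · rintro ⟨y, x⟩ h
      rw [Finset.mem_product] at h ⊢
      exact ⟨mix_mem_cube h.1 h.2, mix_mem_cube h.2 h.1⟩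
    · rintro ⟨y, x⟩ h
      rw [Finset.mem_product] at h ⊢
      exact ⟨mix_mem_cube h.1 h.2, mix_mem_cube h.2 h.1⟩
    · rintro ⟨y, x⟩ _
      simp [mix_mix]
    · rintro ⟨y, x⟩ _
      simp [mix_mix]
    · rintro ⟨y, x⟩ _
      rfl
  simp only [ex, ← Finset.sum_div]
  rw [key, Finset.sum_const, card_cube]
  simp

theorem pr_nonneg (E : (ι → ℝ) → Prop) : 0 ≤ pr E := by
  classical
  exact ex_nonneg fun x _ => by split_ifs <;> norm_num

theorem pr_le_one (E : (ι → ℝ) → Prop) : pr E ≤ 1 := by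
  classical
  exact ex_le fun x _ => by split_ifs <;> norm_num

theorem pr_mono {E F : (ι → ℝ) → Prop} (h : ∀ x ∈ cube ι, E x → F x) : pr E ≤ pr F := by
  classical
  refine ex_mono fun x hx => ?_
  by_cases hE : E x
  · simp [hE, h x hx hE]
  · simp only [hE, if_false]
    split_ifs <;> norm_num

theorem pr_eq_zero {E : (ι → ℝ) → Prop} (h : ∀ x ∈ cube ι, ¬ E x) : pr E = 0 := by
  classical
  exact (ex_congr fun x hx => if_neg (h x hx)).trans (ex_const 0)

theorem pr_or_le (E F : (ι → ℝ) → Prop) : pr (fun x => E x ∨ F x) ≤ pr E + pr F := by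
  classical
  rw [pr, pr, pr, ← ex_add]
  refine ex_mono fun x _ => ?_
  by_cases hE : E x <;> by_cases hF : F x <;> simp [hE, hF]

theorem pr_mix (S : Finset ι) (E : (ι → ℝ) → Prop) :
    pr E = ex fun y => pr fun x => E (mix S x y) := by
  rw [pr, ex_mix S]
  rfl

theorem pr_le_of_mix (S : Finset ι) {E : (ι → ℝ) → Prop} {M : ℝ}
    (h : ∀ y ∈ cube ι, pr (fun x => E (mix S x y)) ≤ M) : pr E ≤ M := by
  rw [pr_mix S]
  exact ex_le h

/-- Decoupling: the square of a probability is at most the probability that the event holds for two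
outcomes that agree on `S` and are independent elsewhere. -/
theorem pr_sq_le (S : Finset ι) (E : (ι → ℝ) → Prop) :
    pr E ^ 2 ≤ ex fun y' => ex fun y => pr fun x => E (mix S x y) ∧ E (mix S x y') := by
  classical
  have h1 : pr E = ex fun x => ex fun y => if E (mix S x y) then (1 : ℝ) else 0 := by
    rw [pr_mix S, ex_comm]
    rfl
  rw [h1]
  -- Cauchy–Schwarz in the shared coordinates; the square of the inner average is an average over
  -- two independent copies.
  refine (ex_sq_le _).trans ?_
  rw [ex_comm]
  have : ∀ y, (ex fun y' => pr fun x => E (mix S x y') ∧ E (mix S x y)) =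
      ex fun x => ex fun y' => if E (mix S x y') ∧ E (mix S x y) then (1 : ℝ) else 0 := by
    intro y
    rw [ex_comm]
    exact ex_congr fun y' _ => ex_congr fun x _ => by congr
  rw [ex_comm]
  simp only [this]
  rw [ex_comm]
  refine ex_mono fun x _ => le_of_eq ?_
  rw [sq, ← ex_mul_left]
  refine ex_congr fun y _ => ?_
  rw [mul_comm, ← ex_mul_left]
  refine ex_congr fun y' _ => ?_
  by_cases hE : E (mix S x y) <;> by_cases hF : E (mix S x y') <;> simp [hE, hF]

theorem pr_sq_le_of_forall (S : Finset ι) {E : (ι → ℝ) → Prop} {M : ℝ}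
    (h : ∀ y' ∈ cube ι,
      (ex fun y => pr fun x => E (mix S x y) ∧ E (mix S x y')) ≤ M) : pr E ^ 2 ≤ M :=
  (pr_sq_le S E).trans (ex_le h)

end Cube

end QuadLO

namespace QuadLO

set_option linter.unusedSectionVars false

/-! ### Convolution inequalities in the group algebra and return probabilities of sign walks. -/

section Convolution

variable {W : Type*} [AddCommGroup W] [Module ℝ W]

/-- A finitely supported function invariant under `x ↦ -x`. -/
def IsSymm (f : AddMonoidAlgebra ℝ W) : Prop := ∀ x, f.coeff (-x) = f.coeff x

theorem coeff_mul_eq_sum (f g : AddMonoidAlgebra ℝ W) (x : W) :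
    (f * g).coeff x = ∑ h ∈ f.coeff.support, f.coeff h * g.coeff (-h + x) := by
  rw [AddMonoidAlgebra.coeff_mul_apply_left]
  rfl

theorem IsSymm.mul {f g : AddMonoidAlgebra ℝ W} (hf : IsSymm f) (hg : IsSymm g) :
    IsSymm (f * g) := by
  intro x
  rw [coeff_mul_eq_sum, coeff_mul_eq_sum]
  refine Finset.sum_nbij' (fun h => -h) (fun h => -h) ?_ ?_ ?_ ?_ ?_
  · intro h hh
    rw [Finsupp.mem_support_iff] at hh ⊢
    rwa [hf]
  · intro h hh
    rw [Finsupp.mem_support_iff] at hh ⊢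
    rwa [hf]
  · simp
  · simp
  · intro h _
    rw [hf, ← hg (- -h + x)]
    congr 2
    abel

theorem IsSymm.one : IsSymm (1 : AddMonoidAlgebra ℝ W) := by
  classical
  intro x
  simp [AddMonoidAlgebra.one_def, Finsupp.single_apply, eq_comm]

theorem IsSymm.pow {f : AddMonoidAlgebra ℝ W} (hf : IsSymm f) (n : ℕ) : IsSymm (f ^ n) := by
  induction n with
  | zero => simpa using IsSymm.one
  | succ n ih => rw [pow_succ]; exact ih.mul hf

theorem IsSymm.prod {κ : Type*} {s : Finset κ} {f : κ → AddMonoidAlgebra ℝ W}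
    (hf : ∀ k, IsSymm (f k)) : IsSymm (∏ k ∈ s, f k) := by
  classical
  induction s using Finset.induction_on with
  | empty => simpa using IsSymm.one
  | insert a s ha ih => rw [Finset.prod_insert ha]; exact (hf a).mul ih

theorem IsSymm.coeff_sq_zero {f : AddMonoidAlgebra ℝ W} (hf : IsSymm f) :
    (f ^ 2).coeff 0 = ∑ h ∈ f.coeff.support, f.coeff h ^ 2 := by
  rw [sq, coeff_mul_eq_sum]
  refine Finset.sum_congr rfl fun h _ => ?_
  rw [add_zero, hf, sq]

/-- Cauchy–Schwarz for a convolution: by symmetry the ℓ² norm squared of `f` is the value of `f ^ 2`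
at the origin. -/
theorem coeff_mul_sq_le {f g : AddMonoidAlgebra ℝ W} (hf : IsSymm f) (hg : IsSymm g) (x : W) :
    (f * g).coeff x ^ 2 ≤ (f ^ 2).coeff 0 * (g ^ 2).coeff 0 := by
  classical
  rw [hf.coeff_sq_zero, hg.coeff_sq_zero, coeff_mul_eq_sum]
  refine (Finset.sum_mul_sq_le_sq_mul_sq _ _ _).trans ?_
  refine mul_le_mul_of_nonneg_left ?_ (Finset.sum_nonneg fun _ _ => sq_nonneg _)
  have hinj : Set.InjOn (fun h : W => -h + x) f.coeff.support := by
    intro a _ b _ hab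
    simpa using hab
  rw [← Finset.sum_image (f := fun y => g.coeff y ^ 2) hinj]
  rw [← Finset.sum_filter_ne_zero]
  refine Finset.sum_le_sum_of_subset_of_nonneg ?_ fun _ _ _ => sq_nonneg _
  intro y hy
  rw [Finset.mem_filter] at hy
  simpa using hy.2

/-- Hölder's inequality for a power of two many factors, without Fourier analysis: Cauchy–Schwarz
splits the product into two halves, and induction applies to each half with every `f k` replaced by
its square. -/
theorem coeff_prod_pow_le (l : ℕ) {κ : Type*} (s : Finset κ) (hs : s.card = 2 ^ (l + 1))
    (f : κ → AddMonoidAlgebra ℝ W) (hf : ∀ k, IsSymm (f k)) (x : W) :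
    (∏ k ∈ s, f k).coeff x ^ (2 ^ (l + 1)) ≤ ∏ k ∈ s, (f k ^ (2 ^ (l + 1))).coeff 0 := by
  classical
  induction l generalizing s f x with
  | zero =>
    obtain ⟨a, b, hab, rfl⟩ := Finset.card_eq_two.1 (by simpa using hs)
    rw [Finset.prod_pair hab, Finset.prod_pair hab]
    simpa using coeff_mul_sq_le (hf a) (hf b) x
  | succ l ih =>
    obtain ⟨t, hts, ht⟩ := Finset.exists_subset_card_eq (s := s) (n := 2 ^ (l + 1))
      (by rw [hs]; exact Nat.pow_le_pow_right (by norm_num) (by omega))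
    have ht' : (s \ t).card = 2 ^ (l + 1) := by
      rw [Finset.card_sdiff_of_subset hts, hs, ht, pow_succ]
      omega
    rw [← Finset.prod_sdiff hts, ← Finset.prod_sdiff hts]
    have h1 := coeff_mul_sq_le (IsSymm.prod (s := s \ t) hf) (IsSymm.prod (s := t) hf) x
    have hpow : ∀ y : ℝ, y ^ (2 ^ (l + 1 + 1)) = (y ^ 2) ^ (2 ^ (l + 1)) := by
      intro y
      rw [← pow_mul]
      congr 1
      ring
    have hpow' : ∀ y : AddMonoidAlgebra ℝ W, y ^ (2 ^ (l + 1 + 1)) = (y ^ 2) ^ (2 ^ (l + 1)) := by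
      intro y
      rw [← pow_mul]
      congr 1
      ring
    have hnn : ∀ u : Finset κ, 0 ≤ ((∏ k ∈ u, f k) ^ 2).coeff 0 := by
      intro u
      rw [(IsSymm.prod hf).coeff_sq_zero]
      exact Finset.sum_nonneg fun _ _ => sq_nonneg _
    have h2 := ih (s \ t) ht' (fun k => f k ^ 2) (fun k => (hf k).pow 2) 0
    have h3 := ih t ht (fun k => f k ^ 2) (fun k => (hf k).pow 2) 0
    rw [Finset.prod_pow] at h2 h3
    rw [hpow]
    simp only [hpow']
    calc (((∏ k ∈ s \ t, f k) * ∏ k ∈ t, f k).coeff x ^ 2) ^ 2 ^ (l + 1)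
        ≤ (((∏ k ∈ s \ t, f k) ^ 2).coeff 0 * ((∏ k ∈ t, f k) ^ 2).coeff 0) ^ 2 ^ (l + 1) := by
          gcongr
      _ = (((∏ k ∈ s \ t, f k) ^ 2).coeff 0) ^ 2 ^ (l + 1) *
          (((∏ k ∈ t, f k) ^ 2).coeff 0) ^ 2 ^ (l + 1) := mul_pow _ _ _
      _ ≤ _ := mul_le_mul h2 h3 (pow_nonneg (hnn t) _)
          (le_trans (pow_nonneg (hnn _) _) h2)

/-- The finitely supported function `f` vanishes outside the submodule `A`. -/
def SuppIn (A : Submodule ℝ W) (f : AddMonoidAlgebra ℝ W) : Prop := ∀ x, x ∉ A → f.coeff x = 0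

theorem SuppIn.mono {A A' : Submodule ℝ W} {f : AddMonoidAlgebra ℝ W} (hf : SuppIn A f)
    (h : A ≤ A') : SuppIn A' f := fun x hx => hf x fun hA => hx (h hA)

theorem SuppIn.mul {A : Submodule ℝ W} {f g : AddMonoidAlgebra ℝ W} (hf : SuppIn A f)
    (hg : SuppIn A g) : SuppIn A (f * g) := by
  intro x hx
  rw [coeff_mul_eq_sum]
  refine Finset.sum_eq_zero fun h _ => ?_
  by_cases hh : h ∈ A
  · rw [hg, mul_zero]
    intro hmem
    exact hx (by simpa using A.add_mem hh hmem)
  · rw [hf h hh, zero_mul]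

theorem SuppIn.one (A : Submodule ℝ W) : SuppIn A (1 : AddMonoidAlgebra ℝ W) := by
  classical
  intro x hx
  have : (0 : W) ≠ x := by rintro rfl; exact hx A.zero_mem
  simp [AddMonoidAlgebra.one_def, this]

theorem SuppIn.pow {A : Submodule ℝ W} {f : AddMonoidAlgebra ℝ W} (hf : SuppIn A f) (n : ℕ) :
    SuppIn A (f ^ n) := by
  induction n with
  | zero => simpa using SuppIn.one A
  | succ n ih => rw [pow_succ]; exact ih.mul hf

theorem coeff_mul_zero_of_disjoint {A A' : Submodule ℝ W} (h : Disjoint A A')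
    {f g : AddMonoidAlgebra ℝ W} (hf : SuppIn A f) (hg : SuppIn A' g) :
    (f * g).coeff 0 = f.coeff 0 * g.coeff 0 := by
  rw [coeff_mul_eq_sum, Finset.sum_eq_single 0]
  · simp
  · intro x _ hx
    by_cases hA : x ∈ A
    · rw [hg, mul_zero]
      intro hA'
      refine hx (Submodule.disjoint_def.1 h x hA ?_)
      simpa using hA'
    · rw [hf x hA, zero_mul]
  · intro h0
    rw [Finsupp.notMem_support_iff.1 h0, zero_mul]

/-- Steps along linearly independent lines sum to zero only if each is zero, so the return
probability factorizes. -/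
theorem coeff_prod_zero_of_linearIndepOn {κ : Type*} {T : Finset κ} {v : κ → W}
    (hv : LinearIndepOn ℝ v (T : Set κ)) {g : κ → AddMonoidAlgebra ℝ W}
    (hg : ∀ k, SuppIn (Submodule.span ℝ {v k}) (g k)) :
    (∏ k ∈ T, g k).coeff 0 = ∏ k ∈ T, (g k).coeff 0 := by
  classical
  induction T using Finset.induction_on with
  | empty => simp [AddMonoidAlgebra.one_def]
  | insert a T ha ih =>
    rw [Finset.coe_insert, linearIndepOn_insert (by simpa using ha)] at hv
    rw [Finset.prod_insert ha, Finset.prod_insert ha, mul_comm, mul_comm ((g a).coeff 0),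
      ← ih hv.1]
    have hva : v a ≠ 0 := by
      intro h0
      exact hv.2 (h0 ▸ Submodule.zero_mem _)
    refine coeff_mul_zero_of_disjoint (A := Submodule.span ℝ (v '' T))
      ((Submodule.disjoint_span_singleton' hva).2 hv.2) ?_ (hg a)
    have : ∀ S : Finset κ, S ⊆ T → SuppIn (Submodule.span ℝ (v '' T)) (∏ k ∈ S, g k) := by
      intro S
      induction S using Finset.induction_on with
      | empty => intro _; simpa using SuppIn.one _
      | insert b S hb ihS =>
        intro hS
        rw [Finset.prod_insert hb]
        refine SuppIn.mul ((hg b).mono (Submodule.span_mono ?_))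
          (ihS fun x hx => hS (Finset.mem_insert_of_mem hx))
        rw [Set.singleton_subset_iff]
        exact ⟨b, hS (Finset.mem_insert_self b S), rfl⟩
    exact this T subset_rfl

/-- The distribution of `±v` with a uniformly random sign. -/
noncomputable def signStep (v : W) : AddMonoidAlgebra ℝ W :=
  AddMonoidAlgebra.single v (1 / 2) + AddMonoidAlgebra.single (-v) (1 / 2)

theorem isSymm_signStep (v : W) : IsSymm (signStep v) := by
  classical
  intro x
  simp only [signStep, AddMonoidAlgebra.coeff_add, AddMonoidAlgebra.coeff_single,
    Finsupp.add_apply, Finsupp.single_apply, neg_inj]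
  have h1 : (v = -x) ↔ (-v = x) := by rw [← neg_eq_iff_eq_neg]
  rw [add_comm]
  simp [h1]

theorem suppIn_signStep (v : W) : SuppIn (Submodule.span ℝ {v}) (signStep v) := by
  classical
  intro x hx
  have h1 : v ≠ x := by rintro rfl; exact hx (Submodule.mem_span_singleton_self _)
  have h2 : -v ≠ x := by
    rintro rfl
    exact hx (Submodule.neg_mem _ (Submodule.mem_span_singleton_self _))
  simp [signStep, h1, h2]

theorem signStep_zero : signStep (0 : W) = 1 := by
  rw [signStep, neg_zero, ← AddMonoidAlgebra.single_add, AddMonoidAlgebra.one_def]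
  norm_num

/-- The factor `2 * n + 1` lets the induction close: successive terms have ratio
(2n+1)(2n+3)/(2n+2)², which is below 1. -/
theorem centralBinom_sq_mul_le (n : ℕ) :
    ((n.centralBinom : ℝ) / 4 ^ n) ^ 2 * (2 * n + 1) ≤ 1 := by
  induction n with
  | zero => simp
  | succ n ih =>
    have h : ((n : ℝ) + 1) * (n + 1).centralBinom = 2 * (2 * n + 1) * n.centralBinom := by
      exact_mod_cast Nat.succ_mul_centralBinom_succ n
    have h' : ((n + 1).centralBinom : ℝ) = 2 * (2 * n + 1) * n.centralBinom / (n + 1) := by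
      field_simp
      linarith
    rw [h']
    push_cast
    have hn : (0 : ℝ) ≤ n := Nat.cast_nonneg n
    calc (2 * (2 * n + 1) * (n.centralBinom : ℝ) / (n + 1) / 4 ^ (n + 1)) ^ 2 *
          (2 * (n + 1) + 1)
        = ((n.centralBinom : ℝ) / 4 ^ n) ^ 2 * (2 * n + 1) *
          ((2 * n + 1) * (2 * n + 3) / (2 * n + 2) ^ 2) := by
          field_simp
          ring
      _ ≤ 1 * 1 := by
          refine mul_le_mul ih ?_ (by positivity) (by norm_num)
          rw [div_le_one (by positivity)]
          nlinarith
      _ = 1 := by norm_num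

theorem coeff_signStep_pow_le {v : W} (hv : v ≠ 0) (n : ℕ) :
    (signStep v ^ (2 * n)).coeff 0 ≤ 1 / √(2 * n + 1) := by
  classical
  have h1 : (signStep v ^ (2 * n)).coeff 0 = (n.centralBinom : ℝ) / 4 ^ n := by
    rw [signStep, add_pow, AddMonoidAlgebra.coeff_sum, Finsupp.finsetSum_apply,
      Finset.sum_eq_single n]
    · rw [AddMonoidAlgebra.single_pow, AddMonoidAlgebra.single_pow,
        AddMonoidAlgebra.single_mul_single, AddMonoidAlgebra.natCast_def,
        AddMonoidAlgebra.single_mul_single]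
      have : n • v + (2 * n - n) • -v + 0 = 0 := by
        rw [show 2 * n - n = n by omega]
        simp
      rw [this, AddMonoidAlgebra.coeff_single, Finsupp.single_eq_same, Nat.centralBinom]
      rw [show 2 * n - n = n by omega, ← mul_pow]
      rw [show (1 / 2 : ℝ) * (1 / 2) = 4⁻¹ by norm_num, inv_pow]
      ring
    · intro m hm hmn
      rw [AddMonoidAlgebra.single_pow, AddMonoidAlgebra.single_pow,
        AddMonoidAlgebra.single_mul_single, AddMonoidAlgebra.natCast_def,
        AddMonoidAlgebra.single_mul_single, AddMonoidAlgebra.coeff_single,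
        Finsupp.single_eq_of_ne]
      intro h0
      have hm' : m ≤ 2 * n := by simpa [Nat.lt_succ_iff] using hm
      have h2 : ((m : ℝ) - ((2 * n - m : ℕ) : ℝ)) • v = 0 := by
        rw [sub_smul, Nat.cast_smul_eq_nsmul, Nat.cast_smul_eq_nsmul]
        rw [h0, smul_neg]
        abel
      rcases smul_eq_zero.1 h2 with h3 | h3
      · have h4 : (m : ℝ) = ((2 * n - m : ℕ) : ℝ) := by linarith
        have h5 : m = 2 * n - m := by exact_mod_cast h4
        omega
      · exact hv h3
    · intro h
      exact absurd (Finset.mem_range.2 (by omega)) h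
  rw [h1, le_div_iff₀ (by positivity)]
  have h2 := centralBinom_sq_mul_le n
  have h3 : ((n.centralBinom : ℝ) / 4 ^ n * √(2 * n + 1)) ^ 2 ≤ 1 ^ 2 := by
    rw [mul_pow, Real.sq_sqrt (by positivity)]
    simpa using h2
  exact le_of_sq_le_sq h3 (by norm_num)

end Convolution

/-! ### Point probabilities of linear maps of random signs. -/

section Anticoncentration

variable {ι : Type*} [Fintype ι] [DecidableEq ι] {W : Type*} [AddCommGroup W] [Module ℝ W]

theorem pr_linear_eq_coeff (L : (ι → ℝ) →ₗ[ℝ] W) (w : W) :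
    pr (fun x => L x = w) = (∏ i, signStep (L (Pi.single i 1))).coeff w := by
  classical
  have h1 : ∀ i, signStep (L (Pi.single i 1)) =
      ∑ a ∈ ({1, -1} : Finset ℝ), AddMonoidAlgebra.single (a • L (Pi.single i 1)) (1 / 2 : ℝ) := by
    intro i
    rw [Finset.sum_pair (by norm_num)]
    simp [signStep]
  simp only [h1]
  rw [Finset.prod_univ_sum, AddMonoidAlgebra.coeff_sum, Finsupp.finsetSum_apply, pr, ex,
    Finset.sum_div]
  refine Finset.sum_congr rfl fun x _ => ?_
  rw [AddMonoidAlgebra.prod_single, AddMonoidAlgebra.coeff_single, Finsupp.single_apply]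
  have hL : L x = ∑ i, x i • L (Pi.single i 1) :=
    map_eq_sum_of_mem_supp L (T := Finset.univ) fun i hi => absurd (Finset.mem_univ i) hi
  rw [← hL]
  by_cases h : L x = w
  · simp [h]
  · simp [h]

/-- Halász's inequality: if `L` maps the vectors supported in each of `s` disjoint sets onto a space
of dimension `d`, then `L` takes each value with probability `O(s ^ (-d / 2))`. -/
theorem pr_linear_le [FiniteDimensional ℝ W] (L : (ι → ℝ) →ₗ[ℝ] W) {s : ℕ} (hs : 1 ≤ s)
    {T : Fin s → Finset ι} (hT : Pairwise fun a b => Disjoint (T a) (T b))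
    (hL : ∀ b, Onto L (T b)) (w : W) :
    pr (fun x => L x = w) ≤ √(2 / s) ^ Module.finrank ℝ W := by
  classical
  set d := Module.finrank ℝ W with hd
  rcases hs.eq_or_lt with rfl | hs2
  · refine (pr_le_one _).trans (one_le_pow₀ ?_)
    rw [Real.one_le_sqrt]
    norm_num
  -- Hölder is available for powers of two, so only N = 2^(l+1) > s/2 of the blocks are used; this
  -- is the 2 in `√(2 / s)`.
  obtain ⟨l, hl1, hl2⟩ : ∃ l, 2 ^ (l + 1) ≤ s ∧ s < 2 ^ (l + 2) := by
    have h0 : Nat.log 2 s ≠ 0 := by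
      have := Nat.log_pos (b := 2) (by norm_num) (show 2 ≤ s by omega)
      omega
    obtain ⟨l, hl⟩ := Nat.exists_eq_succ_of_ne_zero h0
    refine ⟨l, ?_, ?_⟩
    · have := Nat.pow_log_le_self 2 (show s ≠ 0 by omega)
      rwa [hl] at this
    · have := Nat.lt_pow_succ_log_self (b := 2) (by norm_num) s
      rwa [hl] at this
  -- Each block is cut down to a basis, so that the N-fold walk of a block splits into
  -- one-dimensional walks.
  choose T' hT' hcard hOn hli using fun b => (hL b).exists_basis
  obtain ⟨B, -, hB⟩ := Finset.exists_subset_card_eq (s := (Finset.univ : Finset (Fin s)))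
    (n := 2 ^ (l + 1)) (by simpa using hl1)
  have hdisj : (B : Set (Fin s)).PairwiseDisjoint T' := fun a _ b _ hab =>
    (hT hab).mono (hT' a) (hT' b)
  set S := B.biUnion T' with hS
  have ha : ∀ i, i ∈ S → L (Pi.single i 1) ≠ 0 := by
    intro i hi
    obtain ⟨b, _, hb⟩ := Finset.mem_biUnion.1 hi
    exact (hli b).ne_zero hb
  refine pr_le_of_mix S fun y _ => ?_
  have h1 : (fun x => L (mix S x y) = w) = fun x => (L ∘ₗ proj S) x = w - L (proj Sᶜ y) := by
    ext x
    simp [mix, eq_sub_iff_add_eq]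
  rw [h1, pr_linear_eq_coeff]
  set w' := w - L (proj Sᶜ y)
  have h2 : ∏ i, signStep ((L ∘ₗ proj S) (Pi.single i 1)) =
      ∏ b ∈ B, ∏ i ∈ T' b, signStep (L (Pi.single i 1)) := by
    rw [← Finset.prod_biUnion hdisj, ← hS, ← Finset.prod_subset (Finset.subset_univ S)]
    · refine Finset.prod_congr rfl fun i hi => ?_
      rw [LinearMap.comp_apply, proj_eq_self (single_mem_supp hi 1)]
    · intro i _ hi
      rw [LinearMap.comp_apply, proj_eq_zero (T := {i}) (single_mem_supp (by simp) 1)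
        (by simpa using hi), map_zero, signStep_zero]
  rw [h2]
  have h3 := coeff_prod_pow_le l B hB (fun b => ∏ i ∈ T' b, signStep (L (Pi.single i 1)))
    (fun b => IsSymm.prod fun i => isSymm_signStep _) w'
  set N := 2 ^ (l + 1) with hN
  have hNpos : (0 : ℝ) < N := by rw [hN]; positivity
  have h4 : ∀ b ∈ B, ((∏ i ∈ T' b, signStep (L (Pi.single i 1))) ^ N).coeff 0 ≤
      (1 / √N) ^ d := by
    intro b hb
    rw [← Finset.prod_pow, coeff_prod_zero_of_linearIndepOn (hli b)
      fun k => (suppIn_signStep _).pow _]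
    rw [show d = (T' b).card from (hcard b).symm, ← Finset.prod_const]
    refine Finset.prod_le_prod ?_ ?_
    · intro i _
      rw [hN, pow_succ, pow_mul, ((isSymm_signStep _).pow _).coeff_sq_zero]
      exact Finset.sum_nonneg fun _ _ => sq_nonneg _
    · intro i hi
      have := coeff_signStep_pow_le (ha i (Finset.mem_biUnion.2 ⟨b, hb, hi⟩)) (2 ^ l)
      rw [hN, pow_succ, mul_comm]
      refine this.trans ?_
      push_cast
      refine one_div_le_one_div_of_le (by positivity) (Real.sqrt_le_sqrt (by linarith))
  have h5 : ∏ b ∈ B, ((∏ i ∈ T' b, signStep (L (Pi.single i 1))) ^ N).coeff 0 ≤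
      ((1 / √N) ^ d) ^ N := by
    rw [← hB, ← Finset.prod_const]
    refine Finset.prod_le_prod ?_ ?_
    · intro b _
      rw [hB, hN, pow_succ, pow_mul, ((IsSymm.prod fun i => isSymm_signStep _).pow _).coeff_sq_zero]
      exact Finset.sum_nonneg fun _ _ => sq_nonneg _
    · rw [hB]
      exact h4
  have h6 := le_of_pow_le_pow_left₀ (by positivity) (by positivity) (h3.trans h5)
  refine h6.trans ?_
  refine pow_le_pow_left₀ (by positivity) ?_ d
  rw [one_div, ← Real.sqrt_inv]
  refine Real.sqrt_le_sqrt ?_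
  rw [← one_div, div_le_div_iff₀ hNpos (by positivity)]
  have : (s : ℝ) < 2 ^ (l + 2) := by exact_mod_cast hl2
  rw [hN]
  push_cast
  rw [pow_succ] at this
  linarith

/-- A linear map onto a space of dimension `d` takes each value with probability at most
`2 ^ (-d)`. -/
theorem pr_linear_le_two_pow (d : ℕ) : ∀ {W : Type*} [AddCommGroup W] [Module ℝ W]
    [FiniteDimensional ℝ W] (L : (ι → ℝ) →ₗ[ℝ] W), Function.Surjective L →
    Module.finrank ℝ W = d → ∀ w, pr (fun x => L x = w) ≤ (1 / 2) ^ d := by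
  induction d with
  | zero => intro W _ _ _ L _ _ w; simpa using pr_le_one _
  | succ d ih =>
    intro W _ _ _ L hL hW w
    classical
    obtain ⟨i, hi⟩ : ∃ i, L (Pi.single i 1) ≠ 0 := by
      by_contra! h
      have : Module.finrank ℝ W = 0 := by
        rw [finrank_zero_iff_forall_zero]
        intro w
        obtain ⟨x, rfl⟩ := hL w
        rw [map_eq_sum_of_mem_supp L (T := Finset.univ) fun i hi => absurd (Finset.mem_univ i) hi]
        simp [h]
      omega
    set A := Submodule.span ℝ {L (Pi.single i 1)} with hA
    have hrank : Module.finrank ℝ (W ⧸ A) = d := by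
      have h1 := Submodule.finrank_quotient_add_finrank A
      have h2 : Module.finrank ℝ A = 1 := finrank_span_singleton hi
      omega
    have hq := ih (A.mkQ ∘ₗ L) ((Submodule.mkQ_surjective A).comp hL) hrank (A.mkQ w)
    -- Flipping sign `i` moves `L x` by a nonzero element of `A`. So the events that x, respectively
    -- its flip, hits `w` are disjoint, equally likely and both contained in the event for the
    -- quotient by `A`: one dimension costs a factor 1/2.
    set flip : (ι → ℝ) → (ι → ℝ) := fun x => Function.update x i (-x i) with hflip
    have hflip_flip : ∀ x, flip (flip x) = x := by
      intro x
      ext j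
      by_cases hj : j = i
      · subst hj; simp [hflip]
      · simp [hflip, hj]
    have hflip_cube : ∀ x ∈ cube ι, flip x ∈ cube ι := by
      intro x hx
      rw [mem_cube] at hx ⊢
      intro j
      by_cases hj : j = i
      · subst hj
        rcases hx j with h | h <;> simp [hflip, h]
      · simpa [hflip, hj] using hx j
    have hflip_eq : ∀ x, flip x = x - (2 * x i) • Pi.single i (1 : ℝ) := by
      intro x
      ext j
      by_cases hj : j = i
      · subst hj; simp [hflip]; ring
      · simp [hflip, hj]
    have hLflip : ∀ x, L (flip x) = L x - (2 * x i) • L (Pi.single i 1) := by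
      intro x
      rw [hflip_eq, map_sub, map_smul]
    have hmk : ∀ x, A.mkQ (L (flip x)) = A.mkQ (L x) := by
      intro x
      rw [hLflip, map_sub, sub_eq_self, map_smul]
      simp [hA, Submodule.mem_span_singleton_self]
    have hprflip : pr (fun x => L (flip x) = w) = pr (fun x => L x = w) := by
      rw [pr, pr, ex, ex]
      congr 1
      refine Finset.sum_nbij' flip flip hflip_cube hflip_cube (fun x _ => hflip_flip x)
        (fun x _ => hflip_flip x) fun x _ => rfl
    have hsum : pr (fun x => L x = w) + pr (fun x => L (flip x) = w) ≤
        pr (fun x => (A.mkQ ∘ₗ L) x = A.mkQ w) := by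
      rw [pr, pr, pr, ← ex_add]
      refine ex_mono fun x hx => ?_
      have hne : ¬ (L x = w ∧ L (flip x) = w) := by
        rintro ⟨h1, h2⟩
        rw [hLflip, h1, sub_eq_self, smul_eq_zero] at h2
        rcases h2 with h2 | h2
        · rcases (mem_cube.1 hx) i with h | h <;> rw [h] at h2 <;> norm_num at h2
        · exact hi h2
      by_cases h1 : L x = w
      · have h2 : L (flip x) ≠ w := fun h => hne ⟨h1, h⟩
        simp [h1, h2]
      · by_cases h2 : L (flip x) = w
        · have h3 : A.mkQ (L x) = A.mkQ w := by rw [← hmk, h2]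
          simp only [Submodule.mkQ_apply] at h3
          simp [h1, h2, h3]
        · simp only [h1, h2, if_false, add_zero]
          split_ifs <;> norm_num
    rw [hprflip] at hsum
    rw [pow_succ]
    linarith

end Anticoncentration

end QuadLO

namespace QuadLO

/-! ### Quadratic polynomials and their polarization. -/

section Quadratic

variable {W V : Type*} [AddCommGroup W] [Module ℝ W] [AddCommGroup V] [Module ℝ V]

/-- The quadratic polynomial with quadratic part `B w w`, linear part `b` and constant term `c`. -/
def quad (B : W →ₗ[ℝ] W →ₗ[ℝ] ℝ) (b : W →ₗ[ℝ] ℝ) (c : ℝ) (w : W) : ℝ := B w w + b w + c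

/-- The polarization `w ↦ B z w + B w z` of a bilinear form. -/
def polar (B : W →ₗ[ℝ] W →ₗ[ℝ] ℝ) (z : W) : W →ₗ[ℝ] ℝ := B z + B.flip z

theorem polar_apply (B : W →ₗ[ℝ] W →ₗ[ℝ] ℝ) (z w : W) : polar B z w = B z w + B w z := rfl

theorem polar_add_left (B : W →ₗ[ℝ] W →ₗ[ℝ] ℝ) (y z : W) :
    polar B (y + z) = polar B y + polar B z := by
  ext w
  simp only [polar_apply, map_add, LinearMap.add_apply]
  ring

theorem quad_add (B : W →ₗ[ℝ] W →ₗ[ℝ] ℝ) (b : W →ₗ[ℝ] ℝ) (c : ℝ) (w u : W) :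
    quad B b c (w + u) = quad B (b + polar B u) (quad B b c u) w := by
  simp only [quad, polar_apply, map_add, LinearMap.add_apply]
  ring

theorem quad_add' (B : W →ₗ[ℝ] W →ₗ[ℝ] ℝ) (b : W →ₗ[ℝ] ℝ) (c : ℝ) (w z : W) :
    quad B b c (w + z) = quad B b c w + (polar B z w + B z z + b z) := by
  simp only [quad, polar_apply, map_add, LinearMap.add_apply]
  ring

theorem surjective_prod_of_ne_zero {P : W →ₗ[ℝ] V} (hP : Function.Surjective P) {l : W →ₗ[ℝ] ℝ}
    {z : W} (hz : P z = 0) (hl : l z ≠ 0) : Function.Surjective (P.prod l) := by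
  rintro ⟨v, a⟩
  obtain ⟨w, rfl⟩ := hP v
  refine ⟨w + ((a - l w) / l z) • z, ?_⟩
  ext
  · simp [hz]
  · simp [hl]

end Quadratic

/-! ### Quadratic polynomials of a nondegenerate linear image of random signs. -/

section Anticoncentration

variable {ι : Type*} [Fintype ι] [DecidableEq ι]

/-- The cruder constant allows any exponent up to the rank: when 2/√s is at least 1 the bound is
trivial. -/
theorem pr_linear_le_pow {W : Type*} [AddCommGroup W] [Module ℝ W] [FiniteDimensional ℝ W]
    (L : (ι → ℝ) →ₗ[ℝ] W) {s : ℕ} (hs : 1 ≤ s) {T : Fin s → Finset ι}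
    (hT : Pairwise fun a b => Disjoint (T a) (T b)) (hL : ∀ b, Onto L (T b)) {n : ℕ}
    (hn : n ≤ Module.finrank ℝ W) (w : W) : pr (fun x => L x = w) ≤ (2 / √s) ^ n := by
  have hs' : (0 : ℝ) < √s := by
    rw [Real.sqrt_pos]
    exact_mod_cast hs
  by_cases h1 : 1 ≤ 2 / √s
  · exact (pr_le_one _).trans (one_le_pow₀ h1)
  · have h2 : √(2 / s) ≤ 2 / √s := by
      rw [Real.sqrt_div (by norm_num)]
      refine div_le_div_of_nonneg_right ?_ hs'.le
      rw [Real.sqrt_le_left (by norm_num)]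
      norm_num
    refine (pr_linear_le L hs hT hL w).trans ((pow_le_pow_left₀ (by positivity) h2 _).trans ?_)
    exact pow_le_pow_of_le_one (by positivity) (not_le.1 h1).le hn

theorem inv_sqrt_half_le {s : ℕ} (hs : 2 ≤ s) : 1 / √(s / 2 : ℕ) ≤ 2 / √s := by
  have h1 : (s : ℝ) ≤ 4 * (s / 2 : ℕ) := by
    have : s ≤ 4 * (s / 2) := by omega
    exact_mod_cast this
  have h2 : (0 : ℝ) < (s / 2 : ℕ) := by
    have : 0 < s / 2 := by omega
    exact_mod_cast this
  have h3 : (0 : ℝ) < s := by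
    have : 0 < s := by omega
    exact_mod_cast this
  rw [div_le_div_iff₀ (Real.sqrt_pos.2 h2) (Real.sqrt_pos.2 h3), one_mul]
  calc √s ≤ √(4 * (s / 2 : ℕ)) := Real.sqrt_le_sqrt h1
    _ = 2 * √(s / 2 : ℕ) := by
      rw [Real.sqrt_mul (by norm_num), show (4 : ℝ) = 2 ^ 2 by norm_num,
        Real.sqrt_sq (by norm_num)]

universe u v

/-- A quadratic polynomial that vanishes on a hyperplane of an affine subspace factors there. -/
theorem pr_quadric_le_of_hyperplane {W : Type u} {V : Type v} [AddCommGroup W] [Module ℝ W]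
    [FiniteDimensional ℝ W] [AddCommGroup V] [Module ℝ V] [FiniteDimensional ℝ V]
    (L : (ι → ℝ) →ₗ[ℝ] W) {P : W →ₗ[ℝ] V} (hP : Function.Surjective P)
    (B : W →ₗ[ℝ] W →ₗ[ℝ] ℝ) (b : W →ₗ[ℝ] ℝ) (c : ℝ) (v : V)
    (hnz : ∃ w, P w = v ∧ quad B b c w ≠ 0) {s : ℕ} (hs : 1 ≤ s) {T : Fin s → Finset ι}
    (hT : Pairwise fun a b => Disjoint (T a) (T b)) (hL : ∀ b, Onto L (T b))
    {l : W →ₗ[ℝ] ℝ} {z : W} (hz : P z = 0) (hlz : l z ≠ 0) (a : ℝ)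
    (hvan : ∀ w, P w = v → l w = a → quad B b c w = 0) :
    pr (fun x => P (L x) = v ∧ quad B b c (L x) = 0) ≤
      2 * (2 / √s) ^ (Module.finrank ℝ V + 1) := by
  have hline : ∀ (m : W →ₗ[ℝ] ℝ) (z' : W) (a' : ℝ), P z' = 0 → m z' ≠ 0 →
      pr (fun x => P (L x) = v ∧ m (L x) = a') ≤ (2 / √s) ^ (Module.finrank ℝ V + 1) := by
    intro m z' a' h1 h2
    have := pr_linear_le_pow (P.prod m ∘ₗ L) hs hT
      (fun b => (hL b).comp (surjective_prod_of_ne_zero hP h1 h2))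
      (n := Module.finrank ℝ V + 1) (by rw [Module.finrank_prod, Module.finrank_self]) (v, a')
    simpa [Prod.ext_iff] using this
  set z1 := (l z)⁻¹ • z with hz1
  have hPz1 : P z1 = 0 := by simp [hz1, hz]
  have hlz1 : l z1 = 1 := by simp [hz1, hlz]
  -- Moving `w` along `z1` onto the hyperplane `l = a` changes the polynomial by a multiple of `l w
  -- - a`; `t - a'` is the cofactor.
  set t : W →ₗ[ℝ] ℝ := polar B z1 - B z1 z1 • l with ht
  set a' : ℝ := -(b z1 + a * B z1 z1) with ha'
  have hfac : ∀ w, P w = v → quad B b c w = (l w - a) * (t w - a') := by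
    intro w hw
    have h1 := hvan (w - (l w - a) • z1) (by simp [hw, hPz1]) (by simp [hlz1])
    rw [sub_eq_add_neg, ← neg_smul, quad_add'] at h1
    simp only [map_smul, smul_eq_mul, LinearMap.smul_apply, polar_apply] at h1
    simp only [ht, ha', LinearMap.sub_apply, LinearMap.smul_apply, smul_eq_mul, polar_apply]
    linear_combination h1
  have hsplit : ∀ x ∈ cube ι, (P (L x) = v ∧ quad B b c (L x) = 0) →
      ((P (L x) = v ∧ l (L x) = a) ∨ (P (L x) = v ∧ t (L x) = a')) := by
    rintro x - ⟨h1, h2⟩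
    rw [hfac _ h1, mul_eq_zero, sub_eq_zero, sub_eq_zero] at h2
    exact h2.imp (fun h => ⟨h1, h⟩) fun h => ⟨h1, h⟩
  refine (pr_mono hsplit).trans ((pr_or_le _ _).trans ?_)
  have h1 := hline l z a hz hlz
  have h2 : pr (fun x => P (L x) = v ∧ t (L x) = a') ≤
      (2 / √s) ^ (Module.finrank ℝ V + 1) := by
    by_cases hex : ∃ z', P z' = 0 ∧ t z' ≠ 0
    · obtain ⟨z', h3, h4⟩ := hex
      exact hline t z' a' h3 h4
    -- If `t` is constant on the fibre, that constant is not `a'`, since the polynomial does not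
    -- vanish identically there.
    · push Not at hex
      obtain ⟨w0, hw0, hq0⟩ := hnz
      rw [pr_eq_zero]
      · positivity
      · rintro x - ⟨h3, h4⟩
        have h5 : t (L x - w0) = 0 := hex _ (by rw [map_sub, h3, hw0, sub_self])
        rw [map_sub, h4] at h5
        rw [hfac w0 hw0] at hq0
        exact hq0 (by rw [show t w0 = a' by linarith, sub_self, mul_zero])
  linarith

/-- Let `L` map the vectors supported in each of `s` disjoint sets onto `W`, and let `P` be a
surjection from `W` to a space of dimension `k`. If a quadratic polynomial does not vanish
identically on the fibre `P = v`, then the probability that it vanishes at `L x` and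
`P (L x) = v` is `O(s ^ (-(k + 1) / 2))`. -/
theorem pr_quadric_le (e : ℕ) : ∀ {W : Type u} {V : Type v} [AddCommGroup W] [Module ℝ W]
    [FiniteDimensional ℝ W] [AddCommGroup V] [Module ℝ V] [FiniteDimensional ℝ V]
    (L : (ι → ℝ) →ₗ[ℝ] W) (P : W →ₗ[ℝ] V), Function.Surjective P →
    Module.finrank ℝ (LinearMap.ker P) = e →
    ∀ (B : W →ₗ[ℝ] W →ₗ[ℝ] ℝ) (b : W →ₗ[ℝ] ℝ) (c : ℝ) (v : V),
    (∃ w, P w = v ∧ quad B b c w ≠ 0) → ∀ {s : ℕ}, 1 ≤ s → ∀ {T : Fin s → Finset ι},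
    (Pairwise fun a b => Disjoint (T a) (T b)) → (∀ b, Onto L (T b)) →
    pr (fun x => P (L x) = v ∧ quad B b c (L x) = 0) ≤
      20 ^ (Module.finrank ℝ V + 2) * (1 / √s) ^ (Module.finrank ℝ V + 1) := by
  induction e using Nat.strong_induction_on with
  | _ e ih =>
  intro W V _ _ _ _ _ _ L P hP hker B b c v hnz s hs T hT hL
  set k := Module.finrank ℝ V with hk
  have hspos : (0 : ℝ) < √s := by
    rw [Real.sqrt_pos]
    exact_mod_cast hs
  by_cases hsol : ∃ x ∈ cube ι, P (L x) = v ∧ quad B b c (L x) = 0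
  swap
  · push Not at hsol
    rw [pr_eq_zero fun x hx h => hsol x hx h.1 h.2]
    positivity
  obtain ⟨x0, -, hx0, hqx0⟩ := hsol
  -- When the polynomial vanishes on a hyperplane of the fibre it factors into linear forms.
  -- Otherwise `hhyp` keeps it nonzero after one further constraint, as the induction hypothesis
  -- requires.
  by_cases hhyp : ∀ l : W →ₗ[ℝ] ℝ, (∃ z, P z = 0 ∧ l z ≠ 0) →
      ∀ a : ℝ, ∃ w, P w = v ∧ l w = a ∧ quad B b c w ≠ 0
  swap
  · push Not at hhyp
    obtain ⟨l, ⟨z, hz, hlz⟩, a, hvan⟩ := hhyp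
    refine (pr_quadric_le_of_hyperplane L hP B b c v hnz hs hT hL hz hlz a hvan).trans ?_
    rw [← hk, show (2 : ℝ) / √s = 2 * (1 / √s) by ring, mul_pow, ← mul_assoc]
    refine mul_le_mul_of_nonneg_right ?_ (by positivity)
    calc (2 : ℝ) * 2 ^ (k + 1) = 2 ^ (k + 2) := by ring
      _ ≤ 20 ^ (k + 2) := pow_le_pow_left₀ (by norm_num) (by norm_num) _
  rcases hs.eq_or_lt with rfl | hs2
  · refine (pr_le_one _).trans ?_
    simp only [Nat.cast_one, Real.sqrt_one, div_one, one_pow, mul_one]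
    exact one_le_pow₀ (by norm_num)
  replace hs2 : 2 ≤ s := hs2
  -- the translations of the fibre that preserve the polynomial
  let Z : Submodule ℝ W :=
    { carrier := {z | P z = 0 ∧ (∀ w, P w = 0 → polar B z w = 0) ∧ polar B z (L x0) + b z = 0}
      add_mem' := by
        rintro y z ⟨h1, h2, h3⟩ ⟨h4, h5, h6⟩
        refine ⟨by simp [h1, h4], fun w hw => ?_, ?_⟩
        · simp [polar_add_left, h2 w hw, h5 w hw]
        · simp only [polar_add_left, LinearMap.add_apply, map_add]
          linarith
      zero_mem' := ⟨by simp, fun w _ => by simp [polar_apply], by simp [polar_apply]⟩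
      smul_mem' := by
        rintro r z ⟨h1, h2, h3⟩
        refine ⟨by simp [h1], fun w hw => ?_, ?_⟩
        · have := h2 w hw
          simp only [polar_apply, map_smul, LinearMap.smul_apply, smul_eq_mul] at this ⊢
          linear_combination r * this
        · simp only [polar_apply, map_smul, LinearMap.smul_apply, smul_eq_mul] at h3 ⊢
          linear_combination r * h3 }
  have hZinv : ∀ z ∈ Z, quad B b c (L x0 + z) = 0 := by
    rintro z ⟨h1, h2, h3⟩
    have h4 := h2 z h1
    rw [polar_apply] at h4
    rw [quad_add', hqx0]
    linarith
  have hZker : Z ≤ LinearMap.ker P := fun z hz => hz.1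
  have hZne : Z ≠ LinearMap.ker P := by
    intro h
    obtain ⟨w, hw, hq⟩ := hnz
    have hmem : w - L x0 ∈ Z := by
      rw [h, LinearMap.mem_ker, map_sub, hw, hx0, sub_self]
    exact hq (by simpa using hZinv _ hmem)
  have hZlt : Module.finrank ℝ Z < e := hker ▸ Submodule.finrank_lt_finrank_of_lt
    (lt_of_le_of_ne hZker hZne)
  -- In codimension one the polynomial would vanish on the hyperplane `L x0 + Z` of the fibre,
  -- against `hhyp`. Codimension two is what makes `z y ∈ Z` as rare as s^(-(k+2)/2).
  have hZ2 : Module.finrank ℝ Z + 2 ≤ e := by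
    by_contra hcon
    obtain ⟨z1, hz1, hz1Z⟩ := SetLike.exists_of_lt (lt_of_le_of_ne hZker hZne)
    obtain ⟨l, hl, hlZ⟩ := Submodule.exists_le_ker_of_notMem hz1Z
    obtain ⟨w, hw, hlw, hq⟩ := hhyp l ⟨z1, hz1, hl⟩ (l (L x0))
    have hlt : LinearMap.ker P ⊓ LinearMap.ker l < LinearMap.ker P := by
      refine lt_of_le_of_ne inf_le_left fun h => hl ?_
      have : z1 ∈ LinearMap.ker P ⊓ LinearMap.ker l := by rw [h]; exact hz1
      exact this.2
    have hlt' := Submodule.finrank_lt_finrank_of_lt hlt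
    have heq : Z = LinearMap.ker P ⊓ LinearMap.ker l :=
      Submodule.eq_of_le_of_finrank_le (le_inf hZker hlZ) (by omega)
    have hmem : w - L x0 ∈ Z := by
      rw [heq]
      exact ⟨by simp [hw, hx0], by simp [hlw]⟩
    exact hq (by simpa using hZinv _ hmem)
  have hWk : Module.finrank ℝ W = k + e := by
    rw [← LinearMap.finrank_range_add_finrank_ker P, hker, LinearMap.range_eq_top.2 hP,
      finrank_top]
  have hWZ : k + 2 ≤ Module.finrank ℝ (W ⧸ Z) := by
    have := Submodule.finrank_quotient_add_finrank Z
    omega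
  -- decoupling
  have hs1 : 1 ≤ s / 2 := by omega
  set T1 : Fin (s / 2) → Finset ι := fun a => T ⟨a, by omega⟩ with hT1
  set T2 : Fin (s / 2) → Finset ι := fun a => T ⟨a + s / 2, by omega⟩ with hT2
  have hT1d : Pairwise fun a b => Disjoint (T1 a) (T1 b) := by
    intro a b hab
    exact hT fun h => hab (Fin.ext (by simpa using h))
  have hT2d : Pairwise fun a b => Disjoint (T2 a) (T2 b) := by
    intro a b hab
    exact hT fun h => hab (Fin.ext (by simpa using h))
  set S := Finset.univ.biUnion T1 with hS
  have hT1S : ∀ a, T1 a ⊆ S := fun a => Finset.subset_biUnion_of_mem T1 (Finset.mem_univ a)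
  have hT2S : ∀ a, T2 a ⊆ Sᶜ := by
    intro a
    rw [Finset.subset_compl_iff_disjoint_right, hS, Finset.disjoint_biUnion_right]
    intro a' _
    refine hT fun h => ?_
    have := congrArg Fin.val h
    simp only at this
    omega
  have h1s : 1 / √(s / 2 : ℕ) ≤ 2 / √s := inv_sqrt_half_le hs2
  have h2s : 2 / √(s / 2 : ℕ) ≤ 4 / √s := by
    calc 2 / √(s / 2 : ℕ) = 2 * (1 / √(s / 2 : ℕ)) := by ring
      _ ≤ 2 * (2 / √s) := by gcongr
      _ = 4 / √s := by ring
  set A1 : ℝ := 20 ^ (k + 3) * (2 / √s) ^ (k + 2) with hA1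
  set A2 : ℝ := (4 / √s) ^ k with hA2
  have hprS : ∀ (U : Type v) [AddCommGroup U] [Module ℝ U] [FiniteDimensional ℝ U]
      (g : W →ₗ[ℝ] U) (_ : Function.Surjective g) (w : U),
      pr (fun x => g (L (proj S x)) = w) ≤ (4 / √s) ^ Module.finrank ℝ U := by
    intro U _ _ _ g hg w
    refine (pr_linear_le_pow (g ∘ₗ L ∘ₗ proj S) hs1 hT1d
      (fun a => ((hL _).proj (hT1S a)).comp hg) le_rfl w).trans ?_
    exact pow_le_pow_left₀ (by positivity) h2s _
  have hmain : ∀ y' ∈ cube ι, (ex fun y => pr fun x =>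
      (P (L (mix S x y)) = v ∧ quad B b c (L (mix S x y)) = 0) ∧
      (P (L (mix S x y')) = v ∧ quad B b c (L (mix S x y')) = 0)) ≤
      A1 * (4 / √s) ^ k + A2 * (4 / √s) ^ (k + 2) := by
    intro y' _
    classical
    set z : (ι → ℝ) → W := fun y => L (proj Sᶜ (y - y')) with hz
    have hmixz : ∀ x y, L (mix S x y) = L (mix S x y') + z y := by
      intro x y
      simp only [mix, hz, map_add, map_sub]
      abel
    -- `z y` is the difference of the two outcomes, and `P (z y) = 0` is forced. If `polar B (z y)`
    -- varies on the fibre, subtracting the two equations gives a new linear constraint and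
    -- induction applies to the smaller kernel. If it is constant, the two equations are compatible
    -- only for `z y ∈ Z`.
    have hpt : ∀ y ∈ cube ι, (pr fun x =>
        (P (L (mix S x y)) = v ∧ quad B b c (L (mix S x y)) = 0) ∧
        (P (L (mix S x y')) = v ∧ quad B b c (L (mix S x y')) = 0)) ≤
        A1 * (if P (z y) = 0 then 1 else 0) + A2 * (if z y ∈ Z then 1 else 0) := by
      intro y _
      have hA1nn : 0 ≤ A1 := by positivity
      have hA2nn : 0 ≤ A2 := by positivity
      by_cases hPz : P (z y) = 0
      swap
      · rw [pr_eq_zero]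
        · split_ifs <;> simp [hA2nn]
        · rintro x - ⟨⟨h1, -⟩, h2, -⟩
          rw [hmixz, map_add, h2] at h1
          exact hPz (by simpa using h1)
      by_cases hm : ∃ w, P w = 0 ∧ polar B (z y) w ≠ 0
      · obtain ⟨w1, hw1, hmw1⟩ := hm
        rw [if_pos hPz, mul_one]
        refine le_trans ?_ (le_add_of_nonneg_right (by split_ifs <;> simp [hA2nn]))
        set u := L (proj Sᶜ y') with hu
        set r : ℝ := -(B (z y) (z y) + b (z y)) with hr
        have hP' := surjective_prod_of_ne_zero hP hw1 hmw1
        have hlt : LinearMap.ker (P.prod (polar B (z y))) < LinearMap.ker P := by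
          rw [LinearMap.ker_prod]
          refine lt_of_le_of_ne inf_le_left fun h => hmw1 ?_
          have : w1 ∈ LinearMap.ker P ⊓ LinearMap.ker (polar B (z y)) := by rw [h]; exact hw1
          exact this.2
        have hih := ih _ (hker ▸ Submodule.finrank_lt_finrank_of_lt hlt) (L ∘ₗ proj S)
          (P.prod (polar B (z y))) hP' rfl B (b + polar B u) (quad B b c u)
          (v - P u, r - polar B (z y) u) ?_ hs1 hT1d (fun a => (hL _).proj (hT1S a))
        · rw [Module.finrank_prod, Module.finrank_self, ← hk] at hih
          refine (pr_mono ?_).trans (hih.trans ?_)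
          · rintro x - ⟨⟨h1, h2⟩, h3, h4⟩
            have h5 : L (mix S x y') = (L ∘ₗ proj S) x + u := by simp [mix, hu]
            rw [hmixz, quad_add', h4] at h2
            rw [h5] at h2 h3 h4
            rw [quad_add] at h4
            refine ⟨?_, h4⟩
            rw [map_add] at h2 h3
            simp only [LinearMap.prod_apply, Function.prod_apply, Prod.mk.injEq]
            refine ⟨by rw [← h3]; abel, ?_⟩
            rw [hr]
            linarith
          · rw [hA1]
            exact mul_le_mul_of_nonneg_left (pow_le_pow_left₀ (by positivity) h1s _)
              (by positivity)
        · obtain ⟨w, hw, hlw, hq⟩ := hhyp (polar B (z y)) ⟨w1, hw1, hmw1⟩ r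
          refine ⟨w - u, ?_, ?_⟩
          · simp [hw, hlw]
          · rw [← quad_add, sub_add_cancel]
            exact hq
      · push Not at hm
        by_cases hzZ : z y ∈ Z
        · rw [if_pos hzZ, mul_one]
          refine le_trans ?_ (le_add_of_nonneg_left (by split_ifs <;> simp [hA1nn]))
          refine (pr_mono (F := fun x => P (L (proj S x)) = v - P (L (proj Sᶜ y'))) ?_).trans
            (hprS V P hP _)
          rintro x - ⟨-, h3, -⟩
          rw [eq_sub_iff_add_eq, ← map_add, ← map_add]
          exact h3
        · rw [pr_eq_zero]
          · split_ifs <;> simp [hA1nn]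
          · rintro x - ⟨⟨h1, h2⟩, h3, h4⟩
            refine hzZ ⟨hPz, hm, ?_⟩
            rw [hmixz, quad_add', h4] at h2
            have h5 := hm (L (mix S x y') - L x0) (by rw [map_sub, h3, hx0, sub_self])
            have h6 := hm (z y) hPz
            rw [map_sub] at h5
            rw [polar_apply] at h6
            linarith
    refine (ex_mono hpt).trans ?_
    rw [ex_add, ex_mul_left, ex_mul_left]
    refine add_le_add (mul_le_mul_of_nonneg_left ?_ (by positivity))
      (mul_le_mul_of_nonneg_left ?_ (by positivity))
    · have h := pr_linear_le_pow (P ∘ₗ L ∘ₗ proj Sᶜ) hs1 hT2d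
        (fun a => ((hL _).proj (hT2S a)).comp hP) le_rfl (P (L (proj Sᶜ y')))
      refine le_trans (le_of_eq ?_) (h.trans (pow_le_pow_left₀ (by positivity) h2s _))
      refine ex_congr fun y _ => ?_
      simp [hz, sub_eq_zero]
    · have h := pr_linear_le_pow (Z.mkQ ∘ₗ L ∘ₗ proj Sᶜ) hs1 hT2d
        (fun a => ((hL _).proj (hT2S a)).comp (Submodule.mkQ_surjective Z)) hWZ
        (Z.mkQ (L (proj Sᶜ y')))
      refine le_trans (le_of_eq ?_) (h.trans (pow_le_pow_left₀ (by positivity) h2s _))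
      refine ex_congr fun y _ => ?_
      simp only [LinearMap.comp_apply, Submodule.mkQ_apply, Submodule.Quotient.eq, hz, map_sub]
  have hfin := pr_sq_le_of_forall S
    (E := fun x => P (L x) = v ∧ quad B b c (L x) = 0) hmain
  -- Both terms are of order s^(-(k+2)/2) s^(-k/2) = s^(-(k+1)), the square of the target.
  refine le_of_sq_le_sq (hfin.trans ?_) (by positivity)
  set r := 1 / √s with hr
  have hr0 : 0 ≤ r := by positivity
  have e2 : 2 / √s = 2 * r := by rw [hr]; ring
  have e4 : 4 / √s = 4 * r := by rw [hr]; ring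
  rw [hA1, hA2, e2, e4]
  have hpow : (4 : ℝ) * 8 ^ k + 16 * 16 ^ k ≤ 20 * 20 ^ k := by
    have h8 : (8 : ℝ) ^ k ≤ 20 ^ k := pow_le_pow_left₀ (by norm_num) (by norm_num) _
    have h16 : (16 : ℝ) ^ k ≤ 20 ^ k := pow_le_pow_left₀ (by norm_num) (by norm_num) _
    linarith
  have h20 : (1 : ℝ) ≤ 20 ^ (k + 3) := one_le_pow₀ (by norm_num)
  calc 20 ^ (k + 3) * (2 * r) ^ (k + 2) * (4 * r) ^ k + (4 * r) ^ k * (4 * r) ^ (k + 2)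
      = (20 ^ (k + 3) * (4 * 8 ^ k) + 1 * (16 * 16 ^ k)) * r ^ (2 * k + 2) := by
        rw [show (8 : ℝ) = 2 * 4 by norm_num, show (16 : ℝ) = 4 * 4 by norm_num]
        simp only [mul_pow]
        ring
    _ ≤ (20 ^ (k + 3) * (4 * 8 ^ k) + 20 ^ (k + 3) * (16 * 16 ^ k)) * r ^ (2 * k + 2) := by
        gcongr
    _ = 20 ^ (k + 3) * (4 * 8 ^ k + 16 * 16 ^ k) * r ^ (2 * k + 2) := by ring
    _ ≤ 20 ^ (k + 3) * (20 * 20 ^ k) * r ^ (2 * k + 2) := by gcongr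
    _ = (20 ^ (k + 2) * r ^ (k + 1)) ^ 2 := by ring

end Anticoncentration

end QuadLO

namespace QuadLO

/-! ### Restoring nondegeneracy by fixing few coordinates. -/

section Robust

variable {ι : Type*} [DecidableEq ι]

/-- Among `s` disjoint sets, all but at most `S.card` are disjoint from `S`. -/
theorem exists_embedding_disjoint {s n : ℕ} {R : Fin s → Finset ι}
    (hR : Pairwise fun a b => Disjoint (R a) (R b)) (S : Finset ι) (hn : n + S.card ≤ s) :
    ∃ f : Fin n → Fin s, Function.Injective f ∧ ∀ b, Disjoint (R (f b)) S := by
  classical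
  set good : Finset (Fin s) := Finset.univ.filter fun b => Disjoint (R b) S with hgood
  have hbad : (Finset.univ.filter fun b => ¬ Disjoint (R b) S).card ≤ S.card := by
    have hex : ∀ b, ¬ Disjoint (R b) S → ∃ i ∈ R b, i ∈ S := fun b hb =>
      Finset.not_disjoint_iff.1 hb
    rcases isEmpty_or_nonempty ι with hι | hι
    · simp [Finset.eq_empty_of_isEmpty]
    choose! g hg1 hg2 using hex
    -- Disjoint sets that meet `S` have distinct representatives in `S`.
    refine Finset.card_le_card_of_injOn g (fun b hb => hg2 b (by simpa using hb)) ?_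
    intro a ha b hb hab
    by_contra hne
    have ha' := hg1 a (by simpa using ha)
    have hb' := hg1 b (by simpa using hb)
    rw [hab] at ha'
    exact Finset.disjoint_left.1 (hR hne) ha' hb'
  have hcard : n ≤ good.card := by
    have h := Finset.card_filter_add_card_filter_not (s := (Finset.univ : Finset (Fin s)))
      (fun b => Disjoint (R b) S)
    rw [Finset.card_univ, Fintype.card_fin, ← hgood] at h
    omega
  refine ⟨Finset.orderEmbOfCardLe good hcard, (Finset.orderEmbOfCardLe good hcard).injective,
    fun b => ?_⟩
  have := Finset.orderEmbOfCardLe_mem good hcard b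
  exact (Finset.mem_filter.1 this).2

variable {U : Type*} [AddCommGroup U] [Module ℝ U] [FiniteDimensional ℝ U]

theorem exists_subset_map_supp_eq (L : (ι → ℝ) →ₗ[ℝ] U) (T : Finset ι) :
    ∃ T' ⊆ T, T'.card ≤ Module.finrank ℝ U ∧ (supp T').map L = (supp T).map L := by
  set W := (supp T).map L with hW
  have hmem : ∀ x, (L ∘ₗ proj T) x ∈ W := fun x => ⟨proj T x, proj_mem_supp T x, rfl⟩
  have hon : Onto ((L ∘ₗ proj T).codRestrict W hmem) T := by
    rintro ⟨_, x, hx, rfl⟩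
    refine ⟨x, hx, Subtype.ext ?_⟩
    simp [proj_eq_self hx]
  obtain ⟨T', hT', hcard, hon', -⟩ := hon.exists_basis
  refine ⟨T', hT', hcard.trans_le (Submodule.finrank_le W), le_antisymm ?_ ?_⟩
  · exact Submodule.map_mono (supp_mono hT')
  · rintro _ ⟨x, hx, rfl⟩
    obtain ⟨x', hx', h⟩ := hon' ⟨L x, x, hx, rfl⟩
    refine ⟨x', hx', ?_⟩
    simpa [proj_eq_self (supp_mono hT' hx')] using congrArg Subtype.val h

variable [Fintype ι]

/-- Induction on a bound `n` for the remaining rank: if there are not `s` disjoint sets of full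
image, a small set meets all of them, and deleting it lowers the rank. -/
theorem exists_disjoint_map_supp_eq_aux (L : (ι → ℝ) →ₗ[ℝ] U) (s n : ℕ) (S₀ : Finset ι)
    (hn : Module.finrank ℝ ((supp S₀ᶜ).map L) ≤ n) :
    ∃ S : Finset ι, S.card ≤ S₀.card + n * (s * Module.finrank ℝ U) ∧
      ∃ T : Fin s → Finset ι, Pairwise (fun a b => Disjoint (T a) (T b)) ∧
        ∀ b, T b ⊆ Sᶜ ∧ (supp (T b)).map L = (supp Sᶜ).map L := by
  induction n generalizing S₀ with
  | zero =>
    refine ⟨S₀, by simp, fun _ => ∅, fun _ _ _ => Finset.disjoint_empty_left _, fun _ =>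
      ⟨Finset.empty_subset _, ?_⟩⟩
    rw [Submodule.finrank_eq_zero.1 (Nat.le_zero.1 hn), eq_bot_iff]
    rintro _ ⟨x, hx, rfl⟩
    have : x = 0 := by
      ext i
      exact hx i (by simp)
    simp [this]
  | succ n ih =>
    rcases exists_disjoint_or_cover
      (fun T => T ⊆ S₀ᶜ ∧ (supp T).map L = (supp S₀ᶜ).map L) (Module.finrank ℝ U) s with
      ⟨T, hT, h⟩ | ⟨S₁, hS₁, h⟩
    · exact ⟨S₀, by omega, T, hT, fun b => (h b).1⟩
    · have hlt : Module.finrank ℝ ((supp (S₀ ∪ S₁)ᶜ).map L) <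
          Module.finrank ℝ ((supp S₀ᶜ).map L) := by
        refine Submodule.finrank_lt_finrank_of_lt (lt_of_le_of_ne ?_ ?_)
        · refine Submodule.map_mono (supp_mono ?_)
          rw [Finset.compl_subset_compl]
          exact Finset.subset_union_left
        · intro heq
          obtain ⟨T', hT', hcard, hmap⟩ := exists_subset_map_supp_eq L (S₀ ∪ S₁)ᶜ
          rw [Finset.compl_union] at hT'
          refine h T' ⟨hT'.trans Finset.inter_subset_left, hmap.trans heq⟩ hcard ?_
          rw [← Finset.subset_compl_iff_disjoint_right]
          exact hT'.trans Finset.inter_subset_right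
      obtain ⟨S, hS, hT⟩ := ih (S₀ ∪ S₁) (by omega)
      refine ⟨S, hS.trans ?_, hT⟩
      have h1 := Finset.card_union_le S₀ S₁
      have h2 : (s - 1) * Module.finrank ℝ U ≤ s * Module.finrank ℝ U :=
        Nat.mul_le_mul_right _ (by omega)
      have h3 : (n + 1) * (s * Module.finrank ℝ U) =
        n * (s * Module.finrank ℝ U) + s * Module.finrank ℝ U := by ring
      omega

/-- After deleting few coordinates, a linear map has the same image on each of `s` disjoint sets of
coordinates as on all remaining coordinates. -/
theorem exists_disjoint_map_supp_eq (L : (ι → ℝ) →ₗ[ℝ] U) (s : ℕ) :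
    ∃ S : Finset ι, S.card ≤ Module.finrank ℝ U * (s * Module.finrank ℝ U) ∧
      ∃ T : Fin s → Finset ι, Pairwise (fun a b => Disjoint (T a) (T b)) ∧
        ∀ b, T b ⊆ Sᶜ ∧ (supp (T b)).map L = (supp Sᶜ).map L := by
  simpa using exists_disjoint_map_supp_eq_aux L s (Module.finrank ℝ U) ∅ (Submodule.finrank_le _)

/-- A version of `pr_quadric_le` without a nondegeneracy assumption on `L`: it suffices that there
are many disjoint sets of coordinates on which the fibre and the polynomial are nondegenerate. -/
theorem pr_quadric_le_of_pairs {V : Type*} [AddCommGroup V] [Module ℝ V]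
    [FiniteDimensional ℝ V] (L : (ι → ℝ) →ₗ[ℝ] U) (P : U →ₗ[ℝ] V) (B : U →ₗ[ℝ] U →ₗ[ℝ] ℝ)
    (b : U →ₗ[ℝ] ℝ) (c : ℝ) (v : V) {s n : ℕ} (hn : 1 ≤ n)
    (hs : Module.finrank ℝ U * (n * Module.finrank ℝ U) < s) {R : Fin s → Finset ι}
    (hR : Pairwise fun a b => Disjoint (R a) (R b)) (hon : ∀ a, Onto (P ∘ₗ L) (R a))
    (hpol : ∀ a, ∃ x ∈ supp (R a), ∃ y ∈ supp (R a), P (L x) = 0 ∧ P (L y) = 0 ∧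
      polar B (L x) (L y) ≠ 0) :
    pr (fun x => P (L x) = v ∧ quad B b c (L x) = 0) ≤
      20 ^ (Module.finrank ℝ V + 2) * (1 / √n) ^ (Module.finrank ℝ V + 1) := by
  obtain ⟨S, hS, T, hT, hTS⟩ := exists_disjoint_map_supp_eq L n
  obtain ⟨f, -, hf⟩ := exists_embedding_disjoint (n := 1) hR S (by omega)
  set R₀ := R (f 0)
  have hR₀ : R₀ ⊆ Sᶜ := Finset.subset_compl_iff_disjoint_right.2 (hf 0)
  obtain ⟨x, hx, y, hy, hPx, hPy, hxy⟩ := hpol (f 0)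
  set W := (supp Sᶜ).map L with hW
  have hmem : ∀ x, (L ∘ₗ proj Sᶜ) x ∈ W := fun x => ⟨proj Sᶜ x, proj_mem_supp _ x, rfl⟩
  set L₁ := (L ∘ₗ proj Sᶜ).codRestrict W hmem with hL₁
  have hL₁T : ∀ a, Onto L₁ (T a) := by
    rintro a ⟨w, hw⟩
    rw [← (hTS a).2] at hw
    obtain ⟨x, hx, rfl⟩ := hw
    refine ⟨x, hx, Subtype.ext ?_⟩
    simp [hL₁, proj_eq_self (supp_mono (hTS a).1 hx)]
  have hP₁ : Function.Surjective (P ∘ₗ W.subtype) := by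
    intro v
    obtain ⟨x, hx, rfl⟩ := hon (f 0) v
    exact ⟨⟨L x, x, supp_mono hR₀ hx, rfl⟩, rfl⟩
  have hLx : L x ∈ W := ⟨x, supp_mono hR₀ hx, rfl⟩
  have hLy : L y ∈ W := ⟨y, supp_mono hR₀ hy, rfl⟩
  refine pr_le_of_mix Sᶜ fun y₀ _ => ?_
  set u := L (proj Sᶜᶜ y₀) with hu
  have key := pr_quadric_le _ L₁ (P ∘ₗ W.subtype) hP₁ rfl (B.compl₁₂ W.subtype W.subtype)
    ((b + polar B u) ∘ₗ W.subtype) (quad B b c u) (v - P u) ?_ hn hT hL₁T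
  · refine (pr_mono ?_).trans key
    rintro x' - ⟨h1, h2⟩
    have h3 : L (mix Sᶜ x' y₀) = (L₁ x' : U) + u := by simp [mix, hL₁, hu]
    rw [h3] at h1 h2
    rw [quad_add] at h2
    refine ⟨?_, h2⟩
    rw [← h1]
    simp
  -- The second difference of the polynomial at four points of the fibre is `polar B (L x) (L y)`,
  -- which is nonzero.
  · by_contra! hcon
    obtain ⟨w₀, hw₀⟩ := hP₁ (v - P u)
    have hz : ∀ w : W, P w = v - P u → quad B b c (w + u) = 0 := by
      intro w hw
      rw [quad_add]
      exact hcon w hw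
    have hPw₀ : P w₀ = v - P u := hw₀
    have h1 := hz w₀ hPw₀
    have h2 := hz (w₀ + ⟨L x, hLx⟩) (by simp [hPw₀, hPx])
    have h3 := hz (w₀ + ⟨L y, hLy⟩) (by simp [hPw₀, hPy])
    have h4 := hz (w₀ + ⟨L x, hLx⟩ + ⟨L y, hLy⟩) (by simp [hPw₀, hPx, hPy])
    refine hxy ?_
    simp only [quad, polar_apply, Submodule.coe_add, map_add, LinearMap.add_apply] at h1 h2 h3 h4 ⊢
    linarith

end Robust

/-! ### Pairs of coordinate sets on which the form has prescribed rank. -/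

section Good

variable {ι : Type*} {V : Type*} [AddCommGroup V] [Module ℝ V]

/-- On the kernel of `L`, the pairing `B` between vectors supported in `T` and vectors supported in
`C` has rank at least `r`; moreover `L` is onto on each of the two sets of coordinates. -/
def IsGood (B : (ι → ℝ) →ₗ[ℝ] (ι → ℝ) →ₗ[ℝ] ℝ) (L : (ι → ℝ) →ₗ[ℝ] V) (r : ℕ)
    (T C : Finset ι) : Prop :=
  Onto L T ∧ Onto L C ∧ ∃ x y : Fin r → (ι → ℝ), (∀ p, x p ∈ supp T ∧ L (x p) = 0) ∧
    (∀ q, y q ∈ supp C ∧ L (y q) = 0) ∧ ∀ p q, B (x p) (y q) = if p = q then 1 else 0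

theorem IsGood.flip {B : (ι → ℝ) →ₗ[ℝ] (ι → ℝ) →ₗ[ℝ] ℝ} {L : (ι → ℝ) →ₗ[ℝ] V} {r : ℕ}
    {T C : Finset ι} (h : IsGood B L r T C) : IsGood B.flip L r C T := by
  obtain ⟨h1, h2, x, y, hx, hy, hxy⟩ := h
  exact ⟨h2, h1, y, x, hy, hx, fun p q => by simp [hxy, eq_comm]⟩

/-- A nonzero value of the pairing gives a pair of rank one. -/
theorem IsGood.of_ne_zero {B : (ι → ℝ) →ₗ[ℝ] (ι → ℝ) →ₗ[ℝ] ℝ} {L : (ι → ℝ) →ₗ[ℝ] V}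
    {T C : Finset ι} (hT : Onto L T) (hC : Onto L C) {x y : ι → ℝ} (hx : x ∈ supp T)
    (hLx : L x = 0) (hy : y ∈ supp C) (hLy : L y = 0) (hxy : B x y ≠ 0) : IsGood B L 1 T C := by
  refine ⟨hT, hC, fun _ => (B x y)⁻¹ • x, fun _ => y, fun _ => ⟨Submodule.smul_mem _ _ hx, ?_⟩,
    fun _ => ⟨hy, hLy⟩, fun p q => ?_⟩
  · simp [hLx]
  · rw [if_pos (Subsingleton.elim _ _)]
    simp [hxy]

/-- A biorthogonal form of Gram–Schmidt: the hypothesis `hne` says that the Schur complement of the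
dual system is nonzero at (x₀, y₀). Conversely, maximality of the rank makes this complement vanish,
as used in the low-rank case. -/
theorem exists_succ_of_ne {B : (ι → ℝ) →ₗ[ℝ] (ι → ℝ) →ₗ[ℝ] ℝ} {L : (ι → ℝ) →ₗ[ℝ] V} {r : ℕ}
    {T C : Finset ι} (hT : Onto L T) (hC : Onto L C) {x y : Fin r → (ι → ℝ)}
    (hx : ∀ p, x p ∈ supp T ∧ L (x p) = 0) (hy : ∀ q, y q ∈ supp C ∧ L (y q) = 0)
    (hxy : ∀ p q, B (x p) (y q) = if p = q then 1 else 0) {x₀ y₀ : ι → ℝ}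
    (hx₀ : x₀ ∈ supp T) (hLx₀ : L x₀ = 0) (hy₀ : y₀ ∈ supp C) (hLy₀ : L y₀ = 0)
    (hne : B x₀ y₀ ≠ ∑ p, B x₀ (y p) * B (x p) y₀) : IsGood B L (r + 1) T C := by
  set x₁ := x₀ - ∑ p, B x₀ (y p) • x p with hx₁
  set y₁ := y₀ - ∑ p, B (x p) y₀ • y p with hy₁
  have h1 : ∀ q, B x₁ (y q) = 0 := by
    intro q
    simp [hx₁, hxy]
  have h2 : ∀ p, B (x p) y₁ = 0 := by
    intro p
    simp [hy₁, hxy]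
  have h3 : B x₁ y₁ ≠ 0 := by
    have : B x₁ y₁ = B x₀ y₀ - ∑ p, B x₀ (y p) * B (x p) y₀ := by
      rw [hy₁, map_sub, map_sum]
      simp only [map_smul, h1, smul_zero, Finset.sum_const_zero, sub_zero]
      simp [hx₁]
    rw [this]
    exact sub_ne_zero.2 hne
  have hx₁m : x₁ ∈ supp T := Submodule.sub_mem _ hx₀
    (Submodule.sum_mem _ fun p _ => Submodule.smul_mem _ _ (hx p).1)
  have hy₁m : y₁ ∈ supp C := Submodule.sub_mem _ hy₀
    (Submodule.sum_mem _ fun p _ => Submodule.smul_mem _ _ (hy p).1)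
  have hLx₁ : L x₁ = 0 := by simp [hx₁, hLx₀, hx]
  have hLy₁ : L y₁ = 0 := by simp [hy₁, hLy₀, hy]
  refine ⟨hT, hC, Fin.cons ((B x₁ y₁)⁻¹ • x₁) x, Fin.cons y₁ y, ?_, ?_, ?_⟩
  · intro p
    induction p using Fin.cases with
    | zero => exact ⟨Submodule.smul_mem _ _ hx₁m, by simp [hLx₁]⟩
    | succ p => simpa using hx p
  · intro q
    induction q using Fin.cases with
    | zero => exact ⟨hy₁m, hLy₁⟩
    | succ q => simpa using hy q
  · intro p q
    induction p using Fin.cases with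
    | zero =>
      induction q using Fin.cases with
      | zero => simp [h3]
      | succ q => simp [h1, (Fin.succ_ne_zero q).symm]
    | succ p =>
      induction q using Fin.cases with
      | zero => simp [h2]
      | succ q => simp [hxy]

variable [DecidableEq ι] [FiniteDimensional ℝ V]

/-- Goodness in the left set says that `L` together with the `r` functionals given by the `y q` is
onto, so coordinates forming a basis suffice. -/
theorem IsGood.exists_subset_left {B : (ι → ℝ) →ₗ[ℝ] (ι → ℝ) →ₗ[ℝ] ℝ} {L : (ι → ℝ) →ₗ[ℝ] V}
    {r : ℕ} {T C : Finset ι} (h : IsGood B L r T C) :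
    ∃ T' ⊆ T, T'.card = Module.finrank ℝ V + r ∧ IsGood B L r T' C := by
  obtain ⟨h1, h2, x, y, hx, hy, hxy⟩ := h
  set M : (ι → ℝ) →ₗ[ℝ] V × (Fin r → ℝ) := L.prod (LinearMap.pi fun q => B.flip (y q)) with hM
  have hon : Onto M T := by
    rintro ⟨v, a⟩
    obtain ⟨x₀, hx₀, rfl⟩ := h1 v
    refine ⟨x₀ + ∑ p, (a p - B x₀ (y p)) • x p, Submodule.add_mem _ hx₀
      (Submodule.sum_mem _ fun p _ => Submodule.smul_mem _ _ (hx p).1), ?_⟩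
    ext q
    · simp [hM, hx]
    · simp [hM, hxy]
  obtain ⟨T', hT', hcard, hon', -⟩ := hon.exists_basis
  rw [Module.finrank_prod, Module.finrank_fin_fun] at hcard
  have hex : ∀ p, ∃ x' ∈ supp T', M x' = (0, Pi.single p 1) := fun p => hon' _
  choose x' hx'1 hx'2 using hex
  refine ⟨T', hT', hcard, hon'.comp (f := LinearMap.fst ℝ V (Fin r → ℝ))
    (fun v => ⟨(v, 0), rfl⟩), h2, x', y, fun p => ⟨hx'1 p, congrArg Prod.fst (hx'2 p)⟩, hy, ?_⟩
  intro p q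
  have := congrFun (congrArg Prod.snd (hx'2 p)) q
  simp only [hM, LinearMap.prod_apply, Function.prod_apply, LinearMap.pi_apply,
    LinearMap.flip_apply, Pi.single_apply] at this
  rw [this]
  simp [eq_comm]

theorem IsGood.exists_subset {B : (ι → ℝ) →ₗ[ℝ] (ι → ℝ) →ₗ[ℝ] ℝ} {L : (ι → ℝ) →ₗ[ℝ] V}
    {r : ℕ} {T C : Finset ι} (h : IsGood B L r T C) :
    ∃ T' ⊆ T, ∃ C' ⊆ C, (T' ∪ C').card ≤ 2 * (Module.finrank ℝ V + r) ∧ IsGood B L r T' C' := by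
  obtain ⟨T', hT', h1, h2⟩ := h.exists_subset_left
  obtain ⟨C', hC', h3, h4⟩ := h2.flip.exists_subset_left
  refine ⟨T', hT', C', hC', (Finset.card_union_le _ _).trans (by omega), ?_⟩
  simpa using h4.flip

end Good

/-! ### The low-rank case: reduction to few linear forms. -/

section LowRank

variable {ι : Type*} [Fintype ι] [DecidableEq ι] {V : Type*} [AddCommGroup V] [Module ℝ V]
  [FiniteDimensional ℝ V]

/-- A bilinear form vanishing on pairs of distinct coordinate vectors from `S` vanishes on pairs of
vectors with disjoint supports in `S`. -/
theorem bilin_eq_zero_of_disjoint {D : (ι → ℝ) →ₗ[ℝ] (ι → ℝ) →ₗ[ℝ] ℝ} {S : Finset ι}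
    (hD : ∀ i ∈ S, ∀ j ∈ S, i ≠ j → D (Pi.single i 1) (Pi.single j 1) = 0) {A A' : Finset ι}
    (hA : A ⊆ S) (hA' : A' ⊆ S) (hAA' : Disjoint A A') {x y : ι → ℝ} (hx : x ∈ supp A)
    (hy : y ∈ supp A') : D x y = 0 := by
  rw [eq_sum_single_of_mem_supp hx, eq_sum_single_of_mem_supp hy]
  simp only [map_sum, LinearMap.sum_apply, map_smul, LinearMap.smul_apply]
  refine Finset.sum_eq_zero fun i hi => ?_
  rw [Finset.sum_eq_zero, smul_zero]
  intro j hj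
  rw [hD j (hA hj) i (hA' hi) fun h => Finset.disjoint_left.1 hAA' hj (h ▸ hi), smul_zero]

/-- On sign vectors, a diagonal quadratic form is constant. -/
theorem bilin_self_eq_of_mem_cube {D : (ι → ℝ) →ₗ[ℝ] (ι → ℝ) →ₗ[ℝ] ℝ} {S : Finset ι}
    (hD : ∀ i ∈ S, ∀ j ∈ S, i ≠ j → D (Pi.single i 1) (Pi.single j 1) = 0) {x : ι → ℝ}
    (hx : x ∈ cube ι) : D (proj S x) (proj S x) = ∑ i ∈ S, D (Pi.single i 1) (Pi.single i 1) := by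
  rw [eq_sum_single_of_mem_supp (proj_mem_supp S x)]
  simp only [map_sum, LinearMap.sum_apply, map_smul, LinearMap.smul_apply]
  refine Finset.sum_congr rfl fun i hi => ?_
  rw [Finset.sum_eq_single i]
  · have : x i * x i = 1 := by
      rcases mem_cube.1 hx i with h | h <;> rw [h] <;> norm_num
    simp only [proj_apply, hi, if_true, smul_eq_mul, ← mul_assoc, this, one_mul]
  · intro j hj hji
    rw [hD j hj i hi hji]
    simp
  · exact fun h => absurd hi h

/-- The low-rank case: away from `S`, the rank of the pairing between disjoint sets of coordinates
cannot exceed that of a fixed pair contained in `S`. -/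
theorem pr_quad_le_of_lowRank {B : (ι → ℝ) →ₗ[ℝ] (ι → ℝ) →ₗ[ℝ] ℝ} (hB : ∀ x y, B x y = B y x)
    (b : (ι → ℝ) →ₗ[ℝ] ℝ) (c : ℝ) (L : (ι → ℝ) →ₗ[ℝ] V) (v : V) {r : ℕ} {T₀ C₀ S : Finset ι}
    (hgood : IsGood B L r T₀ C₀)
    (hmax : ∀ i ∉ S, ∀ j ∉ S, i ≠ j → ¬ IsGood B L (r + 1) (insert i T₀) (insert j C₀))
    {s n : ℕ} (hn : 1 ≤ n)
    (hs : (Module.finrank ℝ V + 2 * r + 1) * (n * (Module.finrank ℝ V + 2 * r + 1)) < s)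
    {T C : Fin s → Finset ι} (hTC : Pairwise fun a b => Disjoint (T a ∪ C a) (T b ∪ C b))
    (hd : ∀ a, Disjoint (T a) (C a)) (hg : ∀ a, IsGood B L 1 (T a) (C a))
    (hS : ∀ a, Disjoint (T a ∪ C a) S) :
    pr (fun x => L x = v ∧ quad B b c x = 0) ≤
      20 ^ (Module.finrank ℝ V + 2) * (1 / √n) ^ (Module.finrank ℝ V + 1) := by
  obtain ⟨hT₀, hC₀, x, y, hx, hy, hxy⟩ := hgood
  obtain ⟨σ, hσT, hσ⟩ := hT₀.exists_section
  obtain ⟨τ, hτC, hτ⟩ := hC₀.exists_section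
  -- `ρ` and `π` project onto the kernel of `L` by corrections within `T₀` and `C₀`. `D` is the form
  -- after these projections minus its rank-`r` part; a nonzero off-diagonal entry of `D` outside
  -- `S` would contradict `hmax`.
  set ρ : (ι → ℝ) →ₗ[ℝ] (ι → ℝ) := LinearMap.id - σ ∘ₗ L with hρ
  set π : (ι → ℝ) →ₗ[ℝ] (ι → ℝ) := LinearMap.id - τ ∘ₗ L with hπ
  have hρa : ∀ u, ρ u = u - σ (L u) := fun u => rfl
  have hπa : ∀ u, π u = u - τ (L u) := fun u => rfl
  set α : Fin r → (ι → ℝ) →ₗ[ℝ] ℝ := fun p => B.flip (y p) ∘ₗ ρ with hα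
  set β : Fin r → (ι → ℝ) →ₗ[ℝ] ℝ := fun p => B (x p) ∘ₗ π with hβ
  set D : (ι → ℝ) →ₗ[ℝ] (ι → ℝ) →ₗ[ℝ] ℝ :=
    B.compl₁₂ ρ π - ∑ p, (α p).smulRight (β p) with hD
  have hDa : ∀ u u', D u u' = B (ρ u) (π u') - ∑ p, α p u * β p u' := by
    intro u u'
    simp [hD]
  have hDz : ∀ i ∈ Sᶜ, ∀ j ∈ Sᶜ, i ≠ j → D (Pi.single i 1) (Pi.single j 1) = 0 := by
    intro i hi j hj hij
    by_contra hne
    rw [Finset.mem_compl] at hi hj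
    refine hmax i hi j hj hij (exists_succ_of_ne (hT₀.mono (Finset.subset_insert i T₀))
      (hC₀.mono (Finset.subset_insert j C₀))
      (fun p => ⟨supp_mono (Finset.subset_insert i T₀) (hx p).1, (hx p).2⟩)
      (fun p => ⟨supp_mono (Finset.subset_insert j C₀) (hy p).1, (hy p).2⟩) hxy
      (x₀ := ρ (Pi.single i 1)) (y₀ := π (Pi.single j 1)) ?_ ?_ ?_ ?_ ?_)
    · exact Submodule.sub_mem _ (single_mem_supp (Finset.mem_insert_self i T₀) 1)
        (supp_mono (Finset.subset_insert i T₀) (hσT _))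
    · rw [hρa, map_sub, hσ, sub_self]
    · exact Submodule.sub_mem _ (single_mem_supp (Finset.mem_insert_self j C₀) 1)
        (supp_mono (Finset.subset_insert j C₀) (hτC _))
    · rw [hπa, map_sub, hτ, sub_self]
    · intro h
      exact hne (by rw [hDa, h, sub_eq_zero]; rfl)
  refine pr_le_of_mix Sᶜ fun y₀ _ => ?_
  set u := proj Sᶜᶜ y₀ with hu
  set v₀ := v - L u with hv₀
  -- Where `L ξ = v₀`, ρ ξ = ξ - σ v₀ and π ξ = ξ - τ v₀. Expanding `D ξ ξ = κ` then expresses `B ξ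
  -- ξ` by the products α β and linear terms, which `h` collects.
  set h : (ι → ℝ) →ₗ[ℝ] ℝ := b + polar B u + B.flip (τ v₀) + B (σ v₀) with hh
  set κ := ∑ i ∈ Sᶜ, D (Pi.single i 1) (Pi.single i 1) with hκ
  set Λ : (ι → ℝ) →ₗ[ℝ] V × (Fin r → ℝ) × (Fin r → ℝ) × ℝ :=
    (L.prod ((LinearMap.pi α).prod ((LinearMap.pi β).prod h))) ∘ₗ proj Sᶜ with hΛ
  set BU : (V × (Fin r → ℝ) × (Fin r → ℝ) × ℝ) →ₗ[ℝ] (V × (Fin r → ℝ) × (Fin r → ℝ) × ℝ) →ₗ[ℝ] ℝ :=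
    LinearMap.mk₂ ℝ (fun w w' => ∑ p, w.2.1 p * w'.2.2.1 p)
      (fun w w' w'' => by simp [add_mul, Finset.sum_add_distrib])
      (fun a w w' => by simp [Finset.mul_sum, mul_assoc])
      (fun w w' w'' => by simp [mul_add, Finset.sum_add_distrib])
      (fun a w w' => by simp [Finset.mul_sum, mul_left_comm]) with hBU
  set bU : (V × (Fin r → ℝ) × (Fin r → ℝ) × ℝ) →ₗ[ℝ] ℝ :=
    LinearMap.snd ℝ _ _ ∘ₗ LinearMap.snd ℝ _ _ ∘ₗ LinearMap.snd ℝ _ _ with hbU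
  have key := pr_quadric_le_of_pairs Λ (LinearMap.fst ℝ V _) BU bU
    (quad B b c u + κ - B (σ v₀) (τ v₀)) v₀ hn (s := s) ?_ hTC ?_ ?_
  · refine (pr_mono ?_).trans key
    rintro x' hx' ⟨h1, h2⟩
    set ξ := proj Sᶜ x' with hξ
    have hmix : mix Sᶜ x' y₀ = ξ + u := rfl
    rw [hmix] at h1 h2
    have hLξ : L ξ = v₀ := by rw [hv₀, ← h1, map_add, add_sub_cancel_right]
    refine ⟨hLξ, ?_⟩
    rw [quad_add] at h2
    have h3 : D ξ ξ = κ := bilin_self_eq_of_mem_cube hDz hx'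
    rw [hDa, hρa, hπa, hLξ] at h3
    simp only [map_sub, LinearMap.sub_apply] at h3
    have h4 : quad BU bU (quad B b c u + κ - B (σ v₀) (τ v₀)) (Λ x') =
        ∑ p, α p ξ * β p ξ + h ξ + (quad B b c u + κ - B (σ v₀) (τ v₀)) := rfl
    rw [h4, hh]
    simp only [LinearMap.add_apply, LinearMap.flip_apply]
    unfold quad at h2 ⊢
    simp only [LinearMap.add_apply] at h2
    linarith
  · simp only [Module.finrank_prod, Module.finrank_fin_fun, Module.finrank_self]
    convert hs using 2
    · ring
    · ring
  · intro a
    exact (((hg a).1.mono Finset.subset_union_left).proj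
      (Finset.subset_compl_iff_disjoint_right.2 (hS a)))
  · intro a
    have hsub := Finset.subset_compl_iff_disjoint_right.2 (hS a)
    obtain ⟨-, -, x', y', hx', hy', hxy'⟩ := hg a
    have hxs := supp_mono (Finset.subset_union_left (s₂ := C a)) (hx' 0).1
    have hys := supp_mono (Finset.subset_union_right (s₁ := T a)) (hy' 0).1
    have hpx : proj Sᶜ (x' 0) = x' 0 := proj_eq_self (supp_mono hsub hxs)
    have hpy : proj Sᶜ (y' 0) = y' 0 := proj_eq_self (supp_mono hsub hys)
    refine ⟨x' 0, hxs, y' 0, hys, ?_, ?_, ?_⟩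
    · change L (proj Sᶜ (x' 0)) = 0
      rw [hpx, (hx' 0).2]
    · change L (proj Sᶜ (y' 0)) = 0
      rw [hpy, (hy' 0).2]
    · have e1 : BU (Λ (x' 0)) (Λ (y' 0)) = ∑ p, α p (x' 0) * β p (y' 0) := by
        change ∑ p, α p (proj Sᶜ (x' 0)) * β p (proj Sᶜ (y' 0)) = _
        rw [hpx, hpy]
      have e2 : BU (Λ (y' 0)) (Λ (x' 0)) = ∑ p, α p (y' 0) * β p (x' 0) := by
        change ∑ p, α p (proj Sᶜ (y' 0)) * β p (proj Sᶜ (x' 0)) = _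
        rw [hpx, hpy]
      have hTs : T a ⊆ Sᶜ := Finset.subset_union_left.trans hsub
      have hCs : C a ⊆ Sᶜ := Finset.subset_union_right.trans hsub
      have h1 := bilin_eq_zero_of_disjoint hDz hTs hCs (hd a) (hx' 0).1 (hy' 0).1
      have h2 := bilin_eq_zero_of_disjoint hDz hCs hTs (hd a).symm (hy' 0).1 (hx' 0).1
      rw [hDa, hρa, hπa, (hx' 0).2, (hy' 0).2, map_zero, map_zero, sub_zero, sub_zero] at h1 h2
      have h3 := hxy' 0 0
      rw [if_pos rfl] at h3
      have h4 := hB (x' 0) (y' 0)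
      -- Since `D` vanishes between `T a` and `C a`, the two sums equal `B (x' 0) (y' 0)` and `B (y'
      -- 0) (x' 0)`, both 1, so the polarization is 2.
      rw [polar_apply, e1, e2]
      intro h5
      linarith

end LowRank

end QuadLO

namespace QuadLO

/-! ### Sparse linear functionals of random signs. -/

section Sparse

variable {ι κ : Type*} [Fintype ι] [DecidableEq ι]

open Classical in
/-- The sequences of length `t` of indices from `K` whose functionals are linearly independent. -/
noncomputable def indepSeqs (g : κ → (ι → ℝ) →ₗ[ℝ] ℝ) (t : ℕ) (K : Finset κ) :
    Finset (Fin t → κ) :=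
  (Fintype.piFinset fun _ => K).filter fun b => LinearIndependent ℝ fun i => g (b i)

theorem mem_indepSeqs {g : κ → (ι → ℝ) →ₗ[ℝ] ℝ} {t : ℕ} {K : Finset κ} {b : Fin t → κ} :
    b ∈ indepSeqs g t K ↔ (∀ i, b i ∈ K) ∧ LinearIndependent ℝ fun i => g (b i) := by
  simp [indepSeqs]

/-- Sparse functionals with distinct marked coordinates have many linearly independent
sequences. -/
theorem pow_le_card_indepSeqs {g : κ → (ι → ℝ) →ₗ[ℝ] ℝ} {S : κ → Finset ι} {j : κ → ι}
    {K : Finset κ} {D : ℕ} (hS : ∀ b ∈ K, ∀ i, i ∉ S b → g b (Pi.single i 1) = 0)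
    (hD : ∀ b ∈ K, (S b).card ≤ D) (hj : Set.InjOn j K)
    (hgj : ∀ b ∈ K, g b (Pi.single (j b) 1) ≠ 0) (t : ℕ) :
    (K.card - t * D) ^ t ≤ (indepSeqs g t K).card := by
  classical
  induction t with
  | zero =>
    have : Fin.elim0 ∈ indepSeqs g 0 K :=
      mem_indepSeqs.2 ⟨fun i => i.elim0, linearIndependent_empty_type⟩
    simpa using Finset.card_pos.2 ⟨_, this⟩
  | succ t ih =>
    set next : (Fin t → κ) → Finset κ := fun b =>
      K.filter fun a => g a ∉ Submodule.span ℝ (Set.range fun i => g (b i)) with hnext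
    have hcard : ∀ b ∈ indepSeqs g t K, K.card - t * D ≤ (next b).card := by
      intro b hb
      rw [mem_indepSeqs] at hb
      -- A functional in the span of the chosen ones is supported on the union of their sets, so its
      -- marked coordinate is one of at most `t * D`.
      have hle : (K.filter fun a => g a ∈ Submodule.span ℝ (Set.range fun i => g (b i))).card ≤
          t * D := by
        have h1 : (Finset.univ.biUnion fun i => S (b i)).card ≤ t * D := by
          refine Finset.card_biUnion_le.trans ?_
          calc ∑ i, (S (b i)).card ≤ ∑ _i : Fin t, D :=
                Finset.sum_le_sum fun i _ => hD _ (hb.1 i)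
            _ = t * D := by simp
        refine le_trans (Finset.card_le_card_of_injOn j ?_ ?_) h1
        · intro a ha
          rw [Finset.mem_coe, Finset.mem_filter] at ha
          by_contra hna
          rw [Finset.mem_coe, Finset.mem_biUnion] at hna
          push Not at hna
          refine hgj a ha.1 ?_
          have hspan : Submodule.span ℝ (Set.range fun i => g (b i)) ≤
              LinearMap.ker (LinearMap.applyₗ (R := ℝ) (M₂ := ℝ) (Pi.single (j a) (1 : ℝ))) := by
            rw [Submodule.span_le]
            rintro _ ⟨i, rfl⟩
            exact hS _ (hb.1 i) _ (hna i (Finset.mem_univ i))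
          exact hspan ha.2
        · intro a ha a' ha' h
          exact hj (Finset.mem_filter.1 ha).1 (Finset.mem_filter.1 ha').1 h
      have h2 := Finset.card_filter_add_card_filter_not (s := K)
        (fun a => g a ∈ Submodule.span ℝ (Set.range fun i => g (b i)))
      change _ + (next b).card = _ at h2
      omega
    have hsig : ((indepSeqs g t K).sigma next).card ≤ (indepSeqs g (t + 1) K).card := by
      refine Finset.card_le_card_of_injOn (fun p => (Fin.cons p.2 p.1 : Fin (t + 1) → κ)) ?_ ?_
      · rintro ⟨b, a⟩ h
        rw [Finset.mem_coe, Finset.mem_sigma] at h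
        obtain ⟨hb, ha⟩ := h
        rw [mem_indepSeqs] at hb
        rw [hnext, Finset.mem_filter] at ha
        rw [Finset.mem_coe, mem_indepSeqs]
        constructor
        · intro i
          induction i using Fin.cases with
          | zero => simpa using ha.1
          | succ i => simpa using hb.1 i
        · have : (fun i => g ((Fin.cons a b : Fin (t + 1) → κ) i)) =
              (Fin.cons (g a) fun i => g (b i) : Fin (t + 1) → ((ι → ℝ) →ₗ[ℝ] ℝ)) := by
            ext i : 1
            induction i using Fin.cases with
            | zero => rfl
            | succ i => rfl
          simp only [this]
          exact linearIndependent_finCons.2 ⟨hb.2, ha.2⟩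
      · rintro ⟨b, a⟩ - ⟨b', a'⟩ - h
        obtain ⟨h1, h2⟩ := Fin.cons_inj.1 h
        simp only at h1 h2
        subst h1 h2
        rfl
    refine le_trans ?_ hsig
    rw [Finset.card_sigma]
    calc (K.card - (t + 1) * D) ^ (t + 1) ≤ (K.card - t * D) ^ (t + 1) := by
          refine Nat.pow_le_pow_left (Nat.sub_le_sub_left (Nat.mul_le_mul_right _ (by omega)) _) _
      _ = (K.card - t * D) ^ t * (K.card - t * D) := pow_succ _ _
      _ ≤ (indepSeqs g t K).card * (K.card - t * D) := Nat.mul_le_mul_right _ ih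
      _ = ∑ _b ∈ indepSeqs g t K, (K.card - t * D) := by simp
      _ ≤ _ := Finset.sum_le_sum hcard

theorem pr_forall_eq_le {t : ℕ} {h : Fin t → (ι → ℝ) →ₗ[ℝ] ℝ} (hh : LinearIndependent ℝ h)
    (c : Fin t → ℝ) : pr (fun y => ∀ i, h i y = c i) ≤ (1 / 2) ^ t := by
  have hsurj : Function.Surjective (LinearMap.pi h) := by
    have hon : Onto (LinearMap.pi h) Finset.univ := by
      by_contra hcon
      obtain ⟨θ, hθ, hz⟩ := not_onto_iff.1 hcon
      have hθ' : ∀ w, θ w = ∑ i, w i * θ (Pi.single i 1) := by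
        intro w
        have := map_eq_sum_of_mem_supp θ (T := Finset.univ) (x := w)
          fun i hi => absurd (Finset.mem_univ i) hi
        simpa using this
      have hsum : ∑ i, θ (Pi.single i 1) • h i = 0 := by
        refine LinearMap.ext fun y => ?_
        have := hz y fun i hi => absurd (Finset.mem_univ i) hi
        rw [hθ'] at this
        simpa [mul_comm] using this
      have hzero := Fintype.linearIndependent_iff.1 hh _ hsum
      refine hθ (LinearMap.ext fun w => ?_)
      rw [hθ' w]
      simp [hzero]
    exact hon.surjective
  have := pr_linear_le_two_pow t (LinearMap.pi h) hsurj (by simp) c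
  simpa [funext_iff] using this

open Classical in
/-- It is unlikely that most of a family of sparse functionals with distinct marked coordinates
take prescribed values. -/
theorem pr_many_eq_mul_le {g : κ → (ι → ℝ) →ₗ[ℝ] ℝ} (c : κ → ℝ) {S : κ → Finset ι} {j : κ → ι}
    {K : Finset κ} {D : ℕ} (hS : ∀ b ∈ K, ∀ i, i ∉ S b → g b (Pi.single i 1) = 0)
    (hD : ∀ b ∈ K, (S b).card ≤ D) (hj : Set.InjOn j K)
    (hgj : ∀ b ∈ K, g b (Pi.single (j b) 1) ≠ 0) (M t : ℕ) :
    pr (fun y => M ≤ (K.filter fun b => g b y = c b).card) * ((M - t * D : ℕ) : ℝ) ^ t ≤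
      (K.card / 2) ^ t := by
  -- A t-th moment count: on the event at least (M - tD)^t independent t-tuples are satisfied, and
  -- each tuple is satisfied with probability at most 2^(-t).
  have hlow : pr (fun y => M ≤ (K.filter fun b => g b y = c b).card) *
      ((M - t * D : ℕ) : ℝ) ^ t ≤
      ex fun y => ∑ b ∈ indepSeqs g t K, if ∀ i, g (b i) y = c (b i) then (1 : ℝ) else 0 := by
    rw [mul_comm, pr, ← ex_mul_left]
    refine ex_mono fun y _ => ?_
    by_cases hM : M ≤ (K.filter fun b => g b y = c b).card
    · rw [if_pos hM, mul_one, Finset.sum_ite, Finset.sum_const_zero, add_zero,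
        Finset.sum_const, nsmul_eq_mul, mul_one]
      have hsub : indepSeqs g t (K.filter fun b => g b y = c b) ⊆
          (indepSeqs g t K).filter fun b => ∀ i, g (b i) y = c (b i) := by
        intro b hb
        rw [mem_indepSeqs] at hb
        rw [Finset.mem_filter, mem_indepSeqs]
        exact ⟨⟨fun i => (Finset.mem_filter.1 (hb.1 i)).1, hb.2⟩,
          fun i => (Finset.mem_filter.1 (hb.1 i)).2⟩
      have h1 := pow_le_card_indepSeqs (K := K.filter fun b => g b y = c b) (S := S) (j := j)
        (D := D) (fun b hb => hS b (Finset.mem_filter.1 hb).1)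
        (fun b hb => hD b (Finset.mem_filter.1 hb).1)
        (hj.mono fun b hb => (Finset.mem_filter.1 hb).1)
        (fun b hb => hgj b (Finset.mem_filter.1 hb).1) t
      have h2 := (Nat.pow_le_pow_left (Nat.sub_le_sub_right hM (t * D)) t).trans
        (h1.trans (Finset.card_le_card hsub))
      exact_mod_cast h2
    · rw [if_neg hM, mul_zero]
      exact Finset.sum_nonneg fun b _ => by split_ifs <;> norm_num
  refine hlow.trans ?_
  rw [ex_sum]
  calc ∑ b ∈ indepSeqs g t K, ex (fun y => if ∀ i, g (b i) y = c (b i) then (1 : ℝ) else 0)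
      ≤ ∑ _b ∈ indepSeqs g t K, (1 / 2 : ℝ) ^ t := by
        refine Finset.sum_le_sum fun b hb => ?_
        refine le_trans (le_of_eq ?_)
          (pr_forall_eq_le (mem_indepSeqs.1 hb).2 fun i => c (b i))
        rw [pr]
        exact ex_congr fun y _ => by
          by_cases h : ∀ i, g (b i) y = c (b i)
          · rw [if_pos h, if_pos h]
          · rw [if_neg h, if_neg h]
    _ = (indepSeqs g t K).card * (1 / 2 : ℝ) ^ t := by rw [Finset.sum_const, nsmul_eq_mul]
    _ ≤ (K.card : ℝ) ^ t * (1 / 2 : ℝ) ^ t := by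
        refine mul_le_mul_of_nonneg_right ?_ (by positivity)
        have : (indepSeqs g t K).card ≤ K.card ^ t := by
          refine (Finset.card_filter_le _ _).trans (le_of_eq ?_)
          rw [Fintype.card_piFinset]
          simp
        exact_mod_cast this
    _ = (K.card / 2) ^ t := by rw [← mul_pow]; congr 1; ring

end Sparse

/-! ### It is rare that most pairs fail to see the new constraint. -/

section Failure

variable {ι : Type*} [Fintype ι] [DecidableEq ι] {V : Type*} [AddCommGroup V] [Module ℝ V]
  [FiniteDimensional ℝ V]

open Classical in
/-- If, together with `L`, each of `n` triples of functionals is onto on its own set of coordinates,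
then it is unlikely that `L` takes a prescribed value and nearly all triples do. -/
theorem pr_many_triples_le (L : (ι → ℝ) →ₗ[ℝ] V) {n : ℕ} {C : Fin n → Finset ι}
    (hC : Pairwise fun a b => Disjoint (C a) (C b)) {φ : Fin n → (ι → ℝ) →ₗ[ℝ] (Fin 3 → ℝ)}
    (hon : ∀ b, Onto (L.prod (φ b)) (C b)) (y' : ι → ℝ) {τ t M : ℕ} (hn : 1 ≤ n) (hτ : 1 ≤ τ)
    (hM : 19 * n ≤ 20 * M) (ht : 40 * (t * (τ * (Module.finrank ℝ V + 3))) ≤ n) :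
    pr (fun y => L y = L y' ∧ M ≤ (Finset.univ.filter fun b => φ b y = φ b y').card) ≤
      2 * (2 / √τ) ^ (Module.finrank ℝ V + 3) + (2 / 3) ^ t := by
  set k := Module.finrank ℝ V with hk
  have hrank : Module.finrank ℝ (V × (Fin 3 → ℝ)) = k + 3 := by
    rw [Module.finrank_prod, Module.finrank_fin_fun]
  -- The robust indices, for which Halász's inequality has `τ` disjoint blocks. If they are at least
  -- half, a first moment count suffices. For the others a small set meets every block, and some
  -- functional of `L` and the triple depends only on that set.
  set R : Finset (Fin n) := Finset.univ.filter fun b => ∃ T : Fin τ → Finset ι,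
    Pairwise (fun a b => Disjoint (T a) (T b)) ∧ ∀ a, Onto (L.prod (φ b)) (T a) with hR
  have hnR : (0 : ℝ) < n := by exact_mod_cast hn
  have hMR : (19 : ℝ) * n ≤ 20 * M := by exact_mod_cast hM
  have htR : (40 : ℝ) * (t * (τ * (k + 3))) ≤ n := by exact_mod_cast ht
  have hcount : ∀ (y : ι → ℝ) (K : Finset (Fin n)),
      M ≤ (Finset.univ.filter fun b => φ b y = φ b y').card →
      (M : ℝ) + K.card - n ≤ (K.filter fun b => φ b y = φ b y').card := by
    intro y K h
    have h1 : (Finset.univ.filter fun b => φ b y = φ b y').card ≤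
        (K.filter fun b => φ b y = φ b y').card + Kᶜ.card := by
      rw [← Finset.card_union_add_card_inter]
      refine le_add_right (Finset.card_le_card ?_)
      intro b hb
      rw [Finset.mem_filter] at hb
      by_cases hbK : b ∈ K
      · exact Finset.mem_union_left _ (Finset.mem_filter.2 ⟨hbK, hb.2⟩)
      · exact Finset.mem_union_right _ (Finset.mem_compl.2 hbK)
    have h2 : Kᶜ.card + K.card = n := by
      rw [Finset.card_compl_add_card, Fintype.card_fin]
    have h3 : M + K.card ≤ (K.filter fun b => φ b y = φ b y').card + n := by omega
    have h4 : (M : ℝ) + K.card ≤ (K.filter fun b => φ b y = φ b y').card + n := by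
      exact_mod_cast h3
    linarith
  have hRc : (R.card : ℝ) + Rᶜ.card = n := by
    have : R.card + Rᶜ.card = n := by rw [Finset.card_add_card_compl, Fintype.card_fin]
    exact_mod_cast this
  by_cases hhalf : (n : ℝ) ≤ 2 * R.card
  · refine le_trans ?_ (le_add_of_nonneg_right (by positivity))
    set q := pr (fun y => L y = L y' ∧ M ≤ (Finset.univ.filter fun b => φ b y = φ b y').card)
      with hq
    have hfirst : q * (R.card / 2 : ℝ) ≤ R.card * (2 / √τ) ^ (k + 3) := by
      calc q * (R.card / 2 : ℝ) ≤
          ex fun y => ∑ b ∈ R, if L y = L y' ∧ φ b y = φ b y' then (1 : ℝ) else 0 := by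
            rw [mul_comm, hq, pr, ← ex_mul_left]
            refine ex_mono fun y _ => ?_
            by_cases h : L y = L y' ∧ M ≤ (Finset.univ.filter fun b => φ b y = φ b y').card
            · rw [if_pos h, mul_one]
              simp only [h.1, true_and]
              rw [Finset.sum_ite, Finset.sum_const_zero, add_zero, Finset.sum_const,
                nsmul_eq_mul, mul_one]
              have := hcount y R h.2
              linarith
            · rw [if_neg h, mul_zero]
              exact Finset.sum_nonneg fun b _ => by split_ifs <;> norm_num
        _ = ∑ b ∈ R, ex fun y => if L y = L y' ∧ φ b y = φ b y' then (1 : ℝ) else 0 :=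
            ex_sum _ _
        _ ≤ ∑ _b ∈ R, (2 / √τ) ^ (k + 3) := by
            refine Finset.sum_le_sum fun b hb => ?_
            obtain ⟨T, hT, hTon⟩ := (Finset.mem_filter.1 hb).2
            have := pr_linear_le_pow (L.prod (φ b)) hτ hT hTon (n := k + 3) hrank.ge
              (L y', φ b y')
            refine le_trans (le_of_eq ?_) this
            rw [pr]
            refine ex_congr fun y _ => ?_
            simp [Prod.ext_iff]
        _ = R.card * (2 / √τ) ^ (k + 3) := by rw [Finset.sum_const, nsmul_eq_mul]
    have hRpos : (0 : ℝ) < R.card := by linarith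
    have : R.card * q ≤ R.card * (2 * (2 / √τ) ^ (k + 3)) := by linarith
    exact le_of_mul_le_mul_left this hRpos
  · refine le_trans ?_ (le_add_of_nonneg_left (by positivity))
    set K := Rᶜ with hK
    have hKn : (n : ℝ) ≤ 2 * K.card := by linarith
    have hcov : ∀ b ∈ K, ∃ (S : Finset ι) (θ : V × (Fin 3 → ℝ) →ₗ[ℝ] ℝ) (j : ι),
        S.card ≤ τ * (k + 3) ∧ j ∈ C b ∧ θ (L.prod (φ b) (Pi.single j 1)) ≠ 0 ∧
        ∀ i, i ∉ S → θ (L.prod (φ b) (Pi.single i 1)) = 0 := by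
      intro b hb
      have hbR : b ∉ R := Finset.mem_compl.1 hb
      rcases exists_disjoint_or_cover (fun T => Onto (L.prod (φ b)) T) (k + 3) τ with
        ⟨T, hT, h⟩ | ⟨S, hS, h⟩
      · exact absurd (Finset.mem_filter.2 ⟨Finset.mem_univ b, T, hT, fun a => (h a).1⟩) hbR
      · have hnot : ¬ Onto (L.prod (φ b)) Sᶜ := by
          intro hO
          obtain ⟨T', hT', hcard, hO', -⟩ := hO.exists_basis
          exact h T' hO' (by rw [hcard, hrank])
            (Finset.subset_compl_iff_disjoint_right.1 hT')
        obtain ⟨θ, hθ, hz⟩ := not_onto_iff.1 hnot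
        -- The functional is visible on `C b`, where the map is onto. As the `C b` are disjoint,
        -- these marked coordinates are distinct.
        have hex : ∃ j ∈ C b, θ (L.prod (φ b) (Pi.single j 1)) ≠ 0 := by
          by_contra! hcon
          refine hθ (LinearMap.ext fun w => ?_)
          obtain ⟨x, hx, rfl⟩ := hon b w
          rw [map_eq_sum_of_mem_supp _ hx, map_sum]
          exact Finset.sum_eq_zero fun i hi => by rw [map_smul, hcon i hi, smul_zero]
        obtain ⟨j, hj, hθj⟩ := hex
        exact ⟨S, θ, j, hS.trans (Nat.mul_le_mul_right _ (by omega)), hj, hθj,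
          fun i hi => hz _ (single_mem_supp (Finset.mem_compl.2 hi) 1)⟩
    have hne : Nonempty ι := by
      have hKpos : 0 < K.card := by
        have : (0 : ℝ) < K.card := by linarith
        exact_mod_cast this
      obtain ⟨b, hb⟩ := Finset.card_pos.1 hKpos
      obtain ⟨-, -, j, -⟩ := hcov b hb
      exact ⟨j⟩
    choose! S θ j hSc hjC hθj hθ0 using hcov
    set g : Fin n → (ι → ℝ) →ₗ[ℝ] ℝ := fun b => θ b ∘ₗ L.prod (φ b) with hg
    have hsparse := pr_many_eq_mul_le (g := g) (fun b => g b y') (S := S) (j := j) (K := K)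
      (D := τ * (k + 3)) hθ0 hSc ?_ hθj (M + K.card - n) t
    · have hmono : pr (fun y => L y = L y' ∧
          M ≤ (Finset.univ.filter fun b => φ b y = φ b y').card) ≤
          pr (fun y => M + K.card - n ≤ (K.filter fun b => g b y = g b y').card) := by
        refine pr_mono fun y _ h => ?_
        have h1 := hcount y K h.2
        have h2 : (K.filter fun b => φ b y = φ b y').card ≤
            (K.filter fun b => g b y = g b y').card := by
          refine Finset.card_le_card fun b hb => ?_
          rw [Finset.mem_filter] at hb ⊢
          refine ⟨hb.1, ?_⟩
          simp only [hg, LinearMap.comp_apply]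
          congr 1
          exact Prod.ext h.1 hb.2
        have h3 : (M : ℝ) + K.card ≤ (K.filter fun b => φ b y = φ b y').card + n := by linarith
        have h4 : M + K.card ≤ (K.filter fun b => φ b y = φ b y').card + n := by
          exact_mod_cast h3
        omega
      refine hmono.trans ?_
      have hKpos : (0 : ℝ) < K.card := by linarith
      -- The losses n/20 and n/40 are at most 3/20 of `K.card`, since `n ≤ 2 * K.card`. Comparing
      -- 3/4 with the 1/2 per functional gives the base 2/3.
      have hbig : (3 / 4 : ℝ) * K.card ≤ ((M + K.card - n - t * (τ * (k + 3)) : ℕ) : ℝ) := by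
        have h1 : (M : ℝ) + K.card - n - t * (τ * (k + 3)) ≤
            ((M + K.card - n - t * (τ * (k + 3)) : ℕ) : ℝ) := by
          have : M + K.card ≤ (M + K.card - n - t * (τ * (k + 3))) + n + t * (τ * (k + 3)) := by
            omega
          have h2 : (M : ℝ) + K.card ≤ ((M + K.card - n - t * (τ * (k + 3)) : ℕ) : ℝ) + n +
            t * (τ * (k + 3)) := by exact_mod_cast this
          linarith
        linarith
      set q := pr (fun y => M + K.card - n ≤ (K.filter fun b => g b y = g b y').card)
      have hq0 : 0 ≤ q := pr_nonneg _
      have h5 : q * ((3 / 4 : ℝ) * K.card) ^ t ≤ (K.card / 2) ^ t :=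
        (mul_le_mul_of_nonneg_left (pow_le_pow_left₀ (by positivity) hbig t) hq0).trans hsparse
      have h6 : (K.card / 2 : ℝ) ^ t = (2 / 3) ^ t * ((3 / 4 : ℝ) * K.card) ^ t := by
        rw [← mul_pow]
        congr 1
        ring
      rw [h6] at h5
      exact le_of_mul_le_mul_right h5 (by positivity)
    · intro a ha b hb hab
      by_contra hne
      have h1 := hjC a ha
      have h2 := hjC b hb
      rw [hab] at h1
      exact Finset.disjoint_left.1 (hC hne) h1 h2

end Failure

end QuadLO

namespace QuadLO

/-! ### The decoupling step and the rank dichotomy. -/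

section Steps

variable {ι : Type*} [Fintype ι] [DecidableEq ι] {V : Type*} [AddCommGroup V] [Module ℝ V]
  [FiniteDimensional ℝ V]

/-- The identity matrix of size three is not a sum of two rank-one matrices. -/
theorem not_one_eq_rank_two (a p q d : Fin 3 → ℝ) :
    ¬ ∀ i j, (if i = j then (1 : ℝ) else 0) = a i * p j + q i * d j := by
  intro h
  have h1 : (1 : Matrix (Fin 3) (Fin 3) ℝ) = Matrix.of fun i j => a i * p j + q i * d j := by
    ext i j
    rw [Matrix.one_apply, h i j, Matrix.of_apply]
  have h2 := congrArg Matrix.det h1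
  rw [Matrix.det_one, Matrix.det_fin_three] at h2
  simp only [Matrix.of_apply] at h2
  have h3 : (1 : ℝ) = 0 := h2.trans (by ring)
  exact one_ne_zero h3

/-- Adjoining one further linear constraint to a pair of rank three leaves a pair of rank one,
provided the constraint is visible on two additional sets of coordinates. -/
theorem IsGood.prod {B : (ι → ℝ) →ₗ[ℝ] (ι → ℝ) →ₗ[ℝ] ℝ} {L : (ι → ℝ) →ₗ[ℝ] V}
    {m : (ι → ℝ) →ₗ[ℝ] ℝ} {T C A A' : Finset ι} (h : IsGood B L 3 T C) {u u' : ι → ℝ}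
    (hu : u ∈ supp A) (hLu : L u = 0) (hmu : m u = 1) (hu' : u' ∈ supp A') (hLu' : L u' = 0)
    (hmu' : m u' = 1) : IsGood B (L.prod m) 1 (T ∪ A) (C ∪ A') := by
  obtain ⟨hT, hC, x, y, hx, hy, hxy⟩ := h
  have hon : ∀ {T A : Finset ι} {u : ι → ℝ}, Onto L T → u ∈ supp A → L u = 0 → m u = 1 →
      Onto (L.prod m) (T ∪ A) := by
    rintro T A u hT hu hLu hmu ⟨v, a⟩
    obtain ⟨x₀, hx₀, rfl⟩ := hT v
    refine ⟨x₀ + (a - m x₀) • u, Submodule.add_mem _ (supp_mono Finset.subset_union_left hx₀)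
      (Submodule.smul_mem _ _ (supp_mono Finset.subset_union_right hu)), ?_⟩
    ext <;> simp [hLu, hmu]
  -- Correcting the vectors by `u` and `u'` to satisfy the new constraint perturbs the identity
  -- matrix by one of rank at most two, so some entry survives in size three.
  have hex : ∃ p q, B (x p - m (x p) • u) (y q - m (y q) • u') ≠ 0 := by
    by_contra! hcon
    refine not_one_eq_rank_two (fun p => m (x p)) (fun q => B u (y q))
      (fun p => B (x p) u' - m (x p) * B u u') (fun q => m (y q)) fun p q => ?_
    have h1 := hcon p q
    simp only [map_sub, map_smul, LinearMap.sub_apply, LinearMap.smul_apply, smul_eq_mul,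
      hxy] at h1
    linarith
  obtain ⟨p, q, hpq⟩ := hex
  refine IsGood.of_ne_zero (hon hT hu hLu hmu) (hon hC hu' hLu' hmu') ?_ ?_ ?_ ?_ hpq
  · exact Submodule.sub_mem _ (supp_mono Finset.subset_union_left (hx p).1)
      (Submodule.smul_mem _ _ (supp_mono Finset.subset_union_right hu))
  · ext <;> simp [hx, hLu, hmu]
  · exact Submodule.sub_mem _ (supp_mono Finset.subset_union_left (hy q).1)
      (Submodule.smul_mem _ _ (supp_mono Finset.subset_union_right hu'))
  · ext <;> simp [hy, hLu', hmu']

theorem IsGood.comp_proj {B : (ι → ℝ) →ₗ[ℝ] (ι → ℝ) →ₗ[ℝ] ℝ} {L : (ι → ℝ) →ₗ[ℝ] V} {r : ℕ}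
    {T C S : Finset ι} (h : IsGood B L r T C) (hT : T ⊆ S) (hC : C ⊆ S) :
    IsGood (B.compl₁₂ (proj S) (proj S)) (L ∘ₗ proj S) r T C := by
  obtain ⟨h1, h2, x, y, hx, hy, hxy⟩ := h
  have hpx : ∀ p, proj S (x p) = x p := fun p => proj_eq_self (supp_mono hT (hx p).1)
  have hpy : ∀ p, proj S (y p) = y p := fun p => proj_eq_self (supp_mono hC (hy p).1)
  exact ⟨h1.proj hT, h2.proj hC, x, y, fun p => ⟨(hx p).1, by simp [hpx, hx]⟩,
    fun p => ⟨(hy p).1, by simp [hpy, hy]⟩, fun p q => by simp [hpx, hpy, hxy]⟩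

/-- One round of decoupling in the high-rank case: a bound for quadratic polynomials with one more
linear constraint gives a bound for the given one. -/
theorem pr_quad_sq_le_of_highRank {B : (ι → ℝ) →ₗ[ℝ] (ι → ℝ) →ₗ[ℝ] ℝ}
    (hB : ∀ x y, B x y = B y x) (b : (ι → ℝ) →ₗ[ℝ] ℝ) (c : ℝ) (L : (ι → ℝ) →ₗ[ℝ] V) (v : V)
    {n N s' τ t : ℕ} (hN : 2 * n ≤ N) {T C : Fin N → Finset ι}
    (hTC : Pairwise fun a b => Disjoint (T a ∪ C a) (T b ∪ C b))
    (hd : ∀ a, Disjoint (T a) (C a)) (hg : ∀ a, IsGood B L 3 (T a) (C a))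
    (hn : 1 ≤ n) (hs' : 40 * s' ≤ n) (hτ : 1 ≤ τ)
    (ht : 40 * (t * (τ * (Module.finrank ℝ V + 3))) ≤ n) {M : ℝ} (hM0 : 0 ≤ M)
    (hM : ∀ (B' : (ι → ℝ) →ₗ[ℝ] (ι → ℝ) →ₗ[ℝ] ℝ), (∀ x y, B' x y = B' y x) →
      ∀ (b' : (ι → ℝ) →ₗ[ℝ] ℝ) (c' : ℝ) (L' : (ι → ℝ) →ₗ[ℝ] V × ℝ) (v' : V × ℝ)
        (T' C' : Fin s' → Finset ι),
        (Pairwise fun a b => Disjoint (T' a ∪ C' a) (T' b ∪ C' b)) →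
        (∀ a, Disjoint (T' a) (C' a)) → (∀ a, IsGood B' L' 1 (T' a) (C' a)) →
        pr (fun x => L' x = v' ∧ quad B' b' c' x = 0) ≤ M) :
    pr (fun x => L x = v ∧ quad B b c x = 0) ^ 2 ≤
      (2 / √n) ^ Module.finrank ℝ V *
        (M + (2 * (2 / √τ) ^ (Module.finrank ℝ V + 3) + (2 / 3) ^ t)) := by
  classical
  set k := Module.finrank ℝ V with hk
  set T1 : Fin n → Finset ι := fun a => T ⟨a, by omega⟩ with hT1
  set C1 : Fin n → Finset ι := fun a => C ⟨a, by omega⟩ with hC1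
  set T2 : Fin n → Finset ι := fun a => T ⟨a + n, by omega⟩ with hT2
  set C2 : Fin n → Finset ι := fun a => C ⟨a + n, by omega⟩ with hC2
  have hd11 : ∀ a b, a ≠ b → Disjoint (T1 a ∪ C1 a) (T1 b ∪ C1 b) := fun a b hab =>
    hTC fun h => hab (Fin.ext (by simpa using h))
  have hd22 : ∀ a b, a ≠ b → Disjoint (T2 a ∪ C2 a) (T2 b ∪ C2 b) := fun a b hab =>
    hTC fun h => hab (Fin.ext (by simpa using h))
  have hd12 : ∀ a b, Disjoint (T1 a ∪ C1 a) (T2 b ∪ C2 b) := by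
    intro a b
    refine hTC fun h => ?_
    have := congrArg Fin.val h
    simp only at this
    omega
  -- Only the coordinates in the sets `C1` are resampled. The sets `T1`, which see the new
  -- constraint, and the whole second family stay among the shared coordinates.
  set J := Finset.univ.biUnion C1 with hJ
  set S := Jᶜ with hS
  have hSc : Sᶜ = J := compl_compl J
  have hC1J : ∀ a, C1 a ⊆ Sᶜ := fun a => by
    rw [hSc]
    exact Finset.subset_biUnion_of_mem C1 (Finset.mem_univ a)
  have hsubS : ∀ A : Finset ι, (∀ a, Disjoint A (C1 a)) → A ⊆ S := by
    intro A hA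
    rw [hS, Finset.subset_compl_iff_disjoint_right, hJ, Finset.disjoint_biUnion_right]
    exact fun a _ => hA a
  have hT1S : ∀ a, T1 a ⊆ S := fun a => hsubS _ fun a' => by
    by_cases h : a = a'
    · subst h; exact hd _
    · exact (hd11 a a' h).mono Finset.subset_union_left Finset.subset_union_right
  have hTC2S : ∀ a, T2 a ∪ C2 a ⊆ S := fun a => hsubS _ fun a' =>
    (hd12 a' a).symm.mono_right Finset.subset_union_right
  have hT2S : ∀ a, T2 a ⊆ S := fun a => Finset.subset_union_left.trans (hTC2S a)
  have hC2S : ∀ a, C2 a ⊆ S := fun a => Finset.subset_union_right.trans (hTC2S a)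
  have hC1d : Pairwise fun a b => Disjoint (C1 a) (C1 b) := fun a b hab =>
    (hd11 a b hab).mono Finset.subset_union_right Finset.subset_union_right
  have hT2d : Pairwise fun a b => Disjoint (T2 a) (T2 b) := fun a b hab =>
    (hd22 a b hab).mono Finset.subset_union_left Finset.subset_union_left
  have hg1 : ∀ a, IsGood B L 3 (T1 a) (C1 a) := fun a => hg _
  have hg2 : ∀ a, IsGood B L 3 (T2 a) (C2 a) := fun a => hg _
  choose h1T h1C x1 y1 hx1 hy1 hxy1 using hg1
  -- By symmetry of `B`, the new constraint `polar B (z y)` takes the value 2 B(x1 a p, z y) at `x1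
  -- a p`; it vanishes for all three p exactly when `φ a` agrees at `y` and `y'`.
  set φ : Fin n → (ι → ℝ) →ₗ[ℝ] (Fin 3 → ℝ) := fun a =>
    LinearMap.pi (fun p => B (x1 a p)) ∘ₗ proj Sᶜ with hφ
  have hφon : ∀ a, Onto ((L ∘ₗ proj Sᶜ).prod (φ a)) (C1 a) := by
    rintro a ⟨v₀, r⟩
    obtain ⟨y₀, hy₀, rfl⟩ := h1C a v₀
    have hmem : y₀ + ∑ q, (r q - B (x1 a q) y₀) • y1 a q ∈ supp (C1 a) :=
      Submodule.add_mem _ hy₀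
        (Submodule.sum_mem _ fun q _ => Submodule.smul_mem _ _ (hy1 a q).1)
    refine ⟨_, hmem, ?_⟩
    have hp := proj_eq_self (supp_mono (hC1J a) hmem)
    ext p
    · simp only [LinearMap.prod_apply, Function.prod_apply, LinearMap.comp_apply]
      rw [hp]
      simp [hy1]
    · simp only [LinearMap.prod_apply, Function.prod_apply, LinearMap.comp_apply, hφ,
        LinearMap.pi_apply]
      rw [hp]
      simp [hxy1]
  refine pr_sq_le_of_forall S fun y' _ => ?_
  set z : (ι → ℝ) → (ι → ℝ) := fun y => proj Sᶜ (y - y') with hz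
  set u := proj Sᶜ y' with hu
  have hmixz : ∀ x y, mix S x y = mix S x y' + z y := by
    intro x y
    simp only [mix, hz, map_sub]
    abel
  set fails : (ι → ℝ) → Finset (Fin n) := fun y => Finset.univ.filter fun a => φ a y = φ a y'
    with hfails
  have hpt : ∀ y ∈ cube ι, (pr fun x => (L (mix S x y) = v ∧ quad B b c (mix S x y) = 0) ∧
      (L (mix S x y') = v ∧ quad B b c (mix S x y') = 0)) ≤
      M * (if (L ∘ₗ proj Sᶜ) y = (L ∘ₗ proj Sᶜ) y' then 1 else 0) + (2 / √n) ^ k *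
        (if (L ∘ₗ proj Sᶜ) y = (L ∘ₗ proj Sᶜ) y' ∧ n - 2 * s' ≤ (fails y).card
          then 1 else 0) := by
    intro y _
    have hLz : (L ∘ₗ proj Sᶜ) y = (L ∘ₗ proj Sᶜ) y' ↔ L (z y) = 0 := by
      simp [hz, sub_eq_zero]
    by_cases hzy : L (z y) = 0
    swap
    · rw [pr_eq_zero]
      · have h1 : 0 ≤ (2 / √n) ^ k := by positivity
        refine add_nonneg (mul_nonneg hM0 ?_) (mul_nonneg h1 ?_) <;> split_ifs <;> norm_num
      · rintro x - ⟨⟨h1, -⟩, h2, -⟩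
        rw [hmixz, map_add, h2] at h1
        exact hzy (by simpa using h1)
    rw [if_pos (hLz.2 hzy), mul_one]
    -- In the exceptional case only the constraints `L` are used on the shared coordinates; its
    -- rarity comes from `pr_many_triples_le`.
    by_cases hf : n - 2 * s' ≤ (fails y).card
    · rw [if_pos ⟨hLz.2 hzy, hf⟩, mul_one]
      refine le_trans ?_ (le_add_of_nonneg_left hM0)
      refine (pr_mono (F := fun x => (L ∘ₗ proj S) x = v - L u) ?_).trans
        (pr_linear_le_pow (L ∘ₗ proj S) hn hT2d (fun a => (hg2 a).1.proj (hT2S a)) le_rfl _)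
      rintro x - ⟨-, h3, -⟩
      rw [eq_sub_iff_add_eq, LinearMap.comp_apply, ← map_add]
      exact h3
    refine le_trans ?_ (le_add_of_nonneg_right (by split_ifs <;> simp <;> positivity))
    -- many functionals see the new constraint
    set good : Finset (Fin n) := Finset.univ.filter fun a => ¬ φ a y = φ a y' with hgood
    have hcard : 2 * s' ≤ good.card := by
      have h1 : (fails y).card + good.card = n := by
        have := Finset.card_filter_add_card_filter_not (s := (Finset.univ : Finset (Fin n)))
          (fun a => φ a y = φ a y')
        rwa [Finset.card_univ, Fintype.card_fin] at this
      omega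
    set f := Finset.orderEmbOfCardLe good hcard with hf'
    set m : (ι → ℝ) →ₗ[ℝ] ℝ := polar B (z y) with hm
    have hex : ∀ a : Fin (2 * s'), ∃ w ∈ supp (T1 (f a)), L w = 0 ∧ m w = 1 := by
      intro a
      have hmem : f a ∈ good := Finset.orderEmbOfCardLe_mem good hcard a
      have hne := (Finset.mem_filter.1 hmem).2
      obtain ⟨p, hp⟩ := Function.ne_iff.1 hne
      have hmp : m (x1 (f a) p) ≠ 0 := by
        intro h0
        refine hp ?_
        rw [hm, polar_apply, hB (z y)] at h0
        have h1 : B (x1 (f a) p) (z y) = 0 := by linarith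
        simp only [hz, map_sub] at h1
        simpa [hφ, sub_eq_zero] using h1
      refine ⟨(m (x1 (f a) p))⁻¹ • x1 (f a) p, Submodule.smul_mem _ _ (hx1 _ p).1, ?_, ?_⟩
      · simp [hx1]
      · simp [hmp]
    choose w hw hLw hmw using hex
    -- A pair for the enlarged system takes its rank from the second family and two sets `T1` that
    -- see the new constraint, one for each side; hence `2 * s'` of them.
    set f1 : Fin s' → Fin (2 * s') := fun a => ⟨a, by omega⟩ with hf1
    set f2 : Fin s' → Fin (2 * s') := fun a => ⟨a + s', by omega⟩ with hf2
    set e : Fin s' → Fin n := fun a => ⟨a, by omega⟩ with he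
    have hf12 : ∀ a a', f (f1 a) ≠ f (f2 a') := by
      intro a a' h
      have := congrArg Fin.val (f.injective h)
      simp only [hf1, hf2] at this
      omega
    have hf11 : ∀ a a', a ≠ a' → f (f1 a) ≠ f (f1 a') := by
      intro a a' haa h
      have := congrArg Fin.val (f.injective h)
      exact haa (Fin.ext this)
    have hf22 : ∀ a a', a ≠ a' → f (f2 a) ≠ f (f2 a') := by
      intro a a' haa h
      have := congrArg Fin.val (f.injective h)
      simp only [hf2] at this
      exact haa (Fin.ext (by omega))
    have hT1d : ∀ a b, a ≠ b → Disjoint (T1 a) (T1 b) := fun a b hab =>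
      (hd11 a b hab).mono Finset.subset_union_left Finset.subset_union_left
    have hT12 : ∀ a b, Disjoint (T1 a) (T2 b ∪ C2 b) := fun a b =>
      (hd12 a b).mono_left Finset.subset_union_left
    have hee : ∀ a a', a ≠ a' → e a ≠ e a' := fun a a' haa h =>
      haa (Fin.ext (by simpa [he] using h))
    have key := hM (B.compl₁₂ (proj S) (proj S)) (fun x y => by simp [hB])
      ((b + polar B u) ∘ₗ proj S) (quad B b c u) ((L.prod m) ∘ₗ proj S)
      (v - L u, -(B (z y) (z y) + b (z y)) - m u)
      (fun a => T2 (e a) ∪ T1 (f (f1 a))) (fun a => C2 (e a) ∪ T1 (f (f2 a))) ?_ ?_ ?_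
    · refine (pr_mono ?_).trans key
      rintro x - ⟨⟨h1, h2⟩, h3, h4⟩
      rw [hmixz, quad_add', h4] at h2
      have h5 : mix S x y' = proj S x + u := rfl
      rw [h5] at h2 h3 h4
      rw [quad_add] at h4
      rw [map_add] at h2 h3
      refine ⟨?_, h4⟩
      simp only [LinearMap.comp_apply, LinearMap.prod_apply, Function.prod_apply, Prod.mk.injEq]
      refine ⟨by rw [← h3]; abel, ?_⟩
      rw [hm]
      linarith
    · intro a a' haa
      have d1 := hd22 _ _ (hee a a' haa)
      have d2 := hT12 (f (f1 a)) (e a')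
      have d3 := hT12 (f (f2 a)) (e a')
      have d4 := (hT12 (f (f1 a')) (e a)).symm
      have d5 := (hT12 (f (f2 a')) (e a)).symm
      have d6 := hT1d _ _ (hf11 a a' haa)
      have d7 := hT1d _ _ (hf22 a a' haa)
      have d8 := hT1d _ _ (hf12 a a')
      have d9 := hT1d _ _ (hf12 a' a).symm
      simp only [Finset.disjoint_union_left, Finset.disjoint_union_right] at *
      tauto
    · intro a
      have d1 : Disjoint (T2 (e a)) (C2 (e a)) := hd _
      have d3 := hT12 (f (f1 a)) (e a)
      have d5 := (hT12 (f (f2 a)) (e a)).symm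
      have d8 := hT1d _ _ (hf12 a a)
      simp only [Finset.disjoint_union_left, Finset.disjoint_union_right] at *
      tauto
    · intro a
      refine ((hg2 (e a)).prod (hw (f1 a)) (hLw _) (hmw _) (hw (f2 a)) (hLw _) (hmw _)).comp_proj
        ?_ ?_
      · exact Finset.union_subset (hT2S _) (hT1S _)
      · exact Finset.union_subset (hC2S _) (hT1S _)
  refine (ex_mono hpt).trans ?_
  rw [ex_add, ex_mul_left, ex_mul_left, mul_add]
  refine add_le_add ?_ (mul_le_mul_of_nonneg_left ?_ (by positivity))
  · rw [mul_comm]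
    refine mul_le_mul_of_nonneg_right ?_ hM0
    exact pr_linear_le_pow (L ∘ₗ proj Sᶜ) hn hC1d (fun a => (h1C a).proj (hC1J a)) le_rfl _
  · have := pr_many_triples_le (L ∘ₗ proj Sᶜ) hC1d hφon y' (M := n - 2 * s') hn hτ (by omega) ht
    refine le_trans (le_of_eq ?_) this
    rw [pr]
    refine ex_congr fun y _ => ?_
    by_cases h : (L ∘ₗ proj Sᶜ) y = (L ∘ₗ proj Sᶜ) y' ∧ n - 2 * s' ≤ (fails y).card
    · rw [if_pos h, if_pos]
      convert h
    · rw [if_neg h, if_neg]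
      convert h

/-- Either the low-rank bound applies or there are many pairs of rank three. -/
theorem pr_quad_le_or_highRank {B : (ι → ℝ) →ₗ[ℝ] (ι → ℝ) →ₗ[ℝ] ℝ}
    (hB : ∀ x y, B x y = B y x) (b : (ι → ℝ) →ₗ[ℝ] ℝ) (c : ℝ) (L : (ι → ℝ) →ₗ[ℝ] V) (v : V)
    {n s : ℕ} (hn : 1 ≤ n) (hs : 3 * (Module.finrank ℝ V + 5) ^ 2 * n < s)
    {T C : Fin s → Finset ι} (hTC : Pairwise fun a b => Disjoint (T a ∪ C a) (T b ∪ C b))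
    (hd : ∀ a, Disjoint (T a) (C a)) (hg : ∀ a, IsGood B L 1 (T a) (C a)) :
    pr (fun x => L x = v ∧ quad B b c x = 0) ≤
        20 ^ (Module.finrank ℝ V + 2) * (1 / √n) ^ (Module.finrank ℝ V + 1) ∨
      ∃ T' C' : Fin (2 * n) → Finset ι,
        (Pairwise fun a b => Disjoint (T' a ∪ C' a) (T' b ∪ C' b)) ∧
        (∀ a, Disjoint (T' a) (C' a)) ∧ ∀ a, IsGood B L 3 (T' a) (C' a) := by
  set k := Module.finrank ℝ V with hk
  rcases exists_disjoint_or_cover (fun R => ∃ T C, R = T ∪ C ∧ Disjoint T C ∧ IsGood B L 3 T C)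
    (2 * (k + 3)) (2 * n) with ⟨R, hR, h⟩ | ⟨S, hS, h⟩
  · choose T' C' hRTC hd' hg' using fun a => (h a).1
    refine Or.inr ⟨T', C', ?_, hd', hg'⟩
    intro a b hab
    have := hR hab
    simpa [hRTC] using this
  left
  have hno3 : ∀ T C, Disjoint T C → Disjoint T S → Disjoint C S → ¬ IsGood B L 3 T C := by
    intro T C h1 h2 h3 h4
    obtain ⟨T', hT', C', hC', hcard, hg'⟩ := h4.exists_subset
    refine h (T' ∪ C') ⟨T', C', rfl, h1.mono hT' hC', hg'⟩ hcard ?_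
    rw [Finset.disjoint_union_left]
    exact ⟨h2.mono_left hT', h3.mono_left hC'⟩
  have hk5 : 6 * (k + 5) ≤ 2 * (k + 5) ^ 2 := by nlinarith
  have hScard : S.card + 2 * (k + 2) ≤ 6 * (k + 5) * n := by
    have h1 : (2 * n - 1) * (2 * (k + 3)) ≤ 2 * n * (2 * (k + 3)) :=
      Nat.mul_le_mul_right _ (by omega)
    nlinarith
  -- `r` is the largest rank available off `S`, either 1 or 2. The pair attaining it is shrunk to at
  -- most 2(k + r) coordinates, and the given pairs meeting those or `S` are discarded.
  have hmain : ∀ (r : ℕ) (T₀ C₀ : Finset ι), r ≤ 2 → Disjoint T₀ C₀ → Disjoint T₀ S →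
      Disjoint C₀ S → IsGood B L r T₀ C₀ →
      (∀ T C, Disjoint T C → Disjoint T S → Disjoint C S → ¬ IsGood B L (r + 1) T C) →
      pr (fun x => L x = v ∧ quad B b c x = 0) ≤
        20 ^ (k + 2) * (1 / √n) ^ (k + 1) := by
    intro r T₁ C₁ hr hd1 hT1 hC1 hg1 hmax
    obtain ⟨T₀, hT₀, C₀, hC₀, hcard, hg₀⟩ := hg1.exists_subset
    set S' := S ∪ (T₀ ∪ C₀) with hS'
    have hS'card : S'.card ≤ S.card + 2 * (k + r) :=
      (Finset.card_union_le _ _).trans (by omega)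
    set q := (k + 2 * r + 1) * (n * (k + 2 * r + 1)) with hq
    have hqle : q ≤ (k + 5) ^ 2 * n := by
      have : k + 2 * r + 1 ≤ k + 5 := by omega
      calc q ≤ (k + 5) * (n * (k + 5)) :=
            Nat.mul_le_mul this (Nat.mul_le_mul_left _ this)
        _ = _ := by ring
    have htot : (q + 1) + S'.card ≤ s := by
      have h1 : 6 * (k + 5) * n ≤ 2 * (k + 5) ^ 2 * n := Nat.mul_le_mul_right _ hk5
      have h2 : 3 * (k + 5) ^ 2 * n = 2 * (k + 5) ^ 2 * n + (k + 5) ^ 2 * n := by ring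
      omega
    obtain ⟨f, hf, hfd⟩ := exists_embedding_disjoint hTC S' htot
    refine pr_quad_le_of_lowRank hB b c L v hg₀ (S := S') ?_ hn (s := q + 1) (Nat.lt_succ_self q)
      (T := fun a => T (f a)) (C := fun a => C (f a)) (fun a b hab => hTC (hf.ne hab))
      (fun a => hd _) (fun a => hg _) hfd
    intro i hi j hj hij
    simp only [hS', Finset.mem_union, not_or] at hi hj
    refine hmax _ _ ?_ ?_ ?_
    · rw [Finset.disjoint_insert_left, Finset.disjoint_insert_right]
      refine ⟨?_, hi.2.2 |> fun _ => hj.2.1, hd1.mono hT₀ hC₀⟩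
      rw [Finset.mem_insert, not_or]
      exact ⟨hij, hi.2.2⟩
    · rw [Finset.disjoint_insert_left]
      exact ⟨hi.1, hT1.mono_left hT₀⟩
    · rw [Finset.disjoint_insert_left]
      exact ⟨hj.1, hC1.mono_left hC₀⟩
  by_cases h2 : ∃ T C, Disjoint T C ∧ Disjoint T S ∧ Disjoint C S ∧ IsGood B L 2 T C
  · obtain ⟨T₀, C₀, e1, e2, e3, e4⟩ := h2
    exact hmain 2 T₀ C₀ le_rfl e1 e2 e3 e4 hno3
  · push Not at h2
    have h3 : 1 + S.card ≤ s := by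
      have h1 : 6 * (k + 5) * n ≤ 2 * (k + 5) ^ 2 * n := Nat.mul_le_mul_right _ hk5
      have h2 : 3 * (k + 5) ^ 2 * n = 2 * (k + 5) ^ 2 * n + (k + 5) ^ 2 * n := by ring
      omega
    obtain ⟨f, -, hf⟩ := exists_embedding_disjoint hTC S h3
    have := hf 0
    rw [Finset.disjoint_union_left] at this
    exact hmain 1 _ _ (by norm_num) (hd (f 0)) this.1 this.2 (hg (f 0)) h2

end Steps

end QuadLO

namespace QuadLO

/-! ### Choice of parameters and constants. -/

section Numerics

theorem inv_sqrt_le_of_le_mul {s n : ℕ} {Q : ℝ} (hs : 1 ≤ s) (hQ : 1 ≤ Q)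
    (h : (s : ℝ) ≤ Q * n) : 1 / √n ≤ Q * (1 / √s) := by
  have hs' : (0 : ℝ) < s := by exact_mod_cast hs
  have hn : (0 : ℝ) < n := by
    by_contra hn
    have : (n : ℝ) = 0 := le_antisymm (not_lt.1 hn) (Nat.cast_nonneg n)
    rw [this, mul_zero] at h
    linarith
  have h1 : √s ≤ Q * √n := by
    rw [Real.sqrt_le_left (by positivity), mul_pow, Real.sq_sqrt hn.le]
    nlinarith
  have h2 : 0 < √(s : ℝ) := Real.sqrt_pos.2 hs'
  have h3 : 0 < √(n : ℝ) := Real.sqrt_pos.2 hn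
  rw [mul_one_div, div_le_div_iff₀ h3 h2]
  linarith

/-- From y ≤ exp y at y = (t+1)/(3N), the N-th power of t + 1 costs exp((t+1)/3), and exp(1/3) ≤
3/2. -/
theorem two_thirds_pow_mul_le (t N : ℕ) (hN : 1 ≤ N) :
    (2 / 3 : ℝ) ^ t * ((t : ℝ) + 1) ^ N ≤ 2 * (3 * N) ^ N := by
  have hN' : (0 : ℝ) < N := by exact_mod_cast hN
  have h1 : (t : ℝ) + 1 ≤ 3 * N * Real.exp ((t + 1) / (3 * N)) := by
    have := Real.add_one_le_exp (((t : ℝ) + 1) / (3 * N))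
    have h2 : ((t : ℝ) + 1) = 3 * N * ((t + 1) / (3 * N)) := by field_simp
    calc (t : ℝ) + 1 = 3 * N * ((t + 1) / (3 * N)) := h2
      _ ≤ _ := by gcongr; linarith
  have h3 : Real.exp (1 / 3) ≤ 3 / 2 := by
    have h4 : Real.exp (1 / 3) ^ 3 ≤ (3 / 2) ^ 3 := by
      rw [← Real.exp_nat_mul]
      norm_num
      linarith [Real.exp_one_lt_d9]
    exact le_of_pow_le_pow_left₀ (by norm_num) (by norm_num) h4
  have h5 : ((t : ℝ) + 1) ^ N ≤ (3 * N) ^ N * (3 / 2) ^ (t + 1) := by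
    calc ((t : ℝ) + 1) ^ N ≤ (3 * N * Real.exp ((t + 1) / (3 * N))) ^ N := by gcongr
      _ = (3 * N) ^ N * Real.exp (1 / 3) ^ (t + 1) := by
          rw [mul_pow, ← Real.exp_nat_mul, ← Real.exp_nat_mul]
          congr 2
          push_cast
          field_simp
      _ ≤ _ := by gcongr
  have h6 : (2 / 3 : ℝ) ^ t * (3 / 2) ^ (t + 1) = 3 / 2 := by
    rw [pow_succ, ← mul_assoc, ← mul_pow]
    norm_num
  calc (2 / 3 : ℝ) ^ t * ((t : ℝ) + 1) ^ N
      ≤ (2 / 3) ^ t * ((3 * N) ^ N * (3 / 2) ^ (t + 1)) := by gcongr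
    _ = (3 * N) ^ N * ((2 / 3 : ℝ) ^ t * (3 / 2) ^ (t + 1)) := by ring
    _ ≤ _ := by
      rw [h6]
      have : (0 : ℝ) ≤ (3 * N) ^ N := by positivity
      linarith

/-- Integer parameters balancing the robust and the sparse bounds. -/
theorem exists_parameters {s n Q k : ℕ} (hs : 1 ≤ s) (hQ : s ≤ Q * n) :
    ∃ τ t : ℕ, 1 ≤ τ ∧ 40 * (t * (τ * (k + 3))) ≤ n ∧ s ^ (k + 2) ≤ τ ^ (k + 3) ∧
      s ^ (k + 2) ≤ (80 * Q * (k + 3) * (t + 1)) ^ ((k + 2) * (k + 3)) := by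
  have hex : ∃ τ : ℕ, s ^ (k + 2) ≤ τ ^ (k + 3) :=
    ⟨s, Nat.pow_le_pow_right hs (by omega)⟩
  classical
  -- `τ` is about s^((k+2)/(k+3)), just enough for the robust bound. It is sublinear in `s`, which
  -- leaves `t` of order s^(1/(k+3)), so that (2/3)^t beats any power of `s`.
  set τ := Nat.find hex with hτ
  have h1 : s ^ (k + 2) ≤ τ ^ (k + 3) := Nat.find_spec hex
  have h2 : 1 ≤ τ := by
    rcases Nat.eq_zero_or_pos τ with h | h
    · rw [h, zero_pow (by omega)] at h1
      have := Nat.pow_pos (n := k + 2) hs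
      omega
    · exact h
  have h3 : τ ^ (k + 3) ≤ 2 ^ (k + 3) * s ^ (k + 2) := by
    rcases Nat.lt_or_ge τ 2 with h | h
    · have : τ = 1 := by omega
      rw [this, one_pow]
      exact Nat.mul_pos (by positivity) (Nat.pow_pos hs)
    · have h4 := Nat.find_min hex (m := τ - 1) (by omega)
      calc τ ^ (k + 3) ≤ (2 * (τ - 1)) ^ (k + 3) := Nat.pow_le_pow_left (by omega) _
        _ = 2 ^ (k + 3) * (τ - 1) ^ (k + 3) := mul_pow _ _ _
        _ ≤ _ := Nat.mul_le_mul_left _ (by omega)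
  set d := 40 * (τ * (k + 3)) with hd
  have hd0 : 0 < d := by positivity
  refine ⟨τ, n / d, h2, ?_, h1, ?_⟩
  · calc 40 * (n / d * (τ * (k + 3))) = n / d * d := by rw [hd]; ring
      _ ≤ n := Nat.div_mul_le_self n d
  · set t := n / d
    have h5 : n < d * (t + 1) := by
      have := Nat.lt_div_mul_add hd0 (a := n)
      calc n < n / d * d + d := this
        _ = d * (t + 1) := by ring
    have h6 : s ≤ Q * (40 * (k + 3)) * (t + 1) * τ := by
      calc s ≤ Q * n := hQ
        _ ≤ Q * (d * (t + 1)) := Nat.mul_le_mul_left _ h5.le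
        _ = _ := by rw [hd]; ring
    have h7 : s ^ (k + 3) ≤ (80 * Q * (k + 3) * (t + 1)) ^ (k + 3) * s ^ (k + 2) := by
      calc s ^ (k + 3) ≤ (Q * (40 * (k + 3)) * (t + 1) * τ) ^ (k + 3) :=
            Nat.pow_le_pow_left h6 _
        _ = (Q * (40 * (k + 3)) * (t + 1)) ^ (k + 3) * τ ^ (k + 3) := mul_pow _ _ _
        _ ≤ (Q * (40 * (k + 3)) * (t + 1)) ^ (k + 3) * (2 ^ (k + 3) * s ^ (k + 2)) :=
            Nat.mul_le_mul_left _ h3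
        _ = (2 * (Q * (40 * (k + 3)) * (t + 1))) ^ (k + 3) * s ^ (k + 2) := by
            rw [mul_pow 2]; ring
        _ = _ := by congr 2; ring
    have h8 : s ≤ (80 * Q * (k + 3) * (t + 1)) ^ (k + 3) := by
      rw [pow_succ' s (k + 2)] at h7
      exact Nat.le_of_mul_le_mul_right h7 (Nat.pow_pos hs)
    calc s ^ (k + 2) ≤ ((80 * Q * (k + 3) * (t + 1)) ^ (k + 3)) ^ (k + 2) :=
          Nat.pow_le_pow_left h8 _
      _ = _ := by rw [← pow_mul, mul_comm (k + 3)]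

/-- The constant lost in one step of the induction, in terms of the number of linear
constraints. -/
noncomputable def stepConst (k : ℕ) : ℝ :=
  (240 * ((k + 2) * (k + 3)) * (640 * (k + 5) ^ 2) * (k + 3)) ^ (k ^ 2 + 7 * k + 12)

/-- For small `s` the trivial bound 1 suffices. Otherwise the last three inequalities serve the
low-rank case, the typical decoupled outcome and the exceptional one; the latter two are compared
with the square of the target. -/
theorem exists_step_parameters (k : ℕ) {s : ℕ} (hs : 1 ≤ s) :
    1 ≤ stepConst k * (1 / √s) ^ (k + 1) ∨
      ∃ n s' τ t : ℕ, 1 ≤ n ∧ 1 ≤ s' ∧ 1 ≤ τ ∧ 3 * (k + 5) ^ 2 * n < s ∧ 40 * s' ≤ n ∧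
        40 * (t * (τ * (k + 3))) ≤ n ∧ s' ≤ s ∧
        20 ^ (k + 2) * (1 / √n) ^ (k + 1) ≤ stepConst k * (1 / √s) ^ (k + 1) ∧
        (2 / √n) ^ k * (1 / √s') ^ (k + 2) ≤ stepConst k * ((1 / √s) ^ (k + 1)) ^ 2 ∧
        (2 / √n) ^ k * (2 * (2 / √τ) ^ (k + 3) + (2 / 3 : ℝ) ^ t) ≤
          stepConst k * ((1 / √s) ^ (k + 1)) ^ 2 := by
  obtain ⟨Q, hQ⟩ : ∃ Q : ℕ, Q = 640 * (k + 5) ^ 2 := ⟨_, rfl⟩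
  obtain ⟨Y, hY⟩ : ∃ Y : ℝ, Y = 240 * ((k + 2) * (k + 3)) * (640 * (k + 5) ^ 2) * (k + 3) :=
    ⟨_, rfl⟩
  have hYQ : Y = 3 * ((k + 2) * (k + 3)) * (80 * (Q : ℝ) * (k + 3)) := by
    rw [hY, hQ]; push_cast; ring
  have hk : (0 : ℝ) ≤ k := Nat.cast_nonneg k
  have hQ1 : (1 : ℝ) ≤ Q := by
    rw [hQ]; push_cast; nlinarith
  have hQY : 2 * (Q : ℝ) ≤ Y := by
    rw [hYQ]
    have : (1 : ℝ) ≤ ((k + 2) * (k + 3)) * (k + 3) := by nlinarith [mul_nonneg hk hk]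
    nlinarith [mul_le_mul_of_nonneg_left this (by linarith : (0 : ℝ) ≤ 240 * Q)]
  have hQ20 : (20 : ℝ) ≤ Q := by
    rw [hQ]; push_cast; nlinarith
  have hY20 : 20 ≤ Y := by linarith
  have hY1 : 1 ≤ Y := by linarith
  obtain ⟨r, hr⟩ : ∃ r : ℝ, r = 1 / √s := ⟨_, rfl⟩
  rw [← hr]
  have hs' : (0 : ℝ) < s := by exact_mod_cast hs
  have hr0 : 0 < r := by rw [hr]; positivity
  have hconst : stepConst k = Y ^ (k ^ 2 + 7 * k + 12) := by rw [stepConst, hY]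
  rcases Nat.lt_or_ge s (160 * (k + 5) ^ 2) with hlt | hge
  · left
    have h1 : 1 ≤ Q * r := by
      have := inv_sqrt_le_of_le_mul (n := 1) hs hQ1 (by
        have : s ≤ Q * 1 := by omega
        exact_mod_cast this)
      rw [← hr] at this
      simpa using this
    calc (1 : ℝ) ≤ (Q * r) ^ (k + 1) := one_le_pow₀ h1
      _ = (Q : ℝ) ^ (k + 1) * r ^ (k + 1) := mul_pow _ _ _
      _ ≤ _ := by
        gcongr
        rw [hconst]
        calc (Q : ℝ) ^ (k + 1) ≤ Y ^ (k + 1) := by gcongr; linarith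
          _ ≤ _ := pow_le_pow_right₀ hY1 (by omega)
  · right
    obtain ⟨q, hq⟩ : ∃ q, q = 4 * (k + 5) ^ 2 := ⟨_, rfl⟩
    have hq0 : 0 < q := by rw [hq]; positivity
    set n := s / q with hn
    have hn40 : 40 ≤ n := (Nat.le_div_iff_mul_le hq0).2 (by omega)
    set s' := n / 40 with hs'def
    have hnq : n * q ≤ s := Nat.div_mul_le_self s q
    have hsn : s < n * q + q := Nat.lt_div_mul_add hq0
    have hn' : n < 40 * s' + 40 := by omega
    have hs'1 : 1 ≤ s' := by omega
    have hQs' : s ≤ Q * s' := by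
      have h1 : n + 1 ≤ 40 * s' + 40 := by omega
      have h2 : q * (n + 1) ≤ q * (80 * s') := Nat.mul_le_mul_left _ (by omega)
      have h3 : q * 80 ≤ Q := by omega
      calc s ≤ q * (n + 1) := by rw [mul_add, mul_comm q]; omega
        _ ≤ q * (80 * s') := h2
        _ = q * 80 * s' := by ring
        _ ≤ Q * s' := Nat.mul_le_mul_right _ h3
    have hs'n : s' ≤ n := Nat.div_le_self _ _
    have hQn : s ≤ Q * n := hQs'.trans (Nat.mul_le_mul_left _ hs'n)
    obtain ⟨τ, t, hτ, ht, hτs, hts⟩ := exists_parameters (k := k) hs hQn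
    have hns : n ≤ s := Nat.div_le_self _ _
    have hnr : 1 / √n ≤ Q * r := by
      rw [hr]
      exact inv_sqrt_le_of_le_mul hs hQ1 (by exact_mod_cast hQn)
    have hs'r : 1 / √s' ≤ Q * r := by
      rw [hr]
      exact inv_sqrt_le_of_le_mul hs hQ1 (by exact_mod_cast hQs')
    have h2n : (2 / √n) ^ k ≤ Y ^ k * r ^ k := by
      rw [← mul_pow]
      gcongr
      calc 2 / √n = 2 * (1 / √n) := by ring
        _ ≤ 2 * (Q * r) := by gcongr
        _ = (2 * Q) * r := by ring
        _ ≤ _ := by gcongr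
    have hrr : (r ^ (k + 1)) ^ 2 = r ^ k * r ^ (k + 2) := by ring
    refine ⟨n, s', τ, t, by omega, hs'1, hτ, ?_, by omega, ht, hs'n.trans hns, ?_, ?_, ?_⟩
    · have : 3 * (k + 5) ^ 2 * n < q * n := Nat.mul_lt_mul_of_pos_right
        (by rw [hq]; have : 0 < (k + 5) ^ 2 := by positivity
            omega) (by omega)
      exact this.trans_le (by rw [mul_comm]; exact hnq)
    · calc 20 ^ (k + 2) * (1 / √n) ^ (k + 1) ≤ Y ^ (k + 2) * (Y * r) ^ (k + 1) := by
            gcongr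
            exact hnr.trans (by gcongr; linarith)
        _ = Y ^ (2 * k + 3) * r ^ (k + 1) := by ring
        _ ≤ _ := by
          gcongr
          rw [hconst]
          exact pow_le_pow_right₀ hY1 (by omega)
    · calc (2 / √n) ^ k * (1 / √s') ^ (k + 2) ≤ (Y ^ k * r ^ k) * (Y * r) ^ (k + 2) := by
            gcongr
            exact hs'r.trans (by gcongr; linarith)
        _ = Y ^ (2 * k + 2) * (r ^ (k + 1)) ^ 2 := by ring
        _ ≤ _ := by
          gcongr
          rw [hconst]
          exact pow_le_pow_right₀ hY1 (by omega)
    · have hrk : r ^ (k + 2) = 1 / √((s : ℝ) ^ (k + 2)) := by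
        rw [hr, div_pow, one_pow, Real.sqrt_eq_rpow, Real.sqrt_eq_rpow, ← Real.rpow_natCast,
          ← Real.rpow_mul hs'.le, ← Real.rpow_natCast, ← Real.rpow_mul hs'.le, mul_comm]
      have hS1 : (1 : ℝ) ≤ (s : ℝ) ^ (k + 2) := one_le_pow₀ (by exact_mod_cast hs)
      have hS0 : 0 < √((s : ℝ) ^ (k + 2)) := by positivity
      have hτ0 : (0 : ℝ) < τ := by exact_mod_cast hτ
      have h1 : (2 / √τ) ^ (k + 3) ≤ 2 ^ (k + 3) * r ^ (k + 2) := by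
        rw [div_pow, hrk, mul_one_div]
        gcongr
        rw [Real.sqrt_le_left (by positivity), ← pow_mul, mul_comm, pow_mul,
          Real.sq_sqrt hτ0.le]
        exact_mod_cast hτs
      obtain ⟨N, hN⟩ : ∃ N, N = (k + 2) * (k + 3) := ⟨_, rfl⟩
      rw [← hN] at hts
      have hN2 : N = k ^ 2 + 5 * k + 6 := by rw [hN]; ring
      have h2 : (2 / 3 : ℝ) ^ t ≤ 2 * Y ^ N * r ^ (k + 2) := by
        have h3 := two_thirds_pow_mul_le t N (by omega)
        have h4 : √((s : ℝ) ^ (k + 2)) ≤ (80 * Q * (k + 3) * (t + 1)) ^ N := by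
          calc √((s : ℝ) ^ (k + 2)) ≤ (s : ℝ) ^ (k + 2) := by
                rw [Real.sqrt_le_left (by positivity)]
                exact le_self_pow₀ hS1 two_ne_zero
            _ ≤ _ := by exact_mod_cast hts
        rw [hrk, mul_one_div, le_div_iff₀ hS0]
        calc (2 / 3 : ℝ) ^ t * √((s : ℝ) ^ (k + 2))
            ≤ (2 / 3 : ℝ) ^ t * (80 * Q * (k + 3) * (t + 1)) ^ N := by gcongr
          _ = (80 * Q * (k + 3)) ^ N * ((2 / 3 : ℝ) ^ t * ((t : ℝ) + 1) ^ N) := by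
              rw [mul_pow (80 * (Q : ℝ) * (k + 3))]; ring
          _ ≤ (80 * Q * (k + 3)) ^ N * (2 * (3 * N) ^ N) := by gcongr
          _ = 2 * Y ^ N := by
              have : (N : ℝ) = (k + 2) * (k + 3) := by rw [hN]; push_cast; rfl
              rw [hYQ, ← this, mul_pow (3 * (N : ℝ))]
              ring
      calc (2 / √n) ^ k * (2 * (2 / √τ) ^ (k + 3) + (2 / 3 : ℝ) ^ t)
          ≤ (Y ^ k * r ^ k) * (2 * (2 ^ (k + 3) * r ^ (k + 2)) + 2 * Y ^ N * r ^ (k + 2)) := by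
            gcongr
        _ = Y ^ k * (2 * 2 ^ (k + 3) + 2 * Y ^ N) * (r ^ (k + 1)) ^ 2 := by rw [hrr]; ring
        _ ≤ _ := by
          gcongr
          rw [hconst]
          have h5 : (2 : ℝ) ^ (k + 3) ≤ Y ^ N :=
            (pow_le_pow_left₀ (by norm_num) (by linarith : (2 : ℝ) ≤ Y) _).trans
              (pow_le_pow_right₀ hY1 (by omega))
          calc Y ^ k * (2 * 2 ^ (k + 3) + 2 * Y ^ N) ≤ Y ^ k * (4 * Y ^ N) := by
                gcongr; linarith
            _ ≤ Y ^ k * (Y * Y ^ N) := by gcongr; linarith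
            _ = Y ^ (k + 1 + N) := by ring
            _ ≤ _ := pow_le_pow_right₀ hY1 (by omega)

/-- The recursion for the constants has a solution. -/
theorem exists_const_recursion : ∃ K : ℕ → ℝ, (∀ k, 1 ≤ K k) ∧ (∀ k, stepConst k ≤ K k) ∧
    ∀ k, stepConst k * (K (k + 1) + 1) ≤ K k ^ 2 := by
  -- The logarithm of `stepConst k` is bounded by a polynomial in k, hence by a multiple of (3/2)^k.
  -- The base must stay below 2, because every level of the recursion takes a square root.
  have hlim := tendsto_pow_const_div_const_pow_of_one_lt 12 (r := (3 / 2 : ℝ)) (by norm_num)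
  obtain ⟨c, hc⟩ := hlim.bddAbove_range
  have hc' : ∀ k : ℕ, (k : ℝ) ^ 12 ≤ c * (3 / 2) ^ k := by
    intro k
    have := hc ⟨k, rfl⟩
    rwa [div_le_iff₀ (by positivity)] at this
  have hstep : ∃ c' : ℝ, 0 ≤ c' ∧ ∀ k : ℕ, 2 * stepConst k ≤ Real.exp (c' * (3 / 2) ^ k) := by
    refine ⟨10 ^ 9 * c * (3 / 2) ^ 5 , ?_, fun k => ?_⟩
    · have := hc' 0
      norm_num at this
      positivity
    · obtain ⟨Y, hY⟩ : ∃ Y : ℝ, Y = 240 * ((k + 2) * (k + 3)) * (640 * (k + 5) ^ 2) * (k + 3) :=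
        ⟨_, rfl⟩
      obtain ⟨X, hX⟩ : ∃ X : ℝ, X = (k : ℝ) + 5 := ⟨_, rfl⟩
      have hk : (0 : ℝ) ≤ k := Nat.cast_nonneg k
      have hX5 : 5 ≤ X := by linarith
      have hYX : Y ≤ 240 * (X * X) * (640 * X ^ 2) * X := by
        rw [hY, ← hX]
        gcongr <;> linarith
      have hY0 : 0 ≤ Y := by rw [hY]; positivity
      have hconst : stepConst k = Y ^ (k ^ 2 + 7 * k + 12) := by rw [stepConst, hY]
      have h1 : Y ≤ Real.exp Y := by linarith [Real.add_one_le_exp Y]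
      have h2 : stepConst k ≤ Real.exp ((k ^ 2 + 7 * k + 12) * Y) := by
        rw [hconst]
        calc Y ^ (k ^ 2 + 7 * k + 12) ≤ Real.exp Y ^ (k ^ 2 + 7 * k + 12) := by gcongr
          _ = _ := by rw [← Real.exp_nat_mul]; push_cast; rfl
      have h3 : (2 : ℝ) ≤ Real.exp 1 := by linarith [Real.add_one_le_exp (1 : ℝ)]
      have h0 : 0 ≤ stepConst k := by rw [hconst]; positivity
      calc 2 * stepConst k ≤ Real.exp 1 * Real.exp ((k ^ 2 + 7 * k + 12) * Y) := by gcongr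
        _ = Real.exp (1 + (k ^ 2 + 7 * k + 12) * Y) := by rw [Real.exp_add]
        _ ≤ _ := by
          gcongr
          have h4 := hc' (k + 5)
          push_cast at h4
          rw [← hX] at h4
          have h5 : ((k : ℝ) ^ 2 + 7 * k + 12) ≤ X ^ 2 := by rw [hX]; nlinarith
          have h6 : ((k : ℝ) ^ 2 + 7 * k + 12) * Y ≤ X ^ 2 * (240 * (X * X) * (640 * X ^ 2) * X) :=
            mul_le_mul h5 hYX hY0 (by positivity)
          have h7 : X ^ 7 ≤ X ^ 12 := pow_le_pow_right₀ (by linarith) (by norm_num)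
          have h8 : 1 ≤ X ^ 12 := one_le_pow₀ (by linarith)
          calc 1 + (k ^ 2 + 7 * k + 12) * Y ≤ X ^ 12 + 153600 * X ^ 12 := by nlinarith
            _ ≤ 10 ^ 9 * X ^ 12 := by linarith
            _ ≤ 10 ^ 9 * (c * (3 / 2) ^ (k + 5)) := by gcongr
            _ = _ := by ring
  obtain ⟨c', hc'0, hstep⟩ := hstep
  have hpos : ∀ k, 0 ≤ stepConst k := fun k => by unfold stepConst; positivity
  -- In exponents the recursion becomes 1 + 2 · (3/2) = 2 · 2.
  refine ⟨fun k => Real.exp (2 * c' * (3 / 2) ^ k), fun k => ?_, fun k => ?_, fun k => ?_⟩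
  · exact Real.one_le_exp (by positivity)
  · have h1 := hstep k
    have h2 : Real.exp (c' * (3 / 2) ^ k) ≤ Real.exp (2 * c' * (3 / 2) ^ k) := by
      gcongr
      linarith
    linarith [hpos k]
  · have h1 : (1 : ℝ) ≤ Real.exp (2 * c' * (3 / 2) ^ (k + 1)) := Real.one_le_exp (by positivity)
    calc stepConst k * (Real.exp (2 * c' * (3 / 2) ^ (k + 1)) + 1)
        ≤ 2 * stepConst k * Real.exp (2 * c' * (3 / 2) ^ (k + 1)) := by
          nlinarith [hpos k]
      _ ≤ Real.exp (c' * (3 / 2) ^ k) * Real.exp (2 * c' * (3 / 2) ^ (k + 1)) := by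
          gcongr; exact hstep k
      _ = _ := by
          rw [← Real.exp_add, ← Real.exp_nat_mul]
          congr 1
          push_cast
          ring

end Numerics

end QuadLO

namespace QuadLO

/-! ### The recursion, and the theorem for random signs. -/

section Core

variable {ι : Type*} [Fintype ι] [DecidableEq ι]

theorem two_pow_le_stepConst (k : ℕ) : (2 : ℝ) ^ k ≤ stepConst k := by
  have hk : (0 : ℝ) ≤ k := Nat.cast_nonneg k
  have h1 : (2 : ℝ) ≤ 240 * ((k + 2) * (k + 3)) * (640 * (k + 5) ^ 2) * (k + 3) := by
    have h2 : (1 : ℝ) ≤ (k + 2) * (k + 3) := by nlinarith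
    have h3 : (1 : ℝ) ≤ (k + 5) ^ 2 := by nlinarith
    calc (2 : ℝ) ≤ 240 * 1 * (640 * 1) * (0 + 3) := by norm_num
      _ ≤ _ := by gcongr
  calc (2 : ℝ) ^ k ≤ _ := pow_le_pow_left₀ (by norm_num) h1 _
    _ ≤ _ := pow_le_pow_right₀ (by linarith) (by omega)

/-- The bound at each level of the induction: the exponent of `s` improves towards the optimal one
as `j` grows. -/
theorem pr_quad_le_of_recursion {K : ℕ → ℝ} (hK1 : ∀ k, 1 ≤ K k) (hK2 : ∀ k, stepConst k ≤ K k)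
    (hK3 : ∀ k, stepConst k * (K (k + 1) + 1) ≤ K k ^ 2) (j : ℕ) :
    ∀ {V : Type*} [AddCommGroup V] [Module ℝ V] [FiniteDimensional ℝ V]
      {B : (ι → ℝ) →ₗ[ℝ] (ι → ℝ) →ₗ[ℝ] ℝ} (_ : ∀ x y, B x y = B y x)
      (b : (ι → ℝ) →ₗ[ℝ] ℝ) (c : ℝ) (L : (ι → ℝ) →ₗ[ℝ] V) (v : V) {s : ℕ} (_ : 1 ≤ s)
      {T C : Fin s → Finset ι}, (Pairwise fun a b => Disjoint (T a ∪ C a) (T b ∪ C b)) →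
      (∀ a, Disjoint (T a) (C a)) → (∀ a, IsGood B L 1 (T a) (C a)) →
      ∀ x : ℝ, 1 ≤ x → (s : ℝ) ≤ x ^ 2 ^ (j + 1) →
      pr (fun ξ => L ξ = v ∧ quad B b c ξ = 0) ≤
        K (Module.finrank ℝ V) * (1 / √s) ^ (Module.finrank ℝ V + 1) * x := by
  induction j with
  | zero =>
    intro V _ _ _ B hB b c L v s hs T C hTC hd hg x hx hsx
    set k := Module.finrank ℝ V with hk
    have hs' : (0 : ℝ) < s := by exact_mod_cast hs
    have hsq : 0 < √(s : ℝ) := Real.sqrt_pos.2 hs'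
    have h1 : √(s : ℝ) ≤ x := by
      rw [Real.sqrt_le_left (by linarith)]
      simpa using hsx
    have hT : Pairwise fun a b => Disjoint (T a) (T b) := fun a b hab =>
      (hTC hab).mono Finset.subset_union_left Finset.subset_union_left
    have h2 : √(2 / (s : ℝ)) ≤ 2 * (1 / √s) := by
      rw [Real.sqrt_div (by norm_num), mul_one_div]
      gcongr
      rw [Real.sqrt_le_left (by norm_num)]
      norm_num
    -- At the lowest level the quadratic equation is ignored; the missing factor √s is absorbed by
    -- `x`.
    calc pr (fun ξ => L ξ = v ∧ quad B b c ξ = 0) ≤ pr (fun ξ => L ξ = v) :=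
          pr_mono fun ξ _ h => h.1
      _ ≤ √(2 / s) ^ k := pr_linear_le L hs hT (fun a => (hg a).1) v
      _ ≤ (2 * (1 / √s)) ^ k := by gcongr
      _ = 2 ^ k * (1 / √s) ^ (k + 1) * √s := by
          rw [mul_pow, pow_succ (1 / √(s : ℝ))]
          field_simp
      _ ≤ _ := mul_le_mul (mul_le_mul_of_nonneg_right
          ((two_pow_le_stepConst k).trans (hK2 k)) (by positivity)) h1 hsq.le
          (mul_nonneg (by linarith [hK1 k]) (by positivity))
  | succ j ih =>
    intro V _ _ _ B hB b c L v s hs T C hTC hd hg x hx hsx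
    set k := Module.finrank ℝ V with hk
    have hK0 : ∀ k, 0 < K k := fun k => zero_lt_one.trans_le (hK1 k)
    have hA0 : 0 ≤ stepConst k := (by positivity : (0 : ℝ) ≤ 2 ^ k).trans (two_pow_le_stepConst k)
    set r : ℝ := (1 / √s) ^ (k + 1) with hr
    have hr0 : 0 ≤ r := by positivity
    have hstep : stepConst k * r ≤ K k * r * x := by
      calc stepConst k * r ≤ K k * r * 1 := by
            rw [mul_one]; gcongr; exact hK2 k
        _ ≤ _ := by have := hK0 k; gcongr
    rcases exists_step_parameters k hs with h | ⟨n, s', τ, t, hn, hs'1, hτ, hns, hs'n, ht, hs's,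
      h1, h2, h3⟩
    · exact (pr_le_one _).trans (h.trans hstep)
    rcases pr_quad_le_or_highRank hB b c L v hn hns hTC hd hg with h | ⟨T', C', hTC', hd', hg'⟩
    · exact h.trans (h1.trans hstep)
    have hx2 : 1 ≤ x ^ 2 := one_le_pow₀ hx
    have hM : 0 ≤ K (k + 1) * (1 / √s') ^ (k + 2) * x ^ 2 := by
      have := hK0 (k + 1); positivity
    have hmain := pr_quad_sq_le_of_highRank hB b c L v (N := 2 * n) (s' := s') le_rfl hTC' hd' hg'
      hn hs'n hτ ht hM (by
        intro B' hB' b' c' L' v' T₁ C₁ h4 h5 h6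
        have hfr : Module.finrank ℝ (V × ℝ) = k + 1 := by
          rw [Module.finrank_prod, Module.finrank_self]
        -- The loss may be `x ^ 2` here, since the square root brings it back to `x`.
        have := ih hB' b' c' L' v' hs'1 h4 h5 h6 (x ^ 2) hx2 (by
          rw [← pow_mul, ← pow_succ']
          exact le_trans (by exact_mod_cast hs's) hsx)
        rw [hfr] at this
        exact this)
    refine abs_le_of_sq_le_sq' ?_ (by have := hK0 k; positivity) |>.2
    calc _ ≤ _ := hmain
      _ = K (k + 1) * x ^ 2 * ((2 / √n) ^ k * (1 / √s') ^ (k + 2)) +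
          (2 / √n) ^ k * (2 * (2 / √τ) ^ (k + 3) + (2 / 3 : ℝ) ^ t) := by ring
      _ ≤ K (k + 1) * x ^ 2 * (stepConst k * r ^ 2) + stepConst k * r ^ 2 * x ^ 2 := by
          have := hK0 (k + 1)
          exact add_le_add (mul_le_mul_of_nonneg_left h2 (by positivity))
            (h3.trans (le_mul_of_one_le_right (by positivity) hx2))
      _ = (stepConst k * (K (k + 1) + 1)) * (r ^ 2 * x ^ 2) := by ring
      _ ≤ K k ^ 2 * (r ^ 2 * x ^ 2) := by gcongr; exact hK3 k
      _ = _ := by ring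

/-- A quadratic polynomial in independent signs whose mixed coefficients do not vanish on `m`
disjoint pairs of coordinates takes any value with probability `O(1 / √m)`. -/
theorem exists_pr_quad_le_of_matching : ∃ K : ℝ, 1 ≤ K ∧
    ∀ {ι : Type*} [Fintype ι] [DecidableEq ι] {B : (ι → ℝ) →ₗ[ℝ] (ι → ℝ) →ₗ[ℝ] ℝ},
      (∀ x y, B x y = B y x) → ∀ (b : (ι → ℝ) →ₗ[ℝ] ℝ) (c : ℝ) {m : ℕ} (_ : 1 ≤ m)
      {i j : Fin m → ι}, (∀ a, i a ≠ j a) →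
      (Pairwise fun a b => Disjoint ({i a, j a} : Finset ι) {i b, j b}) →
      (∀ a, B (Pi.single (i a) 1) (Pi.single (j a) 1) ≠ 0) →
      pr (fun x => quad B b c x = 0) ≤ K / √m := by
  obtain ⟨K, hK1, hK2, hK3⟩ := exists_const_recursion
  refine ⟨2 * K 0, by linarith [hK1 0], ?_⟩
  intro ι _ _ B hB b c m hm i j hij hd hne
  -- Enough levels for the loss `x = 2` to be admissible; this is the factor 2 in the constant. The
  -- recursion starts with no linear constraints.
  have hbig : ∃ l : ℕ, (m : ℝ) ≤ 2 ^ 2 ^ (l + 1) := by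
    refine ⟨m, ?_⟩
    have h1 : m < 2 ^ m := Nat.lt_two_pow_self
    have h2 : m + 1 < 2 ^ (m + 1) := Nat.lt_two_pow_self
    have h3 : 2 ^ m ≤ 2 ^ 2 ^ (m + 1) := Nat.pow_le_pow_right (by norm_num) (by omega)
    exact_mod_cast h1.le.trans h3
  obtain ⟨l, hl⟩ := hbig
  have hV : Module.finrank ℝ (Fin 0 → ℝ) = 0 := by simp
  have honto : ∀ T : Finset ι, Onto (0 : (ι → ℝ) →ₗ[ℝ] (Fin 0 → ℝ)) T := fun T w =>
    ⟨0, Submodule.zero_mem _, Subsingleton.elim _ _⟩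
  have h := pr_quad_le_of_recursion hK1 hK2 hK3 l hB b c (0 : (ι → ℝ) →ₗ[ℝ] (Fin 0 → ℝ)) 0 hm
    (T := fun a => {i a}) (C := fun a => {j a}) (fun a b hab => hd hab)
    (fun a => by simpa using hij a) (fun a => ⟨honto _, honto _, fun _ => Pi.single (i a) 1,
      fun _ => (B (Pi.single (i a) 1) (Pi.single (j a) 1))⁻¹ • Pi.single (j a) 1,
      fun _ => ⟨single_mem_supp (by simp) _, rfl⟩,
      fun _ => ⟨Submodule.smul_mem _ _ (single_mem_supp (by simp) _), rfl⟩,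
      fun p q => by
        rw [if_pos (Subsingleton.elim p q), map_smul, smul_eq_mul, inv_mul_cancel₀ (hne a)]⟩)
    2 (by norm_num) hl
  rw [hV] at h
  calc pr (fun x => quad B b c x = 0) ≤ _ := pr_mono fun x _ hx => ⟨Subsingleton.elim _ _, hx⟩
    _ ≤ _ := h
    _ = _ := by ring

end Core

end QuadLO

namespace QuadLO

/-! ### Product measures and concentration of the number of surviving events. -/

section Product

variable {ι : Type*} [Fintype ι] [DecidableEq ι] {α : Type*} [MeasurableSpace α]

omit [Fintype ι] in
theorem measurable_piecewise (S : Finset ι) :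
    Measurable fun p : (ι → α) × (ι → α) => S.piecewise p.1 p.2 := by
  refine measurable_pi_lambda _ fun i => ?_
  by_cases hi : i ∈ S
  · simp only [Finset.piecewise, hi, if_true]
    fun_prop
  · simp only [Finset.piecewise, hi, if_false]
    fun_prop

omit [Fintype ι] in
theorem measurable_piecewise_right (S : Finset ι) (x : ι → α) :
    Measurable fun y : ι → α => S.piecewise x y :=
  (measurable_piecewise S).comp measurable_prodMk_left

/-- Taking the coordinates in `S` from one point and the remaining ones from an independent point
preserves a product measure. -/
theorem map_piecewise_prod (ν : ι → Measure α) [∀ i, IsProbabilityMeasure (ν i)] (S : Finset ι) :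
    ((Measure.pi ν).prod (Measure.pi ν)).map (fun p => S.piecewise p.1 p.2) = Measure.pi ν := by
  refine (Measure.pi_eq fun s hs => ?_).symm
  rw [Measure.map_apply (measurable_piecewise S) (MeasurableSet.univ_pi hs)]
  have : (fun p : (ι → α) × (ι → α) => S.piecewise p.1 p.2) ⁻¹' Set.univ.pi s =
      (Set.univ.pi fun i => if i ∈ S then s i else Set.univ) ×ˢ
        (Set.univ.pi fun i => if i ∈ S then Set.univ else s i) := by
    ext p
    simp only [Set.mem_preimage, Set.mem_prod, Set.mem_pi, Set.mem_univ, true_implies,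
      ← forall_and]
    refine forall_congr' fun i => ?_
    by_cases hi : i ∈ S <;> simp [hi]
  rw [this, Measure.prod_prod, Measure.pi_pi, Measure.pi_pi, ← Finset.prod_mul_distrib]
  refine Finset.prod_congr rfl fun i _ => ?_
  by_cases hi : i ∈ S <;> simp [hi]

theorem lintegral_pi_eq_piecewise (ν : ι → Measure α) [∀ i, IsProbabilityMeasure (ν i)]
    (S : Finset ι) {f : (ι → α) → ENNReal} (hf : Measurable f) :
    ∫⁻ x, f x ∂Measure.pi ν =
      ∫⁻ x, ∫⁻ y, f (S.piecewise x y) ∂Measure.pi ν ∂Measure.pi ν := by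
  conv_lhs => rw [← map_piecewise_prod ν S]
  rw [lintegral_map hf (measurable_piecewise S), lintegral_prod]
  exact (hf.comp (measurable_piecewise S)).aemeasurable

theorem measure_pi_eq_piecewise (ν : ι → Measure α) [∀ i, IsProbabilityMeasure (ν i)]
    (S : Finset ι) {A : Set (ι → α)} (hA : MeasurableSet A) :
    Measure.pi ν A = ∫⁻ x, Measure.pi ν {y | S.piecewise x y ∈ A} ∂Measure.pi ν := by
  conv_lhs => rw [← map_piecewise_prod ν S]
  rw [Measure.map_apply (measurable_piecewise S) hA,
    Measure.prod_apply (measurable_piecewise S hA)]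
  rfl

theorem indepFun_indicator {Ω : Type*} [MeasurableSpace Ω] {P : Measure Ω} {s t : Set Ω}
    (h : IndepSet s t P) :
    IndepFun (s.indicator fun _ => (1 : ℝ)) (t.indicator fun _ => (1 : ℝ)) P := by
  have hle : ∀ u : Set Ω, MeasurableSpace.comap (u.indicator fun _ => (1 : ℝ)) inferInstance ≤
      MeasurableSpace.generateFrom {u} := fun u =>
    Measurable.comap_le (Measurable.indicator (m := MeasurableSpace.generateFrom {u})
      measurable_const (MeasurableSpace.measurableSet_generateFrom rfl))
  exact indep_of_indep_of_le_left (indep_of_indep_of_le_right h (hle t)) (hle s)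

/-- Chebyshev's inequality for the number of independent events that occur. -/
theorem measure_card_lt_le {Ω : Type*} [MeasurableSpace Ω] (P : Measure Ω)
    [IsProbabilityMeasure P] {M : ℕ} (hM : 1 ≤ M) {E : Fin M → Set Ω}
    (hE : ∀ e, MeasurableSet (E e)) (hind : Pairwise fun e f => IndepSet (E e) (E f) P)
    {p : ℝ} (hp : 0 < p) (hpE : ∀ e, p ≤ P.real (E e)) :
    P {ω | ∀ F : Finset (Fin M), (∀ e ∈ F, ω ∈ E e) → (F.card : ℝ) < p * M / 2} ≤
      ENNReal.ofReal (1 / (p ^ 2 * M)) := by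
  classical
  set X : Fin M → Ω → ℝ := fun e => (E e).indicator fun _ => 1 with hX
  have hXm : ∀ e, Measurable (X e) := fun e => measurable_const.indicator (hE e)
  have hX01 : ∀ e ω, X e ω ∈ Set.Icc (0 : ℝ) 1 := by
    intro e ω
    by_cases h : ω ∈ E e <;> simp [hX, h]
  have hmem : ∀ e, MemLp (X e) 2 P := fun e =>
    memLp_of_bounded (Filter.Eventually.of_forall (hX01 e)) (hXm e).aestronglyMeasurable 2
  have hM0 : (0 : ℝ) < M := by exact_mod_cast hM
  have hvar : Var[∑ e, X e; P] ≤ M * (1 / 4) := by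
    rw [IndepFun.variance_sum (fun e _ => hmem e)
      (fun e _ f _ hef => indepFun_indicator (hind hef))]
    calc ∑ e, Var[X e; P] ≤ ∑ _e : Fin M, (1 / 4 : ℝ) := by
          refine Finset.sum_le_sum fun e _ => ?_
          have := variance_le_sq_of_bounded (μ := P)
            (Filter.Eventually.of_forall (hX01 e)) (hXm e).aemeasurable
          norm_num at this ⊢
          exact this
      _ = _ := by simp
  have hint : ∫ ω, (∑ e, X e) ω ∂P = ∑ e, P.real (E e) := by
    simp only [Finset.sum_apply]
    rw [integral_finsetSum _ fun e _ => (hmem e).integrable (by norm_num)]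
    refine Finset.sum_congr rfl fun e _ => ?_
    rw [hX]
    exact integral_indicator_one (hE e)
  have hge : p * M ≤ ∑ e, P.real (E e) := by
    calc p * M = ∑ _e : Fin M, p := by simp [mul_comm]
      _ ≤ _ := Finset.sum_le_sum fun e _ => hpE e
  have hcard : ∀ ω, (∑ e, X e) ω = ((Finset.univ.filter fun e => ω ∈ E e).card : ℝ) := by
    intro ω
    rw [Finset.sum_apply, Finset.card_filter]
    push_cast
    refine Finset.sum_congr rfl fun e _ => ?_
    by_cases h : ω ∈ E e <;> simp [hX, h]
  -- Falling below p M/2 is a deviation of at least half the lower bound `p * M` for the mean, while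
  -- the variance is at most M/4.
  have hc : 0 < p * M / 2 := by positivity
  calc P {ω | ∀ F : Finset (Fin M), (∀ e ∈ F, ω ∈ E e) → (F.card : ℝ) < p * M / 2}
      ≤ P {ω | p * M / 2 ≤ |(∑ e, X e) ω - ∫ x, (∑ e, X e) x ∂P|} := by
        refine measure_mono fun ω hω => ?_
        have hω := hω (Finset.univ.filter fun e => ω ∈ E e) fun e he => (Finset.mem_filter.1 he).2
        rw [Set.mem_ofPred_eq]
        rw [← hcard] at hω
        rw [hint, abs_sub_comm]
        exact le_trans (by linarith) (le_abs_self _)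
    _ ≤ _ := meas_ge_le_variance_div_sq (memLp_finsetSum' _ fun e _ => hmem e) hc
    _ ≤ _ := by
      refine ENNReal.ofReal_le_ofReal ?_
      calc Var[∑ e, X e; P] / (p * M / 2) ^ 2 ≤ M * (1 / 4) / (p * M / 2) ^ 2 := by gcongr
        _ = _ := by field_simp; norm_num

/-- The number of occurring events, among events depending on disjoint sets of at most `N`
coordinates. -/
theorem measure_pi_card_lt_le (ν : ι → Measure α) [∀ i, IsProbabilityMeasure (ν i)] {M : ℕ}
    (hM : 1 ≤ M) {S : Fin M → Finset ι} (hS : Pairwise fun e f => Disjoint (S e) (S f)) {N : ℕ}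
    (hN : ∀ e, (S e).card ≤ N) {A : ι → Set α} (hA : ∀ i, MeasurableSet (A i)) {p : ℝ}
    (hp : 0 < p) (hp1 : p ≤ 1) (hpA : ∀ e, ∀ i ∈ S e, p ≤ (ν i).real (A i)) :
    Measure.pi ν {x | ∀ E : Finset (Fin M), (∀ e ∈ E, ∀ i ∈ S e, x i ∈ A i) →
      (E.card : ℝ) < p ^ N * M / 2} ≤ ENNReal.ofReal (1 / ((p ^ N) ^ 2 * M)) := by
  have hbox : ∀ T : Finset ι, {x : ι → α | ∀ i ∈ T, x i ∈ A i} =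
      Set.univ.pi fun i => if i ∈ T then A i else Set.univ := by
    intro T
    ext x
    simp only [Set.mem_ofPred_eq, Set.mem_pi, Set.mem_univ, true_implies]
    refine forall_congr' fun i => ?_
    by_cases hi : i ∈ T <;> simp [hi]
  have hmeas : ∀ T : Finset ι, MeasurableSet {x : ι → α | ∀ i ∈ T, x i ∈ A i} := by
    intro T
    rw [hbox]
    refine MeasurableSet.univ_pi fun i => ?_
    by_cases hi : i ∈ T <;> simp [hi, hA]
  have hprob : ∀ T : Finset ι, Measure.pi ν {x : ι → α | ∀ i ∈ T, x i ∈ A i} =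
      ∏ i ∈ T, ν i (A i) := by
    intro T
    rw [hbox, Measure.pi_pi, ← Finset.prod_subset (Finset.subset_univ T)]
    · exact Finset.prod_congr rfl fun i hi => by rw [if_pos hi]
    · intro i _ hi
      rw [if_neg hi, measure_univ]
  have hind : Pairwise fun e f => IndepSet {x : ι → α | ∀ i ∈ S e, x i ∈ A i}
      {x | ∀ i ∈ S f, x i ∈ A i} (Measure.pi ν) := by
    intro e f hef
    rw [indepSet_iff_measure_inter_eq_mul (hmeas _) (hmeas _) (Measure.pi ν), hprob, hprob,
      ← Finset.prod_union (hS hef), ← hprob]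
    congr 1
    ext x
    simp only [Set.mem_inter_iff, Set.mem_ofPred_eq, Finset.mem_union, or_imp, forall_and]
  have hpE : ∀ e, p ^ N ≤ (Measure.pi ν).real {x : ι → α | ∀ i ∈ S e, x i ∈ A i} := by
    intro e
    rw [measureReal_def, hprob, ENNReal.toReal_prod]
    calc p ^ N ≤ p ^ (S e).card := pow_le_pow_of_le_one hp.le hp1 (hN e)
      _ = ∏ _i ∈ S e, p := by simp
      _ ≤ _ := Finset.prod_le_prod (fun _ _ => hp.le) fun i hi => hpA e i hi
  refine (measure_mono fun x hx => ?_).trans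
    (measure_card_lt_le (Measure.pi ν) hM (fun e => hmeas (S e)) hind (pow_pos hp N) hpE)
  exact hx

end Product

/-! ### Symmetrization: selecting from random pairs by random signs. -/

section Symmetrization

variable {ι : Type*} [Fintype ι] [DecidableEq ι]

open Classical in
theorem ofReal_pr (E : (ι → ℝ) → Prop) : ENNReal.ofReal (pr E) =
    ∑ c ∈ cube ι, (2 ^ Fintype.card ι : ENNReal)⁻¹ * (if E c then 1 else 0) := by
  rw [pr, ex, ENNReal.ofReal_div_of_pos (by positivity), div_eq_mul_inv, mul_comm,
    ENNReal.ofReal_sum_of_nonneg fun c _ => by split_ifs <;> norm_num, Finset.mul_sum]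
  have h2 : ENNReal.ofReal (2 ^ Fintype.card ι) = 2 ^ Fintype.card ι := by
    rw [ENNReal.ofReal_pow (by norm_num), ENNReal.ofReal_ofNat]
  rw [h2]
  refine Finset.sum_congr rfl fun c _ => ?_
  split_ifs <;> simp

theorem sum_cube_inv : ∑ _c ∈ cube ι, (2 ^ Fintype.card ι : ENNReal)⁻¹ = 1 := by
  rw [Finset.sum_const, card_cube, nsmul_eq_mul]
  push_cast
  exact ENNReal.mul_inv_cancel (by simp) (by simp)

theorem measurable_ofReal_pr {Ω : Type*} [MeasurableSpace Ω] {E : (ι → ℝ) → Ω → Prop}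
    (hE : ∀ c, MeasurableSet {ω | E c ω}) :
    Measurable fun ω => ENNReal.ofReal (pr fun c => E c ω) := by
  classical
  simp_rw [ofReal_pr]
  exact Finset.measurable_sum _ fun c _ =>
    measurable_const.mul (Measurable.ite (hE c) measurable_const measurable_const)

theorem lintegral_ofReal_pr {Ω : Type*} [MeasurableSpace Ω] (P : Measure Ω)
    {E : (ι → ℝ) → Ω → Prop} (hE : ∀ c, MeasurableSet {ω | E c ω}) :
    ∫⁻ ω, ENNReal.ofReal (pr fun c => E c ω) ∂P =
      ∑ c ∈ cube ι, (2 ^ Fintype.card ι : ENNReal)⁻¹ * P {ω | E c ω} := by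
  classical
  simp_rw [ofReal_pr]
  have hm : ∀ c, Measurable fun ω => if E c ω then (1 : ENNReal) else 0 := fun c =>
    Measurable.ite (hE c) measurable_const measurable_const
  rw [lintegral_finsetSum _ fun c _ => (hm c).const_mul _]
  refine Finset.sum_congr rfl fun c _ => ?_
  rw [lintegral_const_mul _ (hm c)]
  congr 1
  rw [← lintegral_indicator_one (hE c)]
  rfl

theorem lintegral_ofReal_le {Ω : Type*} [MeasurableSpace Ω] (P : Measure Ω)
    [IsProbabilityMeasure P] {f : Ω → ℝ} (hf : ∀ ω, f ω ≤ 1) {C : ℝ} {s : Set Ω}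
    (hs : ∀ ω, ω ∉ s → f ω ≤ C) :
    ∫⁻ ω, ENNReal.ofReal (f ω) ∂P ≤ ENNReal.ofReal C + P s := by
  calc ∫⁻ ω, ENNReal.ofReal (f ω) ∂P
      ≤ ∫⁻ ω, (ENNReal.ofReal C + s.indicator (fun _ => 1) ω) ∂P := by
        refine lintegral_mono fun ω => ?_
        by_cases h : ω ∈ s
        · simp only [h, Set.indicator_of_mem]
          exact (ENNReal.ofReal_le_one.2 (hf ω)).trans le_add_self
        · simp only [h, not_false_eq_true, Set.indicator_of_notMem, add_zero]
          exact ENNReal.ofReal_le_ofReal (hs ω h)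
    _ = ENNReal.ofReal C + ∫⁻ ω, s.indicator (fun _ => 1) ω ∂P := by
        rw [lintegral_add_left measurable_const, lintegral_const, measure_univ, mul_one]
    _ ≤ _ := by
        gcongr
        simpa using lintegral_indicator_const_le (μ := P) s 1

open Classical in
/-- Select from a pair in each coordinate according to a sign. -/
noncomputable def select (c : ι → ℝ) (ω : ι → ℝ × ℝ) (i : ι) : ℝ :=
  if c i = 1 then (ω i).1 else (ω i).2

omit [Fintype ι] [DecidableEq ι] in
theorem measurable_select (c : ι → ℝ) : Measurable (select c) := by
  refine measurable_pi_lambda _ fun i => ?_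
  by_cases h : c i = 1
  · simp only [select, h, if_true]; fun_prop
  · simp only [select, h, if_false]; fun_prop

theorem select_eq {c : ι → ℝ} (hc : c ∈ cube ι) (ω : ι → ℝ × ℝ) (i : ι) :
    select c ω i = ((ω i).1 + (ω i).2) / 2 + ((ω i).1 - (ω i).2) / 2 * c i := by
  rcases mem_cube.1 hc i with h | h
  · rw [select, if_pos h, h]; ring
  · rw [select, if_neg (by rw [h]; norm_num), h]; ring

omit [Fintype ι] in
theorem select_piecewise (c : ι → ℝ) (S : Finset ι) (ω ω' : ι → ℝ × ℝ) :
    select c (S.piecewise ω ω') = S.piecewise (select c ω) (select c ω') := by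
  ext i
  by_cases hi : i ∈ S <;> simp [select, hi]

omit [DecidableEq ι] in
theorem map_select {μ : ι → Measure ℝ} [∀ i, IsProbabilityMeasure (μ i)]
    {ν : ι → Measure (ℝ × ℝ)} [∀ i, IsProbabilityMeasure (ν i)]
    (h1 : ∀ i, (ν i).map Prod.fst = μ i) (h2 : ∀ i, (ν i).map Prod.snd = μ i) (c : ι → ℝ) :
    (Measure.pi ν).map (select c) = Measure.pi μ := by
  classical
  set f : ι → ℝ × ℝ → ℝ := fun i => if c i = 1 then Prod.fst else Prod.snd with hf
  have hfm : ∀ i, Measurable (f i) := by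
    intro i
    by_cases h : c i = 1
    · simp only [hf, h, if_true]; fun_prop
    · simp only [hf, h, if_false]; fun_prop
  have hmap : ∀ i, (ν i).map (f i) = μ i := by
    intro i
    by_cases h : c i = 1
    · simp only [hf, h, if_true, h1]
    · simp only [hf, h, if_false, h2]
  have hsel : select c = fun ω i => f i (ω i) := by
    ext ω i
    by_cases h : c i = 1 <;> simp [select, hf, h]
  have : ∀ i, SigmaFinite ((ν i).map (f i)) := fun i => by rw [hmap]; infer_instance
  rw [hsel, Measure.pi_map_pi fun i => (hfm i).aemeasurable]
  simp_rw [hmap]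

/-- For each fixed sign vector the selected point has law `Measure.pi μ`, as both marginals of every
pair agree; averaging over signs changes nothing. -/
theorem measure_pi_eq_lintegral_select {μ : ι → Measure ℝ} [∀ i, IsProbabilityMeasure (μ i)]
    {ν : ι → Measure (ℝ × ℝ)} [∀ i, IsProbabilityMeasure (ν i)]
    (h1 : ∀ i, (ν i).map Prod.fst = μ i) (h2 : ∀ i, (ν i).map Prod.snd = μ i)
    {A : Set (ι → ℝ)} (hA : MeasurableSet A) :
    Measure.pi μ A = ∫⁻ ω, ENNReal.ofReal (pr fun c => select c ω ∈ A) ∂Measure.pi ν := by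
  rw [lintegral_ofReal_pr _ fun c => measurable_select c hA]
  have : ∀ c, Measure.pi ν {ω | select c ω ∈ A} = Measure.pi μ A := by
    intro c
    rw [← map_select h1 h2 c, Measure.map_apply (measurable_select c) hA]
    rfl
  simp_rw [this]
  rw [← Finset.sum_mul, sum_cube_inv, one_mul]

/-- The product coupling: two independent samples differ with probability at least `δ` as soon as
no value is taken with probability more than `1 - δ`. -/
theorem le_measureReal_prod_ne (μ : Measure ℝ) [IsProbabilityMeasure μ] {f : ℝ → ℝ}
    (hf : Measurable f) {δ : ℝ} (hμ : ∀ v, μ.real {x | f x = v} ≤ 1 - δ) :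
    δ ≤ (μ.prod μ).real {p | f p.1 ≠ f p.2} := by
  have hm : MeasurableSet {p : ℝ × ℝ | f p.1 = f p.2} :=
    measurableSet_eq_fun (hf.comp measurable_fst) (hf.comp measurable_snd)
  have hle : (μ.prod μ) {p | f p.1 = f p.2} ≤ ENNReal.ofReal (1 - δ) := by
    rw [Measure.prod_apply hm]
    calc ∫⁻ x, μ (Prod.mk x ⁻¹' {p | f p.1 = f p.2}) ∂μ ≤ ∫⁻ _x, ENNReal.ofReal (1 - δ) ∂μ := by
          refine lintegral_mono fun x => ?_
          have : Prod.mk x ⁻¹' {p : ℝ × ℝ | f p.1 = f p.2} = {y | f y = f x} := by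
            ext y; exact eq_comm
          rw [this, ← ofReal_measureReal]
          exact ENNReal.ofReal_le_ofReal (hμ _)
      _ = _ := by simp
  have h0 : 0 ≤ 1 - δ := measureReal_nonneg.trans (hμ 0)
  have hle' : (μ.prod μ).real {p | f p.1 = f p.2} ≤ 1 - δ := ENNReal.toReal_le_of_le_ofReal h0 hle
  have : {p : ℝ × ℝ | f p.1 ≠ f p.2} = {p | f p.1 = f p.2}ᶜ := rfl
  rw [this, measureReal_compl hm, probReal_univ]
  linarith

/-- A distribution with an atom of mass at least one half is the marginal of a symmetric pair of
which one member always is that atom. -/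
theorem exists_coupling_of_atom (μ : Measure ℝ) [IsProbabilityMeasure μ] {a : ℝ}
    (ha : 1 / 2 ≤ μ.real {a}) : ∃ ν : Measure (ℝ × ℝ), IsProbabilityMeasure ν ∧
      ν.map Prod.fst = μ ∧ ν.map Prod.snd = μ ∧ ∀ᵐ p ∂ν, p.1 = a ∨ p.2 = a := by
  set q := μ {a}ᶜ with hq
  set μ' := μ.restrict {a}ᶜ with hμ'
  have hle : q ≤ μ {a} := by
    have h1 : μ.real {a}ᶜ ≤ μ.real {a} := by
      rw [measureReal_compl (measurableSet_singleton a), probReal_univ]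
      linarith
    exact (ENNReal.toReal_le_toReal (measure_ne_top _ _) (measure_ne_top _ _)).1 h1
  have hμ : μ {a} • Measure.dirac a + μ' = μ := by
    rw [← Measure.restrict_singleton, hμ']
    exact Measure.restrict_add_restrict_compl (measurableSet_singleton a)
  have huniv : μ' Set.univ = q := by rw [hμ', Measure.restrict_apply_univ]
  have hm1 : Measurable fun x : ℝ => (a, x) := by fun_prop
  have hm2 : Measurable fun x : ℝ => (x, a) := by fun_prop
  -- The mass off the atom is placed once on each side, opposite `a`. This uses mass `q` of the atom
  -- per side, and the rest stays at (a, a); it is nonnegative because the atom weighs at least 1/2.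
  set ν : Measure (ℝ × ℝ) := (μ {a} - q) • Measure.dirac (a, a) +
    (μ'.map (fun x => (a, x)) + μ'.map (fun x => (x, a))) with hν
  have hfst : ν.map Prod.fst = μ := by
    rw [hν, Measure.map_add _ _ measurable_fst, Measure.map_add _ _ measurable_fst,
      Measure.map_smul, Measure.map_dirac' measurable_fst, Measure.map_map measurable_fst hm1,
      Measure.map_map measurable_fst hm2]
    have h1 : (Prod.fst ∘ fun x : ℝ => (a, x)) = fun _ => a := rfl
    have h2 : (Prod.fst ∘ fun x : ℝ => (x, a)) = id := rfl
    rw [h1, h2, Measure.map_id, Measure.map_const, huniv, ← add_assoc, ← add_smul,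
      tsub_add_cancel_of_le hle, hμ]
  have hsnd : ν.map Prod.snd = μ := by
    rw [hν, Measure.map_add _ _ measurable_snd, Measure.map_add _ _ measurable_snd,
      Measure.map_smul, Measure.map_dirac' measurable_snd, Measure.map_map measurable_snd hm1,
      Measure.map_map measurable_snd hm2]
    have h1 : (Prod.snd ∘ fun x : ℝ => (x, a)) = fun _ => a := rfl
    have h2 : (Prod.snd ∘ fun x : ℝ => (a, x)) = id := rfl
    rw [h1, h2, Measure.map_id, Measure.map_const, huniv, add_comm μ', ← add_assoc, ← add_smul,
      tsub_add_cancel_of_le hle, hμ]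
  refine ⟨ν, ⟨?_⟩, hfst, hsnd, ?_⟩
  · have : (ν.map Prod.fst) Set.univ = 1 := by rw [hfst, measure_univ]
    rwa [Measure.map_apply measurable_fst MeasurableSet.univ, Set.preimage_univ] at this
  · have hms : MeasurableSet {p : ℝ × ℝ | p.1 = a ∨ p.2 = a} :=
      (measurableSet_eq_fun measurable_fst measurable_const).union
        (measurableSet_eq_fun measurable_snd measurable_const)
    rw [hν]
    refine ae_add_measure_iff.2 ⟨?_, ae_add_measure_iff.2 ⟨?_, ?_⟩⟩
    · refine Measure.ae_smul_measure ?_ _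
      rw [ae_dirac_iff hms]
      exact Or.inl rfl
    · rw [ae_map_iff hm1.aemeasurable hms]
      exact Filter.Eventually.of_forall fun x => Or.inl rfl
    · rw [ae_map_iff hm2.aemeasurable hms]
      exact Filter.Eventually.of_forall fun x => Or.inr rfl

end Symmetrization

end QuadLO

namespace QuadLO

/-! ### Anticoncentration after symmetrization. -/

section Symmetrized

variable {ι : Type*} [Fintype ι] [DecidableEq ι]

theorem one_div_sqrt_le_of_mul_le {n M : ℕ} {q : ℝ} (hM : 1 ≤ M) (hq : 0 < q) (hq1 : q ≤ 1)
    (h : q * M / 2 ≤ n) : 1 / √n ≤ 2 / q * (1 / √M) := by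
  have hM0 : (0 : ℝ) < M := by exact_mod_cast hM
  have hn0 : (0 : ℝ) < n := lt_of_lt_of_le (by positivity) h
  have h1 : q * √M ≤ 2 * √n := by
    have h2 : q * √M = √(q ^ 2 * M) := by
      rw [Real.sqrt_mul (by positivity), Real.sqrt_sq hq.le]
    have h3 : 2 * √(n : ℝ) = √(2 ^ 2 * n) := by
      rw [Real.sqrt_mul (by positivity), Real.sqrt_sq (by norm_num)]
    rw [h2, h3]
    refine Real.sqrt_le_sqrt ?_
    have h4 : q ^ 2 * M ≤ q * M := by gcongr; nlinarith
    linarith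
  rw [div_mul_div_comm, mul_one, div_le_div_iff₀ (by positivity) (by positivity)]
  linarith

theorem one_div_le_one_div_sqrt {M : ℕ} {q : ℝ} (hM : 1 ≤ M) (hq : 0 < q) :
    1 / (q * M) ≤ 1 / q * (1 / √M) := by
  have hM0 : (1 : ℝ) ≤ M := by exact_mod_cast hM
  rw [one_div_mul_one_div]
  have h1 : √(M : ℝ) ≤ M := by
    rw [Real.sqrt_le_left (by linarith)]
    nlinarith
  have h2 : 0 < √(M : ℝ) := Real.sqrt_pos.2 (by linarith)
  gcongr

/-- An anticoncentration bound for sums of independent random variables, none of which takes any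
value with probability more than `1 - δ`. -/
theorem measure_sum_eq_le {δ : ℝ} (hδ : 0 < δ) (hδ1 : δ ≤ 1) (μ : ι → Measure ℝ)
    [∀ i, IsProbabilityMeasure (μ i)] {f : ι → ℝ → ℝ} (hf : ∀ i, Measurable (f i))
    {I : Finset ι} (hI : 1 ≤ I.card) (hμ : ∀ i ∈ I, ∀ v, (μ i).real {x | f i x = v} ≤ 1 - δ)
    (z : ℝ) : Measure.pi μ {x | ∑ i, f i (x i) = z} ≤
      ENNReal.ofReal ((4 / δ + 1 / δ ^ 2) / √I.card) := by
  classical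
  obtain ⟨M, hM⟩ : ∃ M, M = I.card := ⟨_, rfl⟩
  have g := (I.equivFin.symm : Fin I.card ≃ I)
  rw [← hM] at g hI ⊢
  have hA : MeasurableSet {x : ι → ℝ | ∑ i, f i (x i) = z} :=
    measurableSet_eq_fun (Finset.measurable_sum _ fun i _ => (hf i).comp (measurable_pi_apply i))
      measurable_const
  set ν : ι → Measure (ℝ × ℝ) := fun i => (μ i).prod (μ i) with hν
  have h1 : ∀ i, (ν i).map Prod.fst = μ i := fun i => by simp [hν]
  have h2 : ∀ i, (ν i).map Prod.snd = μ i := fun i => by simp [hν]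
  have hAm : ∀ i, MeasurableSet {p : ℝ × ℝ | f i p.1 ≠ f i p.2} := fun i =>
    (measurableSet_eq_fun ((hf i).comp measurable_fst) ((hf i).comp measurable_snd)).compl
  have hconc := measure_pi_card_lt_le ν hI (S := fun e => {(g e : ι)})
    (fun e e' he => Finset.disjoint_singleton.2 fun h => he (g.injective (Subtype.ext h)))
    (N := 1) (fun e => by simp) (A := fun i => {p : ℝ × ℝ | f i p.1 ≠ f i p.2}) hAm hδ hδ1
    (fun e i hi => by
      rw [Finset.mem_singleton] at hi
      subst hi
      exact le_measureReal_prod_ne _ (hf _) (hμ _ (g e).2))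
  rw [pow_one] at hconc
  rw [measure_pi_eq_lintegral_select h1 h2 hA]
  refine (lintegral_ofReal_le (Measure.pi ν) (fun _ => pr_le_one _) (C := 2 * (2 / δ * (1 / √M)))
    fun ω hω => ?_).trans ((add_le_add_right hconc _).trans ?_)
  · simp only [Set.mem_ofPred_eq, not_forall, not_lt, exists_prop] at hω
    obtain ⟨E, hE, hn⟩ := hω
    have hM0 : (0 : ℝ) < M := by exact_mod_cast hI
    have hn1 : 1 ≤ E.card := by
      have : (0 : ℝ) < E.card := lt_of_lt_of_le (by positivity) hn
      exact_mod_cast this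
    -- Given the pairs, the sum is affine in the signs with half-differences as coefficients; those
    -- of the indices in `g '' E` are nonzero.
    set d : ι → ℝ := fun i => (f i (ω i).1 - f i (ω i).2) / 2 with hd
    set Λ : (ι → ℝ) →ₗ[ℝ] ℝ := ∑ i, d i • LinearMap.proj i with hΛ
    have hΛa : ∀ x, Λ x = ∑ i, d i * x i := fun x => by simp [hΛ]
    have honto : ∀ a : Fin E.card, Onto Λ {(g (E.orderEmbOfFin rfl a) : ι)} := by
      intro a w
      have hmem := E.orderEmbOfFin_mem rfl a
      set i : ι := (g (E.orderEmbOfFin rfl a) : ι)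
      have hdi : d i ≠ 0 := by
        have := hE _ hmem i (Finset.mem_singleton_self _)
        exact div_ne_zero (sub_ne_zero.2 this) two_ne_zero
      refine ⟨Pi.single i (w / d i), single_mem_supp (Finset.mem_singleton_self _) _, ?_⟩
      rw [hΛa, Finset.sum_eq_single i]
      · rw [Pi.single_eq_same]; field_simp
      · intro j _ hj
        rw [Pi.single_eq_of_ne hj, mul_zero]
      · simp
    have hpr := pr_linear_le_pow Λ hn1 (T := fun a => {(g (E.orderEmbOfFin rfl a) : ι)})
      (fun a b hab => Finset.disjoint_singleton.2
        fun h => hab ((E.orderEmbOfFin rfl).injective (g.injective (Subtype.ext h))))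
      honto (n := 1) (by simp) (z - ∑ i, (f i (ω i).1 + f i (ω i).2) / 2)
    calc pr (fun c => select c ω ∈ {x : ι → ℝ | ∑ i, f i (x i) = z})
        ≤ pr (fun c => Λ c = z - ∑ i, (f i (ω i).1 + f i (ω i).2) / 2) := by
          refine pr_mono fun c hc h => ?_
          rw [Set.mem_ofPred_eq] at h
          rw [hΛa, ← h, ← Finset.sum_sub_distrib]
          refine Finset.sum_congr rfl fun i _ => ?_
          rcases mem_cube.1 hc i with h | h
          · rw [select, if_pos h, h]; ring
          · rw [select, if_neg (by rw [h]; norm_num), h]; ring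
      _ ≤ 2 / √E.card := by simpa using hpr
      _ = 2 * (1 / √E.card) := by ring
      _ ≤ _ := by
        gcongr
        exact one_div_sqrt_le_of_mul_le hI hδ hδ1 hn
  · rw [← ENNReal.ofReal_add (by positivity) (by positivity)]
    refine ENNReal.ofReal_le_ofReal ?_
    have h3 := one_div_le_one_div_sqrt hI (pow_pos hδ 2)
    calc _ ≤ 2 * (2 / δ * (1 / √M)) + 1 / δ ^ 2 * (1 / √M) := by linarith
      _ = _ := by ring

/-- For all choices of the pairs from which the coordinates are selected, a bound in terms of the
number of disjoint mixed terms whose coordinates are truly random. -/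
theorem pr_quad_select_le {K : ℝ}
    (hK : ∀ {B : (ι → ℝ) →ₗ[ℝ] (ι → ℝ) →ₗ[ℝ] ℝ}, (∀ x y, B x y = B y x) →
      ∀ (b : (ι → ℝ) →ₗ[ℝ] ℝ) (c : ℝ) {m : ℕ} (_ : 1 ≤ m) {i j : Fin m → ι}, (∀ a, i a ≠ j a) →
      (Pairwise fun a b => Disjoint ({i a, j a} : Finset ι) {i b, j b}) →
      (∀ a, B (Pi.single (i a) 1) (Pi.single (j a) 1) ≠ 0) →
      pr (fun x => quad B b c x = 0) ≤ K / √m)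
    {B : (ι → ℝ) →ₗ[ℝ] (ι → ℝ) →ₗ[ℝ] ℝ} (hB : ∀ x y, B x y = B y x) (b : (ι → ℝ) →ₗ[ℝ] ℝ) (c : ℝ)
    {m : ℕ} (hm : 1 ≤ m) {i j : Fin m → ι} (hij : ∀ a, i a ≠ j a)
    (hd : Pairwise fun a b => Disjoint ({i a, j a} : Finset ι) {i b, j b})
    (hne : ∀ a, B (Pi.single (i a) 1) (Pi.single (j a) 1) ≠ 0) {ω : ι → ℝ × ℝ}
    (hi : ∀ a, (ω (i a)).1 ≠ (ω (i a)).2) (hj : ∀ a, (ω (j a)).1 ≠ (ω (j a)).2) :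
    pr (fun σ => quad B b c (select σ ω) = 0) ≤ K / √m := by
  set h : ι → ℝ := fun i => ((ω i).1 - (ω i).2) / 2 with hh
  set u : ι → ℝ := fun i => ((ω i).1 + (ω i).2) / 2 with hu
  -- The selected point is `H σ + u`, so the mixed coefficients are multiplied by the
  -- half-differences `h`, nonzero at matched coordinates.
  set H : (ι → ℝ) →ₗ[ℝ] (ι → ℝ) := LinearMap.mulLeft ℝ h with hH
  have hHs : ∀ i, H (Pi.single i 1) = h i • Pi.single i 1 := by
    intro i
    ext k
    by_cases hk : k = i
    · subst hk; simp [hH]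
    · simp [hH, hk]
  have key := hK (B := B.compl₁₂ H H) (fun x y => hB _ _) ((b + polar B u) ∘ₗ H) (quad B b c u) hm
    hij hd (fun a => by
      rw [LinearMap.compl₁₂_apply, hHs, hHs, map_smul, map_smul, LinearMap.smul_apply, smul_eq_mul,
        smul_eq_mul]
      exact mul_ne_zero (div_ne_zero (sub_ne_zero.2 (hj a)) two_ne_zero)
        (mul_ne_zero (div_ne_zero (sub_ne_zero.2 (hi a)) two_ne_zero) (hne a)))
  refine (pr_mono fun σ hσ hq => ?_).trans key
  have hsel : select σ ω = H σ + u := by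
    ext i
    rw [select_eq hσ, Pi.add_apply, add_comm]
    rfl
  rw [hsel, quad_add] at hq
  exact hq

/-- Endpoints in `D` have fixed pairs with distinct members; every other endpoint has distinct
members with probability at least δ. So an edge survives with probability at least δ², and by
Chebyshev a constant proportion of the matching does. -/
theorem lintegral_pr_quad_le_of_matching {K : ℝ} (hK0 : 0 ≤ K)
    (hK : ∀ {B : (ι → ℝ) →ₗ[ℝ] (ι → ℝ) →ₗ[ℝ] ℝ}, (∀ x y, B x y = B y x) →
      ∀ (b : (ι → ℝ) →ₗ[ℝ] ℝ) (c : ℝ) {m : ℕ} (_ : 1 ≤ m) {i j : Fin m → ι}, (∀ a, i a ≠ j a) →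
      (Pairwise fun a b => Disjoint ({i a, j a} : Finset ι) {i b, j b}) →
      (∀ a, B (Pi.single (i a) 1) (Pi.single (j a) 1) ≠ 0) →
      pr (fun x => quad B b c x = 0) ≤ K / √m)
    {δ : ℝ} (hδ : 0 < δ) (hδ1 : δ ≤ 1) (ν : ι → Measure (ℝ × ℝ)) [∀ i, IsProbabilityMeasure (ν i)]
    {B : (ι → ℝ) →ₗ[ℝ] (ι → ℝ) →ₗ[ℝ] ℝ} (hB : ∀ x y, B x y = B y x) (b : (ι → ℝ) →ₗ[ℝ] ℝ) (c : ℝ)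
    {M : ℕ} (hM : 1 ≤ M) {i j : Fin M → ι} (hij : ∀ a, i a ≠ j a)
    (hd : Pairwise fun a b => Disjoint ({i a, j a} : Finset ι) {i b, j b})
    (hne : ∀ a, B (Pi.single (i a) 1) (Pi.single (j a) 1) ≠ 0) {D : Finset ι} {ω : ι → ℝ × ℝ}
    (hν : ∀ k, k ∉ D → δ ≤ (ν k).real {p | p.1 ≠ p.2})
    (hi : ∀ a, i a ∈ D → (ω (i a)).1 ≠ (ω (i a)).2)
    (hj : ∀ a, j a ∈ D → (ω (j a)).1 ≠ (ω (j a)).2) :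
    ∫⁻ ω', ENNReal.ofReal (pr fun σ => quad B b c (select σ (D.piecewise ω ω')) = 0)
      ∂Measure.pi ν ≤ ENNReal.ofReal ((K * (2 / δ ^ 2) + 1 / (δ ^ 2) ^ 2) / √M) := by
  classical
  have hAm : MeasurableSet {p : ℝ × ℝ | p.1 ≠ p.2} :=
    (measurableSet_eq_fun measurable_fst measurable_snd).compl
  have hsub : ∀ e, ({i e, j e} : Finset ι).filter (· ∉ D) ⊆ {i e, j e} := fun e =>
    Finset.filter_subset _ _
  have hconc := measure_pi_card_lt_le ν hM
    (S := fun e => ({i e, j e} : Finset ι).filter (· ∉ D))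
    (fun e e' he => (hd he).mono (hsub e) (hsub e')) (N := 2)
    (fun e => (Finset.card_le_card (hsub e)).trans Finset.card_le_two)
    (A := fun _ => {p : ℝ × ℝ | p.1 ≠ p.2}) (fun _ => hAm) hδ hδ1
    (fun e k hk => hν k (Finset.mem_filter.1 hk).2)
  have hq : 0 < δ ^ 2 := by positivity
  have hq1 : δ ^ 2 ≤ 1 := by nlinarith
  refine (lintegral_ofReal_le (Measure.pi ν) (fun _ => pr_le_one _)
    (C := K * (2 / δ ^ 2 * (1 / √M))) fun ω' hω => ?_).trans
    ((add_le_add_right hconc _).trans ?_)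
  · simp only [Set.mem_ofPred_eq, not_forall, not_lt, exists_prop] at hω
    obtain ⟨E, hE, hn⟩ := hω
    have hM0 : (0 : ℝ) < M := by exact_mod_cast hM
    have hn1 : 1 ≤ E.card := by
      have : (0 : ℝ) < E.card := lt_of_lt_of_le (by positivity) hn
      exact_mod_cast this
    have hsurv : ∀ e ∈ E, ∀ k ∈ ({i e, j e} : Finset ι),
        (k ∈ D → (ω k).1 ≠ (ω k).2) → (D.piecewise ω ω' k).1 ≠ (D.piecewise ω ω' k).2 := by
      intro e he k hk hkD
      by_cases h : k ∈ D
      · simpa [h] using hkD h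
      · have := hE e he k (Finset.mem_filter.2 ⟨hk, h⟩)
        simpa [h] using this
    set g := E.orderEmbOfFin rfl
    calc _ ≤ K / √E.card := pr_quad_select_le hK hB b c hn1
          (i := fun a => i (g a)) (j := fun a => j (g a)) (fun a => hij _)
          (fun a b hab => hd (g.injective.ne hab)) (fun a => hne _)
          (fun a => hsurv (g a) (E.orderEmbOfFin_mem rfl a) _ (by simp) (hi _))
          (fun a => hsurv (g a) (E.orderEmbOfFin_mem rfl a) _ (by simp) (hj _))
      _ = K * (1 / √E.card) := by ring
      _ ≤ _ := by
        gcongr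
        exact one_div_sqrt_le_of_mul_le hM hq hq1 hn
  · rw [← ENNReal.ofReal_add (by positivity) (by positivity)]
    refine ENNReal.ofReal_le_ofReal ?_
    have h3 := one_div_le_one_div_sqrt hM (pow_pos hq 2)
    calc _ ≤ K * (2 / δ ^ 2 * (1 / √M)) + 1 / (δ ^ 2) ^ 2 * (1 / √M) := by linarith
      _ = _ := by ring

end Symmetrized

end QuadLO

namespace QuadLO

/-! ### From general laws to signs: matching or cover. -/

section Reduction

variable {ι : Type*} [Fintype ι] [DecidableEq ι]

omit [Fintype ι] [DecidableEq ι] in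
/-- Polynomials of degree at most two are quadratic functions. -/
theorem exists_eval_eq_quad (Q : MvPolynomial ι ℝ) (hQ : Q.totalDegree ≤ 2) :
    ∃ B : (ι → ℝ) →ₗ[ℝ] (ι → ℝ) →ₗ[ℝ] ℝ, (∀ x y, B x y = B y x) ∧
      ∃ (b : (ι → ℝ) →ₗ[ℝ] ℝ) (c : ℝ), ∀ x, MvPolynomial.eval x Q = quad B b c x := by
  classical
  have hmono : ∀ s ∈ Q.support, ∃ B : (ι → ℝ) →ₗ[ℝ] (ι → ℝ) →ₗ[ℝ] ℝ, (∀ x y, B x y = B y x) ∧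
      ∃ (b : (ι → ℝ) →ₗ[ℝ] ℝ) (c : ℝ), ∀ x : ι → ℝ,
        (Q.coeff s * ∏ i ∈ s.support, x i ^ s i) = quad B b c x := by
    intro s hs
    have hcard : Multiset.card s.toMultiset ≤ 2 := by
      rw [Finsupp.card_toMultiset]
      exact (MvPolynomial.le_totalDegree hs).trans hQ
    have hprod : ∀ x : ι → ℝ, ∏ i ∈ s.support, x i ^ s i = (s.toMultiset.map x).prod := by
      intro x
      rw [Finsupp.toMultiset_map, Finsupp.prod_toMultiset, Finsupp.prod_mapDomain_index]
      · rfl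
      · simp
      · intro i a b
        rw [pow_add]
    simp_rw [hprod]
    set a := Q.coeff s
    obtain h | h | h : Multiset.card s.toMultiset = 0 ∨ Multiset.card s.toMultiset = 1 ∨
        Multiset.card s.toMultiset = 2 := by omega
    · rw [Multiset.card_eq_zero] at h
      exact ⟨0, fun _ _ => rfl, 0, a, fun x => by simp [h, quad]⟩
    · obtain ⟨i, hi⟩ := Multiset.card_eq_one.1 h
      exact ⟨0, fun _ _ => rfl, a • LinearMap.proj i, 0, fun x => by simp [hi, quad]⟩
    · obtain ⟨i, j, hij⟩ := Multiset.card_eq_two.1 h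
      refine ⟨(a / 2) • ((LinearMap.mul ℝ ℝ).compl₁₂ (LinearMap.proj i) (LinearMap.proj j) +
        (LinearMap.mul ℝ ℝ).compl₁₂ (LinearMap.proj j) (LinearMap.proj i)), fun x y => ?_, 0, 0,
        fun x => ?_⟩
      · simp; ring
      · simp [hij, quad]; ring
  choose! B hB b c h using hmono
  refine ⟨∑ s ∈ Q.support, B s, fun x y => ?_, ∑ s ∈ Q.support, b s, ∑ s ∈ Q.support, c s,
    fun x => ?_⟩
  · simp only [LinearMap.sum_apply]
    exact Finset.sum_congr rfl fun s hs => hB s hs x y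
  · rw [MvPolynomial.eval_eq, quad]
    simp only [LinearMap.sum_apply]
    rw [← Finset.sum_add_distrib, ← Finset.sum_add_distrib]
    exact Finset.sum_congr rfl fun s hs => h s hs x

theorem measurable_quad (B : (ι → ℝ) →ₗ[ℝ] (ι → ℝ) →ₗ[ℝ] ℝ) (b : (ι → ℝ) →ₗ[ℝ] ℝ) (c : ℝ) :
    Measurable (quad B b c) := by
  have h : quad B b c = fun x : ι → ℝ => ∑ i, ∑ j, x i * x j * B (Pi.single i 1) (Pi.single j 1) +
      ∑ i, x i * b (Pi.single i 1) + c := by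
    ext x
    have hx := eq_sum_single_of_mem_supp (T := Finset.univ) (x := x)
      fun i hi => absurd (Finset.mem_univ i) hi
    have h1 : b x = ∑ i, x i * b (Pi.single i 1) := by
      conv_lhs => rw [hx]
      simp [map_sum]
    have h2 : B x x = ∑ i, ∑ j, x i * x j * B (Pi.single i 1) (Pi.single j 1) := by
      conv_lhs => rw [hx]
      simp only [map_sum, map_smul, LinearMap.sum_apply, LinearMap.smul_apply, smul_eq_mul]
      rw [Finset.sum_comm]
      refine Finset.sum_congr rfl fun i _ => ?_
      rw [Finset.mul_sum]
      refine Finset.sum_congr rfl fun j _ => ?_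
      ring
    rw [quad, h1, h2]
  rw [h]
  fun_prop

omit [Fintype ι] in
/-- The value of a quadratic function when the free coordinates are not coupled to each other. -/
theorem quad_add_proj {B : (ι → ℝ) →ₗ[ℝ] (ι → ℝ) →ₗ[ℝ] ℝ} (hB : ∀ x y, B x y = B y x)
    (b : (ι → ℝ) →ₗ[ℝ] ℝ) (c : ℝ) {F : Finset ι}
    (hF : ∀ i ∈ F, ∀ j ∈ F, i ≠ j → B (Pi.single i 1) (Pi.single j 1) = 0) (u x : ι → ℝ) :
    quad B b c (u + proj F x) = quad B b c u + ∑ i ∈ F,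
      (B (Pi.single i 1) (Pi.single i 1) * x i ^ 2 +
        (2 * B (Pi.single i 1) u + b (Pi.single i 1)) * x i) := by
  have hx := eq_sum_single_of_mem_supp (proj_mem_supp F x)
  have hx' : proj F x = ∑ i ∈ F, x i • Pi.single i (1 : ℝ) := by
    rw [hx]
    exact Finset.sum_congr rfl fun i hi => by rw [proj_apply, if_pos hi]
  have h1 : ∀ l : (ι → ℝ) →ₗ[ℝ] ℝ, l (proj F x) = ∑ i ∈ F, x i * l (Pi.single i 1) := by
    intro l
    rw [hx', map_sum]
    simp
  have h2 : B (proj F x) (proj F x) = ∑ i ∈ F, x i * (x i * B (Pi.single i 1) (Pi.single i 1)) := by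
    rw [h1]
    refine Finset.sum_congr rfl fun i hi => ?_
    rw [hB, h1, Finset.sum_eq_single i]
    · intro j hj hji
      rw [hF i hi j hj hji.symm, mul_zero]
    · exact fun h => absurd hi h
  rw [quad_add', polar_apply, h2, h1 b, hB (proj F x) u, h1 (B u), ← Finset.sum_add_distrib,
    ← Finset.sum_add_distrib, ← Finset.sum_add_distrib]
  congr 1
  refine Finset.sum_congr rfl fun i _ => ?_
  rw [hB u]
  ring

/-- A level set of `f` that is as likely as possible, for the purpose of comparing with `1 - δ`. -/
theorem exists_level_set (μ : Measure ℝ) [IsProbabilityMeasure μ] {s : Set ℝ}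
    (hs : ∀ᵐ x ∂μ, x ∈ s) (f : ℝ → ℝ) {δ : ℝ} (hδ : δ ≤ 1) :
    ∃ R ⊆ s, R.Nonempty ∧ (∃ v, ∀ x ∈ R, f x = v) ∧
      (μ.real R ≤ 1 - δ → ∀ v, μ.real {x | f x = v} ≤ 1 - δ) := by
  by_cases h : ∃ v, 1 - δ < μ.real {x | f x = v}
  · obtain ⟨v, hv⟩ := h
    have heq : μ.real ({x | f x = v} ∩ s) = μ.real {x | f x = v} := by
      rw [measureReal_def, measureReal_def, measure_inter_conull]
      exact hs
    refine ⟨{x | f x = v} ∩ s, Set.inter_subset_right, ?_, ⟨v, fun x hx => hx.1⟩, fun hle => ?_⟩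
    · rw [Set.nonempty_iff_ne_empty]
      intro h0
      rw [h0, measureReal_empty] at heq
      linarith
    · rw [heq] at hle
      linarith
  -- Without a heavy level the implication holds whatever `R` is, so any point of `s` will do.
  · push Not at h
    obtain ⟨x, hx⟩ := hs.exists
    exact ⟨{x}, Set.singleton_subset_iff.2 hx, Set.singleton_nonempty x, ⟨f x, by simp⟩,
      fun _ => h⟩

/-- The hypothesis of the theorem in terms of the laws: every box on which the quadratic function is
constant is unlikely in at least `m` directions. -/
def FixingBoxesSpread (μ : ι → Measure ℝ) (s : ι → Set ℝ) (f : (ι → ℝ) → ℝ) (δ : ℝ) (m : ℕ) :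
    Prop :=
  ∀ R : ι → Set ℝ, (∀ i, (R i).Nonempty) → (∀ i, R i ⊆ s i) →
    (∃ v, ∀ x ∈ Set.univ.pi R, f x = v) → m ≤ Set.ncard {i | (μ i).real (R i) ≤ 1 - δ}

/-- The case where few coordinates cover all relevant mixed terms. -/
theorem measure_quad_le_of_cover {δ : ℝ} (hδ : 0 < δ) (hδ1 : δ ≤ 1) (μ : ι → Measure ℝ)
    [∀ i, IsProbabilityMeasure (μ i)] {s : ι → Set ℝ} (hs : ∀ i, ∀ᵐ x ∂μ i, x ∈ s i)
    {B : (ι → ℝ) →ₗ[ℝ] (ι → ℝ) →ₗ[ℝ] ℝ} (hB : ∀ x y, B x y = B y x) (b : (ι → ℝ) →ₗ[ℝ] ℝ) (c : ℝ)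
    {m : ℕ} (hm : FixingBoxesSpread μ s (quad B b c) δ m) {D S : Finset ι} (hS : 2 * S.card < m)
    {a w : ι → ℝ} (ha : ∀ j ∈ D, a j ∈ s j ∧ 1 - δ < (μ j).real {a j}) (hw : ∀ j, w j ∈ s j)
    (hcov : ∀ i j, i ≠ j → i ∉ D → i ∉ S → j ∉ S → (j ∈ D → w j ≠ a j) →
      B (Pi.single i 1) (Pi.single j 1) = 0) :
    Measure.pi μ {x | quad B b c (D.piecewise w x) = 0} ≤
      ENNReal.ofReal (2 * (4 / δ + 1 / δ ^ 2) / √m) := by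
  have hA : MeasurableSet {x : ι → ℝ | quad B b c (D.piecewise w x) = 0} :=
    measurableSet_eq_fun ((measurable_quad B b c).comp (measurable_piecewise_right D w))
      measurable_const
  rw [measure_pi_eq_piecewise μ S hA]
  have hae : ∀ᵐ y ∂Measure.pi μ, ∀ i, y i ∈ s i :=
    ae_all_iff.2 fun i => (measurePreserving_eval μ i).quasiMeasurePreserving.ae (hs i)
  refine (lintegral_mono_ae (g := fun _ => ENNReal.ofReal (2 * (4 / δ + 1 / δ ^ 2) / √m))
    ?_).trans (by simp)
  filter_upwards [hae] with y hy
  set F : Finset ι := (D ∪ S)ᶜ with hF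
  have hFD : ∀ i ∈ F, i ∉ D := fun i hi h => by simp [hF, h] at hi
  have hFS : ∀ i ∈ F, i ∉ S := fun i hi h => by simp [hF, h] at hi
  -- `u` is the actual base point; `u'` differs from it only on D \ S, where the atom replaces the
  -- revealed value.
  set u : ι → ℝ := D.piecewise w (S.piecewise y 0) with hu
  set u' : ι → ℝ := S.piecewise (D.piecewise w y) (D.piecewise a 0) with hu'
  have hpt : ∀ x : ι → ℝ, D.piecewise w (S.piecewise y x) = u + proj F x := by
    intro x
    ext i
    by_cases h1 : i ∈ D <;> by_cases h2 : i ∈ S <;> simp [hu, hF, proj_apply, h1, h2]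
  have hFF : ∀ i ∈ F, ∀ j ∈ F, i ≠ j → B (Pi.single i 1) (Pi.single j 1) = 0 :=
    fun i hi j hj hij => hcov i j hij (hFD i hi) (hFS i hi) (hFS j hj)
      fun h => absurd h (hFD j hj)
  -- Where the two base points differ, `hcov` decouples the coordinate from `F`. The univariate
  -- terms are thus the same at `u` and `u'`, and boxes may be based at `u'`.
  have huu' : ∀ i ∈ F, B (Pi.single i 1) u = B (Pi.single i 1) u' := by
    intro i hi
    rw [← sub_eq_zero, ← map_sub]
    have hsupp : u - u' ∈ supp (Finset.univ : Finset ι) := fun j hj =>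
      absurd (Finset.mem_univ j) hj
    rw [map_eq_sum_of_mem_supp _ hsupp]
    refine Finset.sum_eq_zero fun j _ => ?_
    by_cases hS' : j ∈ S
    · by_cases hD : j ∈ D <;> simp [hu, hu', hS', hD]
    · by_cases hD : j ∈ D
      · by_cases hwa : w j = a j
        · simp [hu, hu', hS', hD, hwa]
        · rw [hcov i j (fun h => hFD i hi (h ▸ hD)) (hFD i hi) (hFS i hi) hS' fun _ => hwa,
            smul_zero]
      · simp [hu, hu', hS', hD]
  set f : ι → ℝ → ℝ := fun i t => if i ∈ F then B (Pi.single i 1) (Pi.single i 1) * t ^ 2 +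
    (2 * B (Pi.single i 1) u + b (Pi.single i 1)) * t else 0 with hf
  have hfF : ∀ i ∈ F, ∀ t, f i t = B (Pi.single i 1) (Pi.single i 1) * t ^ 2 +
      (2 * B (Pi.single i 1) u + b (Pi.single i 1)) * t := fun i hi t => if_pos hi
  have hfm : ∀ i, Measurable (f i) := by
    intro i
    by_cases hi : i ∈ F
    · simp only [hf, hi, if_true]; fun_prop
    · simp only [hf, hi, if_false]; fun_prop
  have hsum : ∀ x : ι → ℝ, ∑ i, f i (x i) = ∑ i ∈ F, f i (x i) := fun x =>
    (Finset.sum_subset (Finset.subset_univ F) fun i _ hi => if_neg hi).symm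
  have hq : ∀ x, quad B b c (u + proj F x) = quad B b c u + ∑ i, f i (x i) := by
    intro x
    rw [quad_add_proj hB b c hFF, hsum]
    congr 1
    exact Finset.sum_congr rfl fun i hi => (hfF i hi _).symm
  have hq' : ∀ x, quad B b c (u' + proj F x) = quad B b c u' + ∑ i, f i (x i) := by
    intro x
    rw [quad_add_proj hB b c hFF, hsum]
    congr 1
    refine Finset.sum_congr rfl fun i hi => ?_
    rw [hfF i hi, huu' i hi]
  choose R₀ hR₀s hR₀n hR₀v hR₀μ using fun i => exists_level_set (μ i) (hs i) (f i) hδ1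
  choose v hv using hR₀v
  -- On D \ S the side is an atom of mass above 1 - δ, so these directions do not count: the `m`
  -- unlikely ones lie in `S` or `F`, and more than half of them in `F`.
  set R : ι → Set ℝ := fun i => if i ∈ F then R₀ i else {u' i} with hR
  have hRF : ∀ i ∈ F, R i = R₀ i := fun i hi => if_pos hi
  have hRn : ∀ i, i ∉ F → R i = {u' i} := fun i hi => if_neg hi
  have hu's : ∀ i, i ∉ F → u' i ∈ s i := by
    intro i hi
    by_cases hS' : i ∈ S
    · by_cases hD : i ∈ D
      · simpa [hu', hS', hD] using hw i
      · simpa [hu', hS', hD] using hy i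
    · have hD : i ∈ D := by
        by_contra hD
        exact hi (by simp [hF, hS', hD])
      simpa [hu', hS', hD] using (ha i hD).1
  have hcount := hm R (fun i => by
      by_cases hi : i ∈ F
      · rw [hRF i hi]; exact hR₀n i
      · rw [hRn i hi]; exact Set.singleton_nonempty _)
    (fun i => by
      by_cases hi : i ∈ F
      · rw [hRF i hi]; exact hR₀s i
      · rw [hRn i hi]; exact Set.singleton_subset_iff.2 (hu's i hi))
    ⟨quad B b c u' + ∑ i ∈ F, v i, fun x hx => by
      have hxu : x = u' + proj F x := by
        ext i
        by_cases hi : i ∈ F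
        · have h1 := hFD i hi
          have h2 := hFS i hi
          simp [hu', h1, h2, proj_apply, hi]
        · have := hx i trivial
          rw [hRn i hi] at this
          simp [proj_apply, hi, Set.mem_singleton_iff.1 this]
      rw [hxu, hq', hsum]
      congr 1
      refine Finset.sum_congr rfl fun i hi => ?_
      have := hx i trivial
      rw [hRF i hi] at this
      exact hv i _ this⟩
  classical
  set I : Finset ι := F.filter fun i => (μ i).real (R i) ≤ 1 - δ with hI
  have hsub : {i | (μ i).real (R i) ≤ 1 - δ} ⊆ ((S ∪ I : Finset ι) : Set ι) := by
    intro i hi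
    rw [Set.mem_ofPred_eq] at hi
    rw [Finset.coe_union]
    by_cases hiF : i ∈ F
    · exact Or.inr (Finset.mem_coe.2 (Finset.mem_filter.2 ⟨hiF, hi⟩))
    · left
      by_contra hS'
      have hS'' : i ∉ S := hS'
      have hD : i ∈ D := by
        by_contra hD
        exact hiF (by simp [hF, hS'', hD])
      rw [hRn i hiF] at hi
      have : u' i = a i := by simp [hu', hS'', hD]
      rw [this] at hi
      exact absurd hi (not_le.2 (ha i hD).2)
  have hIcard : m ≤ S.card + I.card := by
    calc m ≤ _ := hcount
      _ ≤ Set.ncard ((S ∪ I : Finset ι) : Set ι) := Set.ncard_le_ncard hsub (Finset.finite_toSet _)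
      _ = (S ∪ I).card := Set.ncard_coe_finset _
      _ ≤ _ := Finset.card_union_le _ _
  have hI1 : 1 ≤ I.card := by omega
  have hIm : m ≤ 2 * I.card := by omega
  have key := measure_sum_eq_le hδ hδ1 μ hfm hI1 (fun i hi v => by
    obtain ⟨hiF, hile⟩ := Finset.mem_filter.1 hi
    rw [hRF i hiF] at hile
    exact hR₀μ i hile v) (-quad B b c u)
  have hset : {x : ι → ℝ | quad B b c (D.piecewise w (S.piecewise y x)) = 0} =
      {x | ∑ i, f i (x i) = -quad B b c u} := by
    ext x
    rw [Set.mem_ofPred_eq, Set.mem_ofPred_eq, hpt, hq, eq_neg_iff_add_eq_zero,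
      add_comm]
  refine (le_of_eq_of_le (congrArg _ hset) key).trans (ENNReal.ofReal_le_ofReal ?_)
  have hm0 : (0 : ℝ) < m := by
    have : 0 < m := by omega
    exact_mod_cast this
  have hI0 : (0 : ℝ) < I.card := by exact_mod_cast hI1
  have hsq : √(m : ℝ) ≤ 2 * √I.card := by
    rw [Real.sqrt_le_left (mul_nonneg zero_le_two (Real.sqrt_nonneg _)), mul_pow,
      Real.sq_sqrt hI0.le]
    have : (m : ℝ) ≤ 2 * I.card := by exact_mod_cast hIm
    linarith
  rw [div_le_div_iff₀ (Real.sqrt_pos.2 hI0) (Real.sqrt_pos.2 hm0)]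
  have hC : 0 ≤ 4 / δ + 1 / δ ^ 2 := by positivity
  nlinarith [mul_le_mul_of_nonneg_left hsq hC]

/-- The main bound, in terms of the laws of the coordinates. -/
theorem exists_measure_quad_le {δ : ℝ} (hδ : 0 < δ) (hδ1 : δ ≤ 1 / 2) : ∃ C : ℝ, 0 ≤ C ∧
    ∀ {ι : Type} [Fintype ι] [DecidableEq ι] (μ : ι → Measure ℝ) [∀ i, IsProbabilityMeasure (μ i)]
      {s : ι → Set ℝ} (_ : ∀ i, ∀ᵐ x ∂μ i, x ∈ s i) {B : (ι → ℝ) →ₗ[ℝ] (ι → ℝ) →ₗ[ℝ] ℝ}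
      (_ : ∀ x y, B x y = B y x) (b : (ι → ℝ) →ₗ[ℝ] ℝ) (c : ℝ) {m : ℕ} (_ : 1 ≤ m),
      (∀ i, MeasurableSet (s i)) → FixingBoxesSpread μ s (quad B b c) δ m →
      Measure.pi μ {x | quad B b c x = 0} ≤ ENNReal.ofReal (C / √m) := by
  obtain ⟨K, hK1, hK⟩ := exists_pr_quad_le_of_matching
  have hδ1' : δ ≤ 1 := by linarith
  set C₁ : ℝ := K * (2 / δ ^ 2) + 1 / (δ ^ 2) ^ 2 with hC₁
  set C₂ : ℝ := 4 / δ + 1 / δ ^ 2 with hC₂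
  have hC₁0 : 0 ≤ C₁ := by positivity
  have hC₂0 : 0 ≤ C₂ := by positivity
  refine ⟨2 * C₁ + 2 * C₂, by positivity, ?_⟩
  intro ι _ _ μ _ s hs B hB b c m hm hsm hspread
  -- `D` gathers the coordinates dominated by an atom. For the others independent copies differ
  -- often enough; for those in `D` they need not, and the coupling through the atom is used.
  classical
  set D : Finset ι := Finset.univ.filter fun i => ∃ a, 1 - δ < (μ i).real {a} with hD
  have hcoup : ∀ i, ∃ (ν : Measure (ℝ × ℝ)) (a : ℝ), IsProbabilityMeasure ν ∧
      ν.map Prod.fst = μ i ∧ ν.map Prod.snd = μ i ∧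
      (i ∈ D → 1 - δ < (μ i).real {a} ∧ ∀ᵐ p ∂ν, p.1 = a ∨ p.2 = a) ∧
      (i ∉ D → δ ≤ ν.real {p | p.1 ≠ p.2}) := by
    intro i
    by_cases hi : i ∈ D
    · obtain ⟨a, ha⟩ := (Finset.mem_filter.1 hi).2
      obtain ⟨ν, h1, h2, h3, h4⟩ := exists_coupling_of_atom (μ i) (a := a) (by linarith)
      exact ⟨ν, a, h1, h2, h3, fun _ => ⟨ha, h4⟩, fun h => absurd hi h⟩
    · refine ⟨(μ i).prod (μ i), 0, inferInstance, by simp, by simp, fun h => absurd h hi,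
        fun _ => le_measureReal_prod_ne (μ i) measurable_id fun v => ?_⟩
      by_contra hv
      exact hi (Finset.mem_filter.2 ⟨Finset.mem_univ i, v, not_le.1 hv⟩)
  choose ν a hν h1 h2 hνD hνN using hcoup
  have hA : MeasurableSet {x : ι → ℝ | quad B b c x = 0} :=
    measurableSet_eq_fun (measurable_quad B b c) measurable_const
  rw [measure_pi_eq_lintegral_select h1 h2 hA, lintegral_pi_eq_piecewise ν D
    (measurable_ofReal_pr fun σ => measurable_select σ hA)]
  have hω1 : ∀ᵐ ω ∂Measure.pi ν, ∀ i, i ∈ D → (ω i).1 = a i ∨ (ω i).2 = a i := by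
    refine ae_all_iff.2 fun i => ?_
    by_cases hi : i ∈ D
    · filter_upwards [(measurePreserving_eval ν i).quasiMeasurePreserving.ae (hνD i hi).2]
        with ω hω _ using hω
    · exact Filter.Eventually.of_forall fun ω h => absurd h hi
  have hω2 : ∀ᵐ ω ∂Measure.pi ν, ∀ i, (ω i).1 ∈ s i ∧ (ω i).2 ∈ s i := by
    refine ae_all_iff.2 fun i => (measurePreserving_eval ν i).quasiMeasurePreserving.ae
      (p := fun p : ℝ × ℝ => p.1 ∈ s i ∧ p.2 ∈ s i) ?_
    have h3 : ∀ᵐ p ∂ν i, p.1 ∈ s i :=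
      (ae_map_iff measurable_fst.aemeasurable (hsm i)).1 (by rw [h1]; exact hs i)
    have h4 : ∀ᵐ p ∂ν i, p.2 ∈ s i :=
      (ae_map_iff measurable_snd.aemeasurable (hsm i)).1 (by rw [h2]; exact hs i)
    exact h3.and h4
  refine (lintegral_mono_ae (g := fun _ => ENNReal.ofReal ((2 * C₁ + 2 * C₂) / √m))
    ?_).trans (by simp)
  filter_upwards [hω1, hω2] with ω hωD hωs
  -- M is m/4 rounded up: a cover has at most 2(M - 1) < m/2 elements.
  obtain ⟨M, hM1, hM2, hM3⟩ : ∃ M, 1 ≤ M ∧ m ≤ 4 * M ∧ 4 * (M - 1) < m :=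
    ⟨(m + 3) / 4, by omega, by omega, by omega⟩
  have hm0 : (0 : ℝ) < m := by exact_mod_cast hm
  -- An edge has an endpoint outside `D`; the other endpoint, if in `D`, must have a revealed pair
  -- with distinct members. Otherwise its value is the atom for either sign, which the fixing box
  -- accommodates.
  rcases exists_disjoint_or_cover (fun R => ∃ i j, i ≠ j ∧ R = {i, j} ∧ i ∉ D ∧
      (j ∈ D → (ω j).1 ≠ (ω j).2) ∧ B (Pi.single i 1) (Pi.single j 1) ≠ 0) 2 M with
    ⟨T, hT, hp⟩ | ⟨S, hS, hcov⟩
  · choose i j hij hTij hiD hjD hne using fun e => (hp e).1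
    refine (lintegral_pr_quad_le_of_matching (by linarith) (fun hB => hK hB) hδ hδ1' ν hB b c hM1
      hij (fun e e' he => ?_) hne hνN (fun e h => absurd h (hiD e)) hjD).trans
      (ENNReal.ofReal_le_ofReal ?_)
    · have : Disjoint (T e) (T e') := hT he
      rw [hTij, hTij] at this
      exact this
    · have hM0 : (0 : ℝ) < M := by exact_mod_cast hM1
      have hsq : √(m : ℝ) ≤ 2 * √M := by
        rw [Real.sqrt_le_left (by positivity), mul_pow, Real.sq_sqrt hM0.le]
        have : (m : ℝ) ≤ 4 * M := by exact_mod_cast hM2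
        linarith
      rw [div_le_div_iff₀ (by positivity) (by positivity)]
      nlinarith [mul_le_mul_of_nonneg_left hsq hC₁0, mul_nonneg hC₂0 (Real.sqrt_nonneg (M : ℝ))]
  · have hE : ∀ σ : ι → ℝ, MeasurableSet {ω' | quad B b c (select σ (D.piecewise ω ω')) = 0} :=
      fun σ => (measurable_select σ).comp (measurable_piecewise_right D ω) hA
    refine (lintegral_ofReal_pr _ hE).trans_le ?_
    have hle : ∀ σ ∈ cube ι, Measure.pi ν {ω' | quad B b c (select σ (D.piecewise ω ω')) = 0} ≤ ENNReal.ofReal ((2 * C₁ + 2 * C₂) / √m) := by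
      intro σ _
      have hwsel : ∀ j, select σ ω j = (ω j).1 ∨ select σ ω j = (ω j).2 := by
        intro j
        by_cases h : σ j = 1 <;> simp [select, h]
      have hA' : MeasurableSet {x : ι → ℝ | quad B b c (D.piecewise (select σ ω) x) = 0} :=
        measurable_piecewise_right D _ hA
      have heq : {ω' | quad B b c (select σ (D.piecewise ω ω')) = 0} =
          select σ ⁻¹' {x | quad B b c (D.piecewise (select σ ω) x) = 0} := by
        ext ω'
        rw [Set.mem_ofPred_eq, select_piecewise]
        rfl
      rw [heq, ← Measure.map_apply (measurable_select σ) hA', map_select h1 h2]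
      refine (measure_quad_le_of_cover hδ hδ1' μ hs hB b c hspread (S := S) (by omega)
        (a := a) (fun j hj => ⟨?_, (hνD j hj).1⟩) (fun j => ?_) fun i j hij hiD hiS hjS hwa => ?_).trans
        (ENNReal.ofReal_le_ofReal ?_)
      · rcases hωD j hj with h | h
        · exact h ▸ (hωs j).1
        · exact h ▸ (hωs j).2
      · rcases hwsel j with h | h
        · rw [h]; exact (hωs j).1
        · rw [h]; exact (hωs j).2
      · by_contra hne
        refine hcov {i, j} ⟨i, j, hij, rfl, hiD, fun hj heq => ?_, hne⟩ Finset.card_le_two ?_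
        · refine hwa hj ?_
          rcases hωD j hj with h | h <;> rcases hwsel j with h' | h' <;> rw [h'] <;>
            first | exact h | (rw [heq]; exact h) | (rw [← heq]; exact h)
        · rw [Finset.disjoint_insert_left]
          exact ⟨hiS, Finset.disjoint_singleton_left.2 hjS⟩
      · gcongr
        linarith
    calc _ ≤ ∑ _σ ∈ cube ι, (2 ^ Fintype.card ι : ENNReal)⁻¹ *
          ENNReal.ofReal ((2 * C₁ + 2 * C₂) / √m) :=
          Finset.sum_le_sum fun σ hσ => mul_le_mul_right (hle σ hσ) _
      _ = _ := by rw [← Finset.sum_mul, sum_cube_inv, one_mul]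

end Reduction

end QuadLO

namespace QuadLO

/-! ### Discrete random variables and their supports. -/

section Discrete

variable {Ω : Type*} [MeasurableSpace Ω] {P : Measure Ω} [IsProbabilityMeasure P]

omit [IsProbabilityMeasure P] in
theorem discreteSupport_subset {X : Ω → ℝ} {S : Set ℝ}
    (hS : ∀ᵐ ω ∂P, X ω ∈ S) :
    discreteSupport P X ⊆ S := by
  intro x hx
  by_contra hxS
  have h0 : P {ω | X ω = x} = 0 := by
    refine measure_mono_null (fun ω hω => ?_) hS
    rw [Set.mem_ofPred_eq] at hω
    rw [Set.mem_compl_iff, Set.mem_ofPred_eq, hω]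
    exact hxS
  have : (0 : ℝ) < P.real {ω | X ω = x} := hx
  rw [measureReal_def, h0] at this
  simp at this

omit [IsProbabilityMeasure P] in
theorem countable_discreteSupport {ι : Type*} {ζ : ι → Ω → ℝ} (hζ : ∀ i, IsDiscreteRV P (ζ i))
    (i : ι) : (discreteSupport P (ζ i)).Countable := by
  obtain ⟨_, S, hS, hSP⟩ := hζ i
  exact hS.mono (discreteSupport_subset hSP)

/-- The part of the countable set `S` outside the support is a countable union of null events. -/
theorem ae_mem_discreteSupport {X : Ω → ℝ} (hX : IsDiscreteRV P X) :
    ∀ᵐ x ∂P.map X, x ∈ discreteSupport P X := by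
  obtain ⟨hm, S, hS, hSP⟩ := hX
  have hsub := discreteSupport_subset hSP
  refine (ae_map_iff (p := fun x => x ∈ discreteSupport P X) hm.aemeasurable
    (hS.mono hsub).measurableSet).2 ?_
  have h0 : P (⋃ x ∈ S \ discreteSupport P X, {ω | X ω = x}) = 0 := by
    rw [measure_biUnion_null_iff (hS.mono Set.sdiff_subset)]
    intro x hx
    have : ¬ (0 : ℝ) < P.real {ω | X ω = x} := hx.2
    rw [not_lt] at this
    exact (measureReal_eq_zero_iff).1 (le_antisymm this measureReal_nonneg)
  have h1 : ∀ᵐ ω ∂P, ω ∉ ⋃ x ∈ S \ discreteSupport P X, {ω | X ω = x} :=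
    measure_eq_zero_iff_ae_notMem.1 h0
  filter_upwards [hSP, h1] with ω hω hω1
  by_contra hn
  exact hω1 (Set.mem_biUnion (show X ω ∈ S \ discreteSupport P X from ⟨hω, hn⟩) rfl)

end Discrete

end QuadLO

theorem theorem1p2 (δ : ℝ) (hδ0 : 0 < δ) (hδ1 : δ < 1) :
    ∃ C : ℝ, ∀ (n : ℕ) (Q : MvPolynomial (Fin n) ℝ), Q.totalDegree ≤ 2 →
      ∀ (Ω : Type*) [MeasurableSpace Ω] (P : Measure Ω) [IsProbabilityMeasure P]
        (ζ : Fin n → Ω → ℝ),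
        (∀ i, QuadLO.IsDiscreteRV P (ζ i)) → iIndepFun ζ P →
        ∀ m : ℕ, 0 < m →
          (∀ R : Fin n → Set ℝ, QuadLO.IsFixingBox P ζ Q R →
            m ≤ Set.ncard {i : Fin n | P.real {ω | ζ i ω ∈ R i} ≤ 1 - δ}) →
          (⨆ z : ℝ, P.real {ω | MvPolynomial.eval (fun i => ζ i ω) Q = z}) ≤
            C / Real.sqrt m := by
  -- The coupling through an atom needs mass at least 1/2. Lowering δ raises the threshold 1 - δ, so
  -- at least as many directions are counted and the hypothesis persists.
  have hδ' : 0 < min δ (1 / 2) := lt_min hδ0 (by norm_num)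
  obtain ⟨C, hC0, hC⟩ := QuadLO.exists_measure_quad_le hδ' (min_le_right _ _)
  refine ⟨C, ?_⟩
  intro n Q hQ Ω _ P _ ζ hζ hind m hm hbox
  have hm0 : (0 : ℝ) < m := by exact_mod_cast hm
  refine ciSup_le fun z => ?_
  obtain ⟨B, hB, b, c, hquad⟩ := QuadLO.exists_eval_eq_quad Q hQ
  have hmeas : ∀ i, Measurable (ζ i) := fun i => (hζ i).1
  have hprob : ∀ i, IsProbabilityMeasure (P.map (ζ i)) := fun i =>
    Measure.isProbabilityMeasure_map (hmeas i).aemeasurable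
  have hcount := QuadLO.countable_discreteSupport hζ
  -- The value z is absorbed into the constant term, so only zero sets matter; fixing boxes are
  -- unaffected.
  have hshift : ∀ x, QuadLO.quad B b (c - z) x = QuadLO.quad B b c x - z := fun x => by
    simp only [QuadLO.quad]; ring
  have key := hC (fun i => P.map (ζ i)) (s := fun i => QuadLO.discreteSupport P (ζ i))
    (fun i => QuadLO.ae_mem_discreteSupport (hζ i)) hB b (c - z) hm
    (fun i => (hcount i).measurableSet) (by
      intro R hRn hRs hRc
      obtain ⟨v, hv⟩ := hRc
      refine (hbox R ⟨hRn, hRs, v + z, fun x hx => ?_⟩).trans (Set.ncard_le_ncard ?_ (Set.toFinite _))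
      · rw [hquad, ← hv x hx, hshift, sub_add_cancel]
      · intro i hi
        rw [Set.mem_ofPred_eq] at hi ⊢
        rw [map_measureReal_apply (hmeas i) ((hcount i).mono (hRs i)).measurableSet]
        exact hi.trans (by linarith [min_le_left δ (1 / 2)]))
  rw [← (iIndepFun_iff_map_fun_eq_pi_map fun i => (hmeas i).aemeasurable).1 hind,
    Measure.map_apply (measurable_pi_lambda _ hmeas) (measurableSet_eq_fun
      (QuadLO.measurable_quad B b (c - z)) measurable_const)] at key
  refine ENNReal.toReal_le_of_le_ofReal (by positivity) (le_of_eq_of_le ?_ key)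
  congr 1
  ext ω
  rw [Set.mem_ofPred_eq, Set.mem_preimage, Set.mem_ofPred_eq, hshift, hquad, sub_eq_zero]
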